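/- **Theorem (Uniqueness).** Let $n\ge 1$, let $b:[0,\infty)\to\mathbb R$ be piecewise continuous and increasing with $b\ge b_0$ for some constant $b_0>0$, and suppose that its distributional derivative on $(0,\infty)$ satisfies $b'\ge b_0'$ for some constant $b_0'>0$, i.e. $\langle b',\varphi\rangle\ge b_0'\int\varphi$ for all test functions $0\le\varphi\in C_0^\infty((0,\infty))$. Let $s>0$ and $(u_0,u_1)\in H^s(\mathbb R^n)\times H^{s-1}(\mathbb R^n)$. Write $\mathbb R_+=[0,\infty)$. The Colombeau algebra $\mathcal G(\mathbb R_+)$ is the quotient of the moderate nets by the negligible nets. A net $(f_\varepsilon)_{\varepsilon\in(0,1]}\subset C^\infty([0,\infty))$ is moderate if for every compact $K\subset[0,\infty)$ and $\alpha\in\mathbb N_0$ there are $N\in\mathbb N_0$ and $c>0$ with $\sup_K|\partial^\alpha f_\varepsilon|\le c\,\varepsilon^{-N-\alpha}$ for all $\varepsilon\in(0,1]$. It is negligible if for all $K$, $\alpha$ and $\ell\in\mathbb N_0$ there is $c>0$ with $\sup_K|\partial^\alpha f_\varepsilon|\le c\,\varepsilon^{\ell}$ for all $\varepsilon\in(0,1]$.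 Likewise, $\mathcal G(\mathbb R_+;H^s)$ is the space of moderate nets $(u_\varepsilon)_{\varepsilon\in(0,1]}\subset\bigcap_k C^k([0,\infty);H^{s-k})$ (for every compact $K\subset[0,\infty)$ there is $N$ such that for every $k\in\mathbb N_0$ there is $c_k$ with $\sup_{t\in K}\|\partial_t^ku_\varepsilon(t)\|_{H^{s-k}}\le c_k\varepsilon^{-N-k}$ for all $\varepsilon$) modulo negligible ones (for all $K$, $k$, $p$ there is $c$ with $\sup_{t\in K}\|\partial_t^ku_\varepsilon(t)\|_{H^{s-k}}\le c\,\varepsilon^{p}$ for all $\varepsilon$). Then there is an embedding of $b$ and $b'$ into $\mathcal G(\mathbb R_+)$ such that the Cauchy problem $$\partial_t^2u-\Delta_xu+\frac{b'(t)}{b(t)}\,\partial_tu=0\ \text{ on }\ [0,\infty)\times\mathbb R^n,\qquad u(0,\cdot)=u_0,\quad \partial_tu(0,\cdot)=u_1,$$ has a unique solution $u\in\mathcal G(\mathbb R_+;H^s)$. Here: * The embedding is an injective linear map $\iota$ into $\mathcal G(\mathbb R_+)$ from the space of distributions $f+g'$ on $(0,\infty)$ with $f,g\in L^1_{\rm loc}([0,\infty))$,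 which contains $b$ and $b'$. It is given by regularisation, $\iota(T)=[(T*\psi_\varepsilon)_\varepsilon]$ with $\psi_\varepsilon(t)=\varepsilon^{-1}\psi(t/\varepsilon)$, for some Friedrichs mollifier $\psi\in C_0^\infty(\mathbb R)$, $\psi\ge0$, $\int\psi=1$, supported in $(-\infty,0)$. * $u\in\mathcal G(\mathbb R_+;H^s)$ is a solution if there are representatives $(u_\varepsilon)$ of $u$, $(b_\varepsilon)$ of $\iota(b)$ and $(b'_\varepsilon)$ of $\iota(b')$, with $b_\varepsilon(t)\neq0$ for all $t\ge 0$, such that for every $\varepsilon\in(0,1]$ $$\partial_t^2u_\varepsilon-\Delta_xu_\varepsilon+\frac{b'_\varepsilon(t)}{b_\varepsilon(t)}\,\partial_tu_\varepsilon=0,\qquad u_\varepsilon(0,\cdot)=u_0,\quad\partial_tu_\varepsilon(0,\cdot)=u_1 .$$ -/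

import Mathlib

open Set MeasureTheory Topology TopologicalSpace TemperedDistribution
open scoped ContDiff Distributions SchwartzMap Laplacian LineDeriv

noncomputable section

/-! ### Parameters -/

/-- The parameter range `ε ∈ (0, 1]` of nets. -/
abbrev Eps : Type := Set.Ioc (0 : ℝ) 1

/-! ### The Colombeau algebra `𝒢(ℝ₊)` on `ℝ₊ = [0, ∞)`

A smooth function on `[0, ∞)` is represented by a function on `ℝ` that is smooth on `[0, ∞)`
(with one-sided derivatives at `0`); its values at negative times are irrelevant, since two
representatives that agree on `[0, ∞)` differ by a negligible net. -/

/-- `C^∞`-moderate nets of smooth functions on `[0, ∞)`. -/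
def IsModerate (f : Eps → ℝ → ℝ) : Prop :=
  (∀ ε, ContDiffOn ℝ ∞ (f ε) (Ici 0)) ∧
    ∀ K : Set ℝ, IsCompact K → K ⊆ Ici 0 → ∀ α : ℕ, ∃ (N : ℕ) (c : ℝ), ∀ ε : Eps, ∀ t ∈ K,
      |iteratedDerivWithin α (f ε) (Ici 0) t| ≤ c / (ε : ℝ) ^ (N + α)

/-- The defining estimates of `C^∞`-negligible nets on `[0, ∞)`. -/
def IsNegligible (f : Eps → ℝ → ℝ) : Prop :=
  ∀ K : Set ℝ, IsCompact K → K ⊆ Ici 0 → ∀ α l : ℕ, ∃ c : ℝ, ∀ ε : Eps, ∀ t ∈ K,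
    |iteratedDerivWithin α (f ε) (Ici 0) t| ≤ c * (ε : ℝ) ^ l

lemma Eps.pos (ε : Eps) : 0 < (ε : ℝ) := ε.2.1

lemma Eps.le_one (ε : Eps) : (ε : ℝ) ≤ 1 := ε.2.2

lemma Eps.div_pow_mono {c : ℝ} (ε : Eps) {m n : ℕ} (h : m ≤ n) :
    c / (ε : ℝ) ^ m ≤ |c| / (ε : ℝ) ^ n := by
  have h1 : (ε : ℝ) ^ n ≤ (ε : ℝ) ^ m := pow_le_pow_of_le_one ε.pos.le ε.le_one h
  have h2 : 0 < (ε : ℝ) ^ n := pow_pos ε.pos n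
  calc c / (ε : ℝ) ^ m ≤ |c| / (ε : ℝ) ^ m := by
        have := pow_pos ε.pos m
        gcongr
        exact le_abs_self c
    _ ≤ |c| / (ε : ℝ) ^ n := by gcongr

/-- The Leibniz estimate for products of smooth functions on `[0, ∞)`. -/
lemma abs_iteratedDerivWithin_mul_le {f g : ℝ → ℝ} (hf : ContDiffOn ℝ ∞ f (Ici 0))
    (hg : ContDiffOn ℝ ∞ g (Ici 0)) (α : ℕ) {t : ℝ} (ht : t ∈ Ici (0 : ℝ)) :
    |iteratedDerivWithin α (f * g) (Ici 0) t| ≤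
      ∑ i ∈ Finset.range (α + 1), (α.choose i : ℝ) * |iteratedDerivWithin i f (Ici 0) t| *
        |iteratedDerivWithin (α - i) g (Ici 0) t| := by
  have h := norm_iteratedFDerivWithin_mul_le (𝕜 := ℝ) (N := ∞) (n := α) hf hg
    (uniqueDiffOn_Ici (0 : ℝ)) ht (by exact_mod_cast le_top)
  simp only [norm_iteratedFDerivWithin_eq_norm_iteratedDerivWithin, Real.norm_eq_abs] at h
  exact h

lemma iteratedDerivWithin_add_of_smooth {f g : ℝ → ℝ} (hf : ContDiffOn ℝ ∞ f (Ici 0))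
    (hg : ContDiffOn ℝ ∞ g (Ici 0)) (α : ℕ) {t : ℝ} (ht : t ∈ Ici (0 : ℝ)) :
    iteratedDerivWithin α (f + g) (Ici 0) t =
      iteratedDerivWithin α f (Ici 0) t + iteratedDerivWithin α g (Ici 0) t :=
  iteratedDerivWithin_add ht (uniqueDiffOn_Ici (0 : ℝ))
    ((hf.of_le (by exact_mod_cast le_top)) t ht) ((hg.of_le (by exact_mod_cast le_top)) t ht)

lemma IsModerate.add {f g : Eps → ℝ → ℝ} (hf : IsModerate f) (hg : IsModerate g) :
    IsModerate (f + g) := by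
  refine ⟨fun ε => (hf.1 ε).add (hg.1 ε), fun K hK hK0 α => ?_⟩
  obtain ⟨N, c, h⟩ := hf.2 K hK hK0 α
  obtain ⟨M, d, h'⟩ := hg.2 K hK hK0 α
  refine ⟨N + M, |c| + |d|, fun ε t ht => ?_⟩
  rw [Pi.add_apply, iteratedDerivWithin_add_of_smooth (hf.1 ε) (hg.1 ε) α (hK0 ht), add_div]
  exact (abs_add_le _ _).trans (add_le_add
    ((h ε t ht).trans (Eps.div_pow_mono ε (by omega)))
    ((h' ε t ht).trans (Eps.div_pow_mono ε (by omega))))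

lemma IsModerate.mul {f g : Eps → ℝ → ℝ} (hf : IsModerate f) (hg : IsModerate g) :
    IsModerate (f * g) := by
  refine ⟨fun ε => (hf.1 ε).mul (hg.1 ε), fun K hK hK0 α => ?_⟩
  choose N c h using hf.2 K hK hK0
  choose M d h' using hg.2 K hK hK0
  refine ⟨∑ i ∈ Finset.range (α + 1), (N i + M (α - i)),
    ∑ i ∈ Finset.range (α + 1), (α.choose i : ℝ) * |c i| * |d (α - i)|, fun ε t ht => ?_⟩
  refine (abs_iteratedDerivWithin_mul_le (hf.1 ε) (hg.1 ε) α (hK0 ht)).trans ?_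
  rw [Finset.sum_div]
  refine Finset.sum_le_sum fun i hi => ?_
  have hi' : i ≤ α := by simpa [Nat.lt_succ_iff] using hi
  have h1 : N i + M (α - i) ≤ ∑ j ∈ Finset.range (α + 1), (N j + M (α - j)) :=
    Finset.single_le_sum (f := fun j => N j + M (α - j)) (fun _ _ => Nat.zero_le _) hi
  have e1 := (h i ε t ht).trans (Eps.div_pow_mono ε le_rfl)
  have e2 := (h' (α - i) ε t ht).trans (Eps.div_pow_mono ε le_rfl)
  have hε := ε.pos
  calc (α.choose i : ℝ) * |iteratedDerivWithin i (f ε) (Ici 0) t| *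
        |iteratedDerivWithin (α - i) (g ε) (Ici 0) t|
      ≤ (α.choose i : ℝ) * (|c i| / (ε : ℝ) ^ (N i + i)) *
          (|d (α - i)| / (ε : ℝ) ^ (M (α - i) + (α - i))) := by gcongr
    _ = ((α.choose i : ℝ) * |c i| * |d (α - i)|) /
          (ε : ℝ) ^ ((N i + i) + (M (α - i) + (α - i))) := by
        rw [pow_add (ε : ℝ) (N i + i)]; field_simp
    _ ≤ abs ((α.choose i : ℝ) * |c i| * |d (α - i)|) /
          (ε : ℝ) ^ (∑ j ∈ Finset.range (α + 1), (N j + M (α - j)) + α) :=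
        Eps.div_pow_mono ε (by omega)
    _ = _ := by rw [abs_of_nonneg (by positivity)]

lemma IsModerate.const (r : ℝ) : IsModerate (fun _ _ => r) := by
  refine ⟨fun ε => contDiffOn_const, fun K hK hK0 α => ⟨0, |r|, fun ε t ht => ?_⟩⟩
  have hε := ε.pos
  have h1 : (ε : ℝ) ^ (0 + α) ≤ 1 := pow_le_one₀ hε.le ε.le_one
  rw [iteratedDerivWithin_const]
  rw [le_div_iff₀ (by positivity)]
  split_ifs
  · exact mul_le_of_le_one_right (abs_nonneg _) h1
  · simp

/-- The algebra of `C^∞`-moderate nets on `[0, ∞)`. -/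
def moderateNets : Subalgebra ℝ (Eps → ℝ → ℝ) where
  carrier := {f | IsModerate f}
  mul_mem' := IsModerate.mul
  add_mem' := IsModerate.add
  algebraMap_mem' r := IsModerate.const r

/-- The ideal of `C^∞`-negligible nets on `[0, ∞)`. -/
def negligibleNets : Ideal moderateNets where
  carrier := {f | IsNegligible (f : Eps → ℝ → ℝ)}
  zero_mem' := fun K _ _ α l => ⟨0, fun ε t _ => by
    have : ((0 : moderateNets) : Eps → ℝ → ℝ) ε = fun _ => (0 : ℝ) := rfl
    rw [this, iteratedDerivWithin_const]; simp⟩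
  add_mem' := by
    rintro f g hf hg K hK hK0 α l
    obtain ⟨c, h⟩ := hf K hK hK0 α l
    obtain ⟨d, h'⟩ := hg K hK hK0 α l
    refine ⟨c + d, fun ε t ht => ?_⟩
    have : ((f + g : moderateNets) : Eps → ℝ → ℝ) ε =
      (f : Eps → ℝ → ℝ) ε + (g : Eps → ℝ → ℝ) ε := rfl
    rw [this, iteratedDerivWithin_add_of_smooth (f.2.1 ε) (g.2.1 ε) α (hK0 ht), add_mul]
    exact (abs_add_le _ _).trans (add_le_add (h ε t ht) (h' ε t ht))
  smul_mem' := by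
    rintro f g hg K hK hK0 α l
    choose N c h using f.2.2 K hK hK0
    choose d h' using fun a => hg K hK hK0 (α - a) (l + (N a + a))
    refine ⟨∑ i ∈ Finset.range (α + 1), (α.choose i : ℝ) * |c i| * |d i|, fun ε t ht => ?_⟩
    refine (abs_iteratedDerivWithin_mul_le (f.2.1 ε) (g.2.1 ε) α (hK0 ht)).trans ?_
    rw [Finset.sum_mul]
    refine Finset.sum_le_sum fun i _ => ?_
    have hε := ε.pos
    have e1 := (h i ε t ht).trans (Eps.div_pow_mono ε le_rfl)
    have e2 : |iteratedDerivWithin (α - i) ((g : Eps → ℝ → ℝ) ε) (Ici 0) t| ≤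
        |d i| * (ε : ℝ) ^ (l + (N i + i)) :=
      (h' i ε t ht).trans (by gcongr; exact le_abs_self _)
    calc (α.choose i : ℝ) * |iteratedDerivWithin i ((f : Eps → ℝ → ℝ) ε) (Ici 0) t| *
          |iteratedDerivWithin (α - i) ((g : Eps → ℝ → ℝ) ε) (Ici 0) t|
        ≤ (α.choose i : ℝ) * (|c i| / (ε : ℝ) ^ (N i + i)) *
            (|d i| * (ε : ℝ) ^ (l + (N i + i))) := by gcongr
      _ = (α.choose i : ℝ) * |c i| * |d i| * (ε : ℝ) ^ l := by
          rw [pow_add (ε : ℝ) l]; field_simp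

/-- The Colombeau algebra `𝒢(ℝ₊)`: moderate nets modulo negligible nets. -/
abbrev ColombeauAlgebra : Type := moderateNets ⧸ negligibleNets

/-! ### Distributions on `(0, ∞)` and their regularisation -/

/-- The open half line `(0, ∞)`. -/
def halfLine : Opens ℝ := ⟨Ioi 0, isOpen_Ioi⟩

/-- The distribution `φ ↦ ∫ φ f` on `(0, ∞)` given by a locally integrable function `f`. -/
def distOf (f : ℝ → ℝ) : 𝓓'(halfLine, ℝ) :=
  TestFunction.integralAgainstBilinCLM (ContinuousLinearMap.mul ℝ ℝ) volume f

/-- The distributional derivative on `(0, ∞)`. -/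
def distDeriv (T : 𝓓'(halfLine, ℝ)) : 𝓓'(halfLine, ℝ) := ∂_{(1 : ℝ)} T

lemma distOf_apply {f : ℝ → ℝ} (hf : LocallyIntegrableOn f (Ici 0)) (φ : 𝓓(halfLine, ℝ)) :
    distOf f φ = ∫ x, φ x * f x := by
  have : LocallyIntegrableOn f (halfLine : Set ℝ) :=
    hf.mono_set (show Ioi (0 : ℝ) ⊆ Ici 0 from Ioi_subset_Ici_self)
  exact TestFunction.integralAgainstBilinCLM_eq_integral this

lemma distOf_add {f g : ℝ → ℝ} (hf : LocallyIntegrableOn f (Ici 0))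
    (hg : LocallyIntegrableOn g (Ici 0)) : distOf (f + g) = distOf f + distOf g := by
  have hs : (halfLine : Set ℝ) ⊆ Ici 0 := show Ioi (0 : ℝ) ⊆ Ici 0 from Ioi_subset_Ici_self
  ext φ
  change distOf (f + g) φ = distOf f φ + distOf g φ
  have hf' : Integrable (fun x => φ x * f x) :=
    TestFunction.integrable_bilin (ContinuousLinearMap.mul ℝ ℝ) (hf.mono_set hs) φ
  have hg' : Integrable (fun x => φ x * g x) :=
    TestFunction.integrable_bilin (ContinuousLinearMap.mul ℝ ℝ) (hg.mono_set hs) φ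
  rw [distOf_apply (hf.add hg), distOf_apply hf, distOf_apply hg, ← integral_add hf' hg']
  simp only [Pi.add_apply, mul_add]

lemma distOf_smul (r : ℝ) {f : ℝ → ℝ} (hf : LocallyIntegrableOn f (Ici 0)) :
    distOf (r • f) = r • distOf f := by
  ext φ
  change distOf (r • f) φ = r • distOf f φ
  rw [distOf_apply (hf.smul r), distOf_apply hf, smul_eq_mul, ← integral_const_mul]
  congr 1
  ext x
  simp only [Pi.smul_apply, smul_eq_mul]
  ring

/-- The space of distributions `f + g'` on `(0, ∞)` with `f`, `g` locally integrable on
`[0, ∞)`. -/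
def firstOrderDist : Submodule ℝ 𝓓'(halfLine, ℝ) where
  carrier := {T | ∃ f g : ℝ → ℝ, LocallyIntegrableOn f (Ici 0) ∧ LocallyIntegrableOn g (Ici 0) ∧
    T = distOf f + distDeriv (distOf g)}
  zero_mem' := by
    have h0 : LocallyIntegrableOn (0 : ℝ → ℝ) (Ici 0) := locallyIntegrable_zero.locallyIntegrableOn _
    have e : distOf (0 : ℝ → ℝ) = 0 := by simpa using distOf_smul 0 h0
    refine ⟨0, 0, h0, h0, ?_⟩
    rw [e, distDeriv, LineDeriv.lineDerivOp_zero, add_zero]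
  add_mem' := by
    rintro _ _ ⟨f, g, hf, hg, rfl⟩ ⟨f', g', hf', hg', rfl⟩
    refine ⟨f + f', g + g', hf.add hf', hg.add hg', ?_⟩
    rw [distOf_add hf hf', distOf_add hg hg']
    simp only [distDeriv, LineDeriv.lineDerivOp_add]
    abel
  smul_mem' := by
    rintro r _ ⟨f, g, hf, hg, rfl⟩
    refine ⟨r • f, r • g, hf.smul r, hg.smul r, ?_⟩
    rw [distOf_smul r hf, distOf_smul r hg]
    simp only [distDeriv, LineDeriv.lineDerivOp_smul, smul_add]

/-- A function `b` that is locally integrable on `[0, ∞)`, as an element of `firstOrderDist`. -/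
def coeffDist (b : ℝ → ℝ) (hb : LocallyIntegrableOn b (Ici 0)) : firstOrderDist :=
  ⟨distOf b, b, 0, hb, locallyIntegrable_zero.locallyIntegrableOn _, by
    have e : distOf (0 : ℝ → ℝ) = 0 := by
      simpa using distOf_smul 0 hb
    rw [e, distDeriv, LineDeriv.lineDerivOp_zero, add_zero]⟩

/-- The distributional derivative `b'` on `(0, ∞)`, as an element of `firstOrderDist`. -/
def coeffDerivDist (b : ℝ → ℝ) (hb : LocallyIntegrableOn b (Ici 0)) : firstOrderDist :=
  ⟨distDeriv (distOf b), 0, b, locallyIntegrable_zero.locallyIntegrableOn _, hb, by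
    have e : distOf (0 : ℝ → ℝ) = 0 := by
      simpa using distOf_smul 0 hb
    rw [e, zero_add]⟩

/-- A monotone function on `[0, ∞)` is locally integrable there. -/
lemma locallyIntegrableOn_of_monotoneOn {b : ℝ → ℝ} (hb : MonotoneOn b (Ici 0)) :
    LocallyIntegrableOn b (Ici 0) := by
  rw [locallyIntegrableOn_iff isClosed_Ici.isLocallyClosed]
  intro K hK0 hK
  exact (hb.mono hK0).integrableOn_isCompact hK

/-- A Friedrichs mollifier: a nonnegative test function with integral one. It is supported in
`(-∞, 0)`, so that the convolution of a distribution on `(0, ∞)` with `ψ_ε` makes sense on all of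
`[0, ∞)`. -/
structure Mollifier where
  toFun : ℝ → ℝ
  smooth : ContDiff ℝ ∞ toFun
  compactSupport : HasCompactSupport toFun
  nonneg : ∀ x, 0 ≤ toFun x
  integral_eq_one : ∫ x, toFun x = 1
  tsupport_subset : tsupport toFun ⊆ Iio 0

/-- The test function `τ ↦ ψ_ε (t - τ)` on `(0, ∞)`, where `ψ_ε (x) = ε⁻¹ ψ (x / ε)` and `t ≥ 0`. -/
def Mollifier.kernel (ψ : Mollifier) (ε : Eps) (t : ℝ) (ht : 0 ≤ t) : 𝓓(halfLine, ℝ) where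
  toFun τ := (ε : ℝ)⁻¹ * ψ.toFun ((t - τ) / ε)
  contDiff' := contDiff_const.mul
    (ψ.smooth.comp ((contDiff_const.sub contDiff_id).div_const (ε : ℝ)))
  hasCompactSupport' := by
    have h : HasCompactSupport (fun τ => ψ.toFun ((t - τ) / ε)) := by
      simp only [div_eq_mul_inv]
      exact ψ.compactSupport.comp_homeomorph
        ((Homeomorph.subLeft t).trans (Homeomorph.mulRight₀ (ε : ℝ)⁻¹ (inv_ne_zero ε.pos.ne')))
    exact h.mul_left
  tsupport_subset' := by
    intro τ hτ
    have h1 : τ ∈ tsupport (fun τ => ψ.toFun ((t - τ) / ε)) :=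
      tsupport_mul_subset_right hτ
    have h2 : (t - τ) / ε ∈ tsupport ψ.toFun :=
      tsupport_comp_subset_preimage ψ.toFun (f := fun τ => (t - τ) / (ε : ℝ)) (by fun_prop) h1
    have h3 : (t - τ) / (ε : ℝ) < 0 := ψ.tsupport_subset h2
    have h4 : t - τ < 0 := by
      by_contra h
      exact absurd h3 (not_lt.2 (div_nonneg (not_lt.1 h) ε.pos.le))
    show 0 < τ
    linarith

/-- The linear map `ι` is the regularisation `T ↦ [(T * ψ_ε)_ε]` by the mollifier `ψ`. -/
def IsRegularisation (ψ : Mollifier) (ι : firstOrderDist →ₗ[ℝ] ColombeauAlgebra) : Prop :=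
  ∀ T : firstOrderDist, ∃ f : moderateNets, ι T = Ideal.Quotient.mk negligibleNets f ∧
    ∀ (ε : Eps) (t : ℝ) (ht : 0 ≤ t),
      (f : Eps → ℝ → ℝ) ε t = (T : 𝓓'(halfLine, ℝ)) (ψ.kernel ε t ht)

/-! ### The Sobolev spaces `H^s(ℝⁿ)` -/

/-- `H^s(ℝⁿ)`, the space of tempered distributions `u` with `⟨D⟩^s u ∈ L²`. -/
@[ext]
structure Sobolev (n : ℕ) (s : ℝ) where
  val : 𝓢'(EuclideanSpace ℝ (Fin n), ℂ)
  mem : MemSobolev s 2 val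

namespace Sobolev

variable {n : ℕ} {s : ℝ}

instance : Zero (Sobolev n s) := ⟨⟨0, memSobolev_fun_zero _ _ s 2⟩⟩

instance : Add (Sobolev n s) := ⟨fun u v => ⟨u.val + v.val, u.mem.add v.mem⟩⟩

instance : Neg (Sobolev n s) := ⟨fun u => ⟨-u.val, u.mem.neg⟩⟩

instance : Sub (Sobolev n s) := ⟨fun u v => ⟨u.val - v.val, u.mem.sub v.mem⟩⟩

instance : SMul ℂ (Sobolev n s) := ⟨fun c u => ⟨c • u.val, u.mem.smul c⟩⟩

lemma val_injective : Function.Injective (val : Sobolev n s → _) := fun _ _ h => Sobolev.ext h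

instance : AddCommGroup (Sobolev n s) where
  add_assoc _ _ _ := val_injective (add_assoc _ _ _)
  zero_add _ := val_injective (zero_add _)
  add_zero _ := val_injective (add_zero _)
  nsmul := nsmulRec
  zsmul := zsmulRec
  neg_add_cancel _ := val_injective (neg_add_cancel _)
  add_comm _ _ := val_injective (add_comm _ _)
  sub_eq_add_neg _ _ := val_injective (sub_eq_add_neg _ _)

instance : Module ℂ (Sobolev n s) where
  one_smul u := val_injective (one_smul ℂ u.val)
  mul_smul a b u := val_injective (mul_smul a b u.val)
  smul_zero a := val_injective (smul_zero (A := 𝓢'(EuclideanSpace ℝ (Fin n), ℂ)) a)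
  smul_add a u v := val_injective (smul_add a u.val v.val)
  add_smul a b u := val_injective (add_smul a b u.val)
  zero_smul u := val_injective (zero_smul ℂ u.val)

/-- The tempered distribution underlying an element of `H^s`. -/
def toDist : Sobolev n s →ₗ[ℂ] 𝓢'(EuclideanSpace ℝ (Fin n), ℂ) where
  toFun := val
  map_add' _ _ := rfl
  map_smul' _ _ := rfl

lemma toDist_injective : Function.Injective (toDist : Sobolev n s →ₗ[ℂ] _) := val_injective

lemma memSobolev_toDist (u : Sobolev n s) : MemSobolev s 2 (toDist u) := u.mem

/-- The `L²` function representing `⟨D⟩^s u`. -/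
def besselFun (u : Sobolev n s) : Lp ℂ 2 (volume : Measure (EuclideanSpace ℝ (Fin n))) :=
  u.memSobolev_toDist.choose

lemma besselFun_spec (u : Sobolev n s) :
    besselPotential _ ℂ s (toDist u) = (besselFun u : 𝓢'(EuclideanSpace ℝ (Fin n), ℂ)) :=
  u.memSobolev_toDist.choose_spec

lemma lp_eq_of_dist_eq {f g : Lp ℂ 2 (volume : Measure (EuclideanSpace ℝ (Fin n)))}
    (h : (f : 𝓢'(EuclideanSpace ℝ (Fin n), ℂ)) = (g : 𝓢'(EuclideanSpace ℝ (Fin n), ℂ))) :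
    f = g :=
  LinearMap.ker_eq_bot.1 (MeasureTheory.Lp.ker_toTemperedDistributionCLM_eq_bot
    (F := ℂ) (μ := (volume : Measure (EuclideanSpace ℝ (Fin n)))) (p := 2)) h

/-- The Bessel isometry `u ↦ ⟨D⟩^s u` from `H^s` to `L²`. -/
def besselMap : Sobolev n s →ₗ[ℂ] Lp ℂ 2 (volume : Measure (EuclideanSpace ℝ (Fin n))) where
  toFun := besselFun
  map_add' u v := by
    apply lp_eq_of_dist_eq
    rw [← besselFun_spec, ← Lp.toTemperedDistributionCLM_apply, map_add, map_add, map_add,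
      besselFun_spec, besselFun_spec]
    rfl
  map_smul' c u := by
    apply lp_eq_of_dist_eq
    rw [← besselFun_spec, ← Lp.toTemperedDistributionCLM_apply, map_smul, map_smul, map_smul,
      besselFun_spec]
    rfl

lemma besselMap_injective : Function.Injective (besselMap : Sobolev n s →ₗ[ℂ] _) := by
  intro u v h
  apply toDist_injective
  have h1 : besselPotential _ ℂ s (toDist u) = besselPotential _ ℂ s (toDist v) := by
    rw [besselFun_spec, besselFun_spec]
    exact congrArg _ h
  have h2 := congrArg (besselPotential _ ℂ (-s)) h1
  simpa using h2

/-- The norm `‖u‖_{H^s} = ‖⟨D⟩^s u‖_{L²}`, with `⟨D⟩^s` the Fourier multiplier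
`(1 + |ξ|²)^{s/2}`. -/
instance : NormedAddCommGroup (Sobolev n s) :=
  NormedAddCommGroup.induced (Sobolev n s)
    (Lp ℂ 2 (volume : Measure (EuclideanSpace ℝ (Fin n)))) besselMap besselMap_injective

instance : NormedSpace ℂ (Sobolev n s) :=
  NormedSpace.induced ℂ (Sobolev n s)
    (Lp ℂ 2 (volume : Measure (EuclideanSpace ℝ (Fin n)))) besselMap

lemma norm_def (u : Sobolev n s) : ‖u‖ = ‖besselFun u‖ := rfl

/-- The inclusion `H^s ⊆ H^{s-k}`. -/
def lower (k : ℕ) (u : Sobolev n s) : Sobolev n (s - k) :=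
  ⟨toDist u, u.memSobolev_toDist.mono (by simp)⟩

lemma toDist_lower (k : ℕ) (u : Sobolev n s) : toDist (lower k u) = toDist u := rfl

lemma lower_add (k : ℕ) (u v : Sobolev n s) : lower k (u + v) = lower k u + lower k v := by
  apply toDist_injective
  rw [map_add, toDist_lower, toDist_lower, toDist_lower, map_add]

lemma lower_neg (k : ℕ) (u : Sobolev n s) : lower k (-u) = -lower k u := by
  apply toDist_injective
  rw [map_neg, toDist_lower, toDist_lower, map_neg]

lemma lower_zero (k : ℕ) : lower k (0 : Sobolev n s) = 0 := by
  apply toDist_injective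
  rw [map_zero, toDist_lower, map_zero]

/-- `u ∈ C^k([0, ∞); H^{s-k})` for all `k`. -/
def IsSmoothCurve (u : ℝ → Sobolev n s) : Prop :=
  ∀ k : ℕ, ContDiffOn ℝ k (fun t => lower k (u t)) (Ici 0)

/-- The time derivative `∂_t^k u` on `[0, ∞)`, with values in `H^{s-k}`. -/
def timeDeriv (k : ℕ) (u : ℝ → Sobolev n s) : ℝ → Sobolev n (s - k) :=
  iteratedDerivWithin k (fun t => lower k (u t)) (Ici 0)

lemma IsSmoothCurve.add {u v : ℝ → Sobolev n s} (hu : IsSmoothCurve u) (hv : IsSmoothCurve v) :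
    IsSmoothCurve (u + v) := fun k => by
  simp only [Pi.add_apply, lower_add]
  exact (hu k).add (hv k)

lemma IsSmoothCurve.neg {u : ℝ → Sobolev n s} (hu : IsSmoothCurve u) :
    IsSmoothCurve (-u) := fun k => by
  simp only [Pi.neg_apply, lower_neg]
  exact (hu k).neg

lemma timeDeriv_add {u v : ℝ → Sobolev n s} (hu : IsSmoothCurve u) (hv : IsSmoothCurve v)
    (k : ℕ) {t : ℝ} (ht : t ∈ Ici (0 : ℝ)) :
    timeDeriv k (u + v) t = timeDeriv k u t + timeDeriv k v t := by
  simp only [timeDeriv, Pi.add_apply, lower_add]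
  exact iteratedDerivWithin_fun_add ht (uniqueDiffOn_Ici (0 : ℝ)) (hu k t ht) (hv k t ht)

lemma timeDeriv_neg (u : ℝ → Sobolev n s) (k : ℕ) (t : ℝ) :
    timeDeriv k (-u) t = -timeDeriv k u t := by
  simp only [timeDeriv, Pi.neg_apply, lower_neg]
  exact iteratedDerivWithin_fun_neg _

lemma timeDeriv_zero (k : ℕ) (t : ℝ) : timeDeriv k (0 : ℝ → Sobolev n s) t = 0 := by
  simp only [timeDeriv, Pi.zero_apply, lower_zero, iteratedDerivWithin_const, ite_self]

end Sobolev

open Sobolev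

/-! ### The space `𝒢(ℝ₊; H^s)` -/

/-- Moderate nets in `⋂_k C^k([0, ∞); H^{s-k})`: on each compact set of times,
`‖∂_t^k u_ε(t)‖_{H^{s-k}} ≤ c_k ε^{-N-k}`. -/
def IsModerateSobolev {n : ℕ} {s : ℝ} (u : Eps → ℝ → Sobolev n s) : Prop :=
  (∀ ε, IsSmoothCurve (u ε)) ∧
    ∀ K : Set ℝ, IsCompact K → K ⊆ Ici 0 → ∃ N : ℕ, ∀ k : ℕ, ∃ c : ℝ, ∀ ε : Eps, ∀ t ∈ K,
      ‖timeDeriv k (u ε) t‖ ≤ c / (ε : ℝ) ^ (N + k)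

/-- The group of moderate nets. -/
def moderateSobolevNets (n : ℕ) (s : ℝ) : AddSubgroup (Eps → ℝ → Sobolev n s) where
  carrier := {u | IsModerateSobolev u}
  zero_mem' := ⟨fun _ k => by
    simp only [Pi.zero_apply, Sobolev.lower_zero]
    exact contDiffOn_const, fun _ _ _ => ⟨0, fun k => ⟨0, fun ε t _ => by
    rw [Pi.zero_apply, timeDeriv_zero]; simp⟩⟩⟩
  add_mem' := by
    rintro u v ⟨hu, hu'⟩ ⟨hv, hv'⟩
    refine ⟨fun ε => (hu ε).add (hv ε), fun K hK hK0 => ?_⟩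
    obtain ⟨N, h⟩ := hu' K hK hK0
    obtain ⟨M, h'⟩ := hv' K hK hK0
    refine ⟨N + M, fun k => ?_⟩
    obtain ⟨c, hc⟩ := h k
    obtain ⟨d, hd⟩ := h' k
    refine ⟨|c| + |d|, fun ε t ht => ?_⟩
    rw [Pi.add_apply, timeDeriv_add (hu ε) (hv ε) k (hK0 ht), add_div]
    exact (norm_add_le _ _).trans (add_le_add
      ((hc ε t ht).trans (Eps.div_pow_mono ε (by omega)))
      ((hd ε t ht).trans (Eps.div_pow_mono ε (by omega))))
  neg_mem' := by
    rintro u ⟨hu, hu'⟩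
    refine ⟨fun ε => (hu ε).neg, fun K hK hK0 => ?_⟩
    obtain ⟨N, h⟩ := hu' K hK hK0
    refine ⟨N, fun k => ?_⟩
    obtain ⟨c, hc⟩ := h k
    refine ⟨c, fun ε t ht => ?_⟩
    rw [Pi.neg_apply, timeDeriv_neg, norm_neg]
    exact hc ε t ht

/-- The `C^∞(ℝ₊; H^s)`-negligible nets. -/
def negligibleSobolevNets (n : ℕ) (s : ℝ) : AddSubgroup (moderateSobolevNets n s) where
  carrier := {u | ∀ K : Set ℝ, IsCompact K → K ⊆ Ici 0 → ∀ k p : ℕ, ∃ c : ℝ,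
    ∀ ε : Eps, ∀ t ∈ K, ‖timeDeriv k ((u : Eps → ℝ → Sobolev n s) ε) t‖ ≤ c * (ε : ℝ) ^ p}
  zero_mem' := fun _ _ _ k p => ⟨0, fun ε t _ => by
    rw [AddSubgroup.coe_zero, Pi.zero_apply, timeDeriv_zero]; simp⟩
  add_mem' := by
    intro u v hu hv K hK hK0 k p
    have hu0 : IsModerateSobolev (u : Eps → ℝ → Sobolev n s) := u.2
    have hv0 : IsModerateSobolev (v : Eps → ℝ → Sobolev n s) := v.2
    obtain ⟨c, hc⟩ := hu K hK hK0 k p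
    obtain ⟨d, hd⟩ := hv K hK hK0 k p
    refine ⟨c + d, fun ε t ht => ?_⟩
    rw [AddSubgroup.coe_add, Pi.add_apply, timeDeriv_add (hu0.1 ε) (hv0.1 ε) k (hK0 ht), add_mul]
    exact (norm_add_le _ _).trans (add_le_add (hc ε t ht) (hd ε t ht))
  neg_mem' := by
    intro u hu K hK hK0 k p
    obtain ⟨c, hc⟩ := hu K hK hK0 k p
    refine ⟨c, fun ε t ht => ?_⟩
    rw [AddSubgroup.coe_neg, Pi.neg_apply, timeDeriv_neg, norm_neg]
    exact hc ε t ht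

/-- The space `𝒢(ℝ₊; H^s)`: moderate nets modulo negligible nets. -/
abbrev ColombeauSobolev (n : ℕ) (s : ℝ) : Type :=
  moderateSobolevNets n s ⧸ negligibleSobolevNets n s

/-! ### The Cauchy problem -/

/-- `u` solves `∂_t² u - Δ u + (b' / b) ∂_t u = 0` on `[0, ∞) × ℝⁿ`, `u(0) = u₀`, `∂_t u(0) = u₁`,
where `b` vanishes nowhere on `[0, ∞)`; here `b` and `b'` are two given functions of time. -/
def SolvesCauchyProblem {n : ℕ} {s : ℝ} (b b' : ℝ → ℝ)
    (u₀ u₁ : 𝓢'(EuclideanSpace ℝ (Fin n), ℂ)) (u : ℝ → Sobolev n s) : Prop :=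
  (∀ t, 0 ≤ t → b t ≠ 0) ∧
  (∀ t, 0 ≤ t → toDist (timeDeriv 2 u t) - Δ (toDist (u t)) +
    ((b' t / b t : ℝ) : ℂ) • toDist (timeDeriv 1 u t) = 0) ∧
  toDist (u 0) = u₀ ∧ toDist (timeDeriv 1 u 0) = u₁

/-- `U ∈ 𝒢(ℝ₊; H^s)` solves the Cauchy problem with coefficients `β, β' ∈ 𝒢(ℝ₊)` in place of
`b, b'`: some representatives of `U`, `β`, `β'` solve it for every `ε`. -/
def IsColombeauSolution {n : ℕ} {s : ℝ} (β β' : ColombeauAlgebra)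
    (u₀ u₁ : 𝓢'(EuclideanSpace ℝ (Fin n), ℂ)) (U : ColombeauSobolev n s) : Prop :=
  ∃ (u : moderateSobolevNets n s) (b b' : moderateNets),
    QuotientAddGroup.mk u = U ∧
    Ideal.Quotient.mk negligibleNets b = β ∧ Ideal.Quotient.mk negligibleNets b' = β' ∧
    ∀ ε : Eps, SolvesCauchyProblem ((b : Eps → ℝ → ℝ) ε) ((b' : Eps → ℝ → ℝ) ε) u₀ u₁
      ((u : Eps → ℝ → Sobolev n s) ε)

/-! ### Hypotheses on the coefficient -/

/-- `b` is piecewise continuous on `[0, ∞)`: on each `[0, T]` it has finitely many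
discontinuities, and all one-sided limits exist. -/
def IsPiecewiseContinuous (b : ℝ → ℝ) : Prop :=
  (∀ T : ℝ, {t ∈ Icc 0 T | ¬ ContinuousWithinAt b (Ici 0) t}.Finite) ∧
  (∀ t, 0 ≤ t → ∃ l, Filter.Tendsto b (𝓝[>] t) (𝓝 l)) ∧
  (∀ t, 0 < t → ∃ l, Filter.Tendsto b (𝓝[<] t) (𝓝 l))

/-- The inequality `T ≥ c` between a distribution on `(0, ∞)` and a constant. -/
def DistGE (T : 𝓓'(halfLine, ℝ)) (c : ℝ) : Prop :=
  ∀ φ : 𝓓(halfLine, ℝ), (∀ x, 0 ≤ φ x) → c * ∫ x, φ x ≤ T φ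

end

noncomputable section

/-! ### Linear ordinary differential equations -/

/-! On the Fourier side, put `X = ⟨ξ⟩^s 𝓕u`. Every `H^{s-k}` becomes the same space `L²`, the
inclusion `H^s ⊆ H^{s-1}` becomes the contraction `M` (multiplication by `⟨ξ⟩⁻¹`), and `∂_t^k u`
becomes the `k`-th derivative of `M^k X`. Since `-Δ` has the symbol `(2π|ξ|)²`, the equation, read
in `H^{s-2}`, says `(M²X)'' + q (1 - M²) X + a M (MX)' = 0` with `q = (2π)²` and `a = b'_ε / b_ε`
(`wave_equation_iff`).

Everything rests on the energy `q‖X‖² + ‖Y‖²`, where `Y = (MX)'`. The unbounded operator `M⁻¹` is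
symmetric, so the principal terms cancel, and `a ≥ 0` makes the damping term harmless. Hence the
Gronwall constant depends on `q` and the time interval only, not on `ε`, although `a` need not stay
bounded as `ε → 0` (`CutoffInverse.energy_le`).

Existence: frequency cutoffs turn the equation into a linear ODE with bounded operators, and the
energy estimate makes the cutoff solutions uniformly Cauchy on each `[0, T]`
(`CutoffInverse.exists_solution`). The energy bounds `X` and `Y` uniformly in `ε`. Higher
derivatives come from the equation multiplied by `b_ε`. As `b` is locally bounded, the `l`-th
derivatives of `b_ε` and `b'_ε` are `O(ε^{-l})` and `O(ε^{-1-l})`, which gives `O(ε^{-k})` for the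
`k`-th derivative of the solution, hence a moderate net.

Uniqueness: two solutions may use different representatives of the coefficients. Their difference
solves the equation with zero data and a negligible right-hand side, so the energy estimate makes it
and its first derivative negligible, and the equation passes this on to all derivatives
(`CutoffInverse.netBound_sub`). Arbitrary representatives satisfy `b_ε ≥ b₀ / 2` and `b'_ε ≥ 0` on
`[0, T]` only for small `ε`; the latter is where `b₀' > 0` enters. For the remaining `ε`
moderateness suffices.

The embedding is injective because pairing `T * ψ_ε` with a test function recovers `T` up to `O(ε)`.
-/

theorem norm_integral_le_pow_succ_div_factorial {E : Type*} [NormedAddCommGroup E]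
    [NormedSpace ℝ E] {g : ℝ → E} {B C t : ℝ} (n : ℕ)
    (hg : ∀ τ ∈ uIoc 0 t, ‖g τ‖ ≤ C * (B * (C * |τ|) ^ n / n.factorial)) :
    ‖∫ τ in (0 : ℝ)..t, g τ‖ ≤ B * (C * |t|) ^ (n + 1) / (n + 1).factorial := by
  rw [intervalIntegral.norm_intervalIntegral_eq]
  calc ‖∫ τ in uIoc 0 t, g τ‖ ≤ ∫ τ in uIoc 0 t, C ^ (n + 1) * B / n.factorial * |τ - 0| ^ n := by
        refine norm_integral_le_of_norm_le (Continuous.integrableOn_uIoc (by fun_prop)) ?_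
        refine (ae_restrict_mem measurableSet_uIoc).mono fun τ hτ => (hg τ hτ).trans (le_of_eq ?_)
        rw [sub_zero, mul_pow]; ring
    _ = B * (C * |t|) ^ (n + 1) / (n + 1).factorial := by
        rw [integral_const_mul, integral_pow_abs_sub_uIoc, sub_zero, Nat.factorial_succ]
        push_cast
        field_simp
        ring

/-- The solution is the sum of the iterated integrals of `A` applied to `x₀`. On a bounded interval
its terms are dominated by an exponential series, so it may be differentiated termwise. -/
theorem exists_hasDerivAt_clm_apply {E : Type*} [NormedAddCommGroup E] [NormedSpace ℝ E]
    [CompleteSpace E] {A : ℝ → E →L[ℝ] E} (hA : Continuous A) (x₀ : E) :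
    ∃ x : ℝ → E, x 0 = x₀ ∧ ∀ t, HasDerivAt x (A t (x t)) t := by
  let z : ℕ → ℝ → E := fun n => Nat.rec (fun _ => x₀) (fun _ y t => ∫ τ in (0 : ℝ)..t, A τ (y τ)) n
  have hz0 : z 0 = fun _ => x₀ := rfl
  have hzs : ∀ n, z (n + 1) = fun t => ∫ τ in (0 : ℝ)..t, A τ (z n τ) := fun n => rfl
  have hcont : ∀ n, Continuous (z n) := by
    intro n
    induction n with
    | zero => rw [hz0]; exact continuous_const
    | succ n ih =>
      rw [hzs]
      exact intervalIntegral.continuous_primitive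
        (fun a b => (hA.clm_apply ih).intervalIntegrable a b) 0
  have hder : ∀ n t, HasDerivAt (z (n + 1)) (A t (z n t)) t := fun n t => by
    rw [hzs]
    exact intervalIntegral.integral_hasDerivAt_right ((hA.clm_apply (hcont n)).intervalIntegrable _ _)
      ((hA.clm_apply (hcont n)).stronglyMeasurableAtFilter _ _) (hA.clm_apply (hcont n)).continuousAt
  have hbound : ∀ T : ℝ, ∃ C : ℝ, 0 ≤ C ∧ ∀ t, |t| ≤ T → ‖A t‖ ≤ C ∧
      ∀ n, ‖z n t‖ ≤ ‖x₀‖ * (C * |t|) ^ n / n.factorial := by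
    intro T
    obtain ⟨C, hC⟩ := (isCompact_Icc (a := -T) (b := T)).exists_bound_of_continuousOn hA.continuousOn
    have hC' : ∀ t, |t| ≤ T → ‖A t‖ ≤ |C| := fun t ht => (hC t (abs_le.1 ht)).trans (le_abs_self C)
    refine ⟨|C|, abs_nonneg C, fun t ht => ⟨hC' t ht, fun n => ?_⟩⟩
    induction n generalizing t with
    | zero => simp [hz0]
    | succ n ih =>
      rw [hzs]
      refine norm_integral_le_pow_succ_div_factorial n fun τ hτ => ?_
      have hτ' : |τ| ≤ T := by
        refine le_trans ?_ ht
        rcases le_total 0 t with h | h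
        · rw [uIoc_of_le h] at hτ
          rw [abs_of_pos hτ.1, abs_of_nonneg h]; exact hτ.2
        · rw [uIoc_of_ge h] at hτ
          rw [abs_of_nonpos hτ.2, abs_of_nonpos h]; linarith [hτ.1]
      exact (ContinuousLinearMap.le_of_opNorm_le _ (hC' τ hτ') _).trans
        (mul_le_mul_of_nonneg_left (ih τ hτ') (abs_nonneg C))
  have hz00 : ∀ n, z (n + 1) 0 = 0 := fun n => by rw [hzs]; simp
  refine ⟨fun t => ∑' n, z n t, ?_, fun t => ?_⟩
  · refine tsum_eq_single (f := fun n => z n 0) 0 ?_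
    intro n hn
    obtain ⟨m, rfl⟩ := Nat.exists_eq_succ_of_ne_zero hn
    exact hz00 m
  obtain ⟨C, hC, hCb⟩ := hbound (|t| + 1)
  have hsum : Summable fun n : ℕ => ‖x₀‖ * (C * (|t| + 1)) ^ n / n.factorial := by
    simp only [mul_div_assoc]
    exact (Real.summable_pow_div_factorial _).mul_left _
  have hle : ∀ n y, |y| ≤ |t| + 1 → ‖z n y‖ ≤ ‖x₀‖ * (C * (|t| + 1)) ^ n / n.factorial :=
    fun n y hy => ((hCb y hy).2 n).trans (by gcongr)
  have hsumz : ∀ y, |y| ≤ |t| + 1 → Summable fun n => z n y := fun y hy =>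
    Summable.of_norm_bounded hsum fun n => hle n y hy
  have hmem : t ∈ Ioo (-(|t| + 1)) (|t| + 1) := by
    rw [mem_Ioo, ← abs_lt]; linarith
  -- The tail is differentiated termwise, with its convergence anchored at time `0`, where all terms
  -- but the constant one vanish. The shift of index turns the sum of the derivatives into `A`
  -- applied to the whole series.
  have key := hasDerivAt_tsum_of_isPreconnected (g := fun n => z (n + 1))
    (g' := fun n y => A y (z n y)) (u := fun n => C * (‖x₀‖ * (C * (|t| + 1)) ^ n / n.factorial))
    (t := Ioo (-(|t| + 1)) (|t| + 1)) (y₀ := 0) (y := t) (hsum.mul_left C) isOpen_Ioo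
    isPreconnected_Ioo (fun n y _ => hder n y)
    (fun n y hy => (ContinuousLinearMap.le_of_opNorm_le _ (hCb y (abs_lt.2 hy).le).1 _).trans
      (mul_le_mul_of_nonneg_left (hle n y (abs_lt.2 hy).le) hC))
    (by constructor <;> linarith [abs_nonneg t]) (by simp [hz00, summable_zero]) hmem
  have e : (fun s => ∑' n, z n s) =ᶠ[𝓝 t] fun s => x₀ + ∑' n, z (n + 1) s := by
    filter_upwards [isOpen_Ioo.mem_nhds hmem] with s hs
    exact (hsumz s (abs_lt.2 hs).le).tsum_eq_zero_add
  have e2 : A t (∑' n, z n t) = ∑' n, A t (z n t) :=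
    (A t).map_tsum (hsumz t (by linarith))
  rw [e2]
  exact (key.const_add x₀).congr_of_eventuallyEq e

/-! ### Uniform limits of differentiable curves -/

/-- Pass to the limit in the fundamental theorem of calculus, then differentiate the resulting
integral of the continuous function `W`. -/
theorem hasDerivWithinAt_Ici_of_tendstoUniformlyOn {E : Type*} [NormedAddCommGroup E]
    [NormedSpace ℝ E] [CompleteSpace E] {z w : ℕ → ℝ → E} {Z W : ℝ → E}
    (hz : ∀ j t, 0 ≤ t → HasDerivWithinAt (z j) (w j t) (Ici 0) t)
    (hw : ∀ j, ContinuousOn (w j) (Ici 0))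
    (hZ : ∀ t, 0 ≤ t → Filter.Tendsto (fun j => z j t) Filter.atTop (𝓝 (Z t)))
    (hW : ∀ T : ℝ, TendstoUniformlyOn w W Filter.atTop (Icc 0 T)) {t : ℝ} (ht : 0 ≤ t) :
    HasDerivWithinAt Z (W t) (Ici 0) t := by
  have hWT : ∀ T, ContinuousOn W (Icc 0 T) := fun T =>
    (hW T).continuousOn (Filter.Frequently.of_forall fun j => (hw j).mono Icc_subset_Ici_self)
  have hWc : ContinuousOn W (Ici 0) := by
    intro s hs
    refine ((hWT (s + 1)) s ⟨hs, by linarith⟩).mono_of_mem_nhdsWithin ?_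
    rw [← Ici_inter_Iic]
    exact inter_mem_nhdsWithin _ (Iic_mem_nhds (by linarith))
  have hint : ∀ s, 0 ≤ s → Z s = Z 0 + ∫ τ in (0 : ℝ)..s, W τ := by
    intro s hs
    have h1 : ∀ j, z j s = z j 0 + ∫ τ in (0 : ℝ)..s, w j τ := fun j => by
      rw [intervalIntegral.integral_eq_sub_of_hasDerivAt_of_le hs
        (f := z j) (fun x hx => ((hz j x hx.1).mono Icc_subset_Ici_self).continuousWithinAt)
        (fun x hx => (hz j x hx.1.le).hasDerivAt (Ici_mem_nhds hx.1))
        (((hw j).mono (by rw [uIcc_of_le hs]; exact Icc_subset_Ici_self)).intervalIntegrable)]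
      abel
    have h2 : Filter.Tendsto (fun j => ∫ τ in (0 : ℝ)..s, w j τ) Filter.atTop
        (𝓝 (∫ τ in (0 : ℝ)..s, W τ)) := by
      refine TendstoUniformlyOn.tendsto_intervalIntegral_of_continuousOn
        (Filter.Eventually.of_forall fun j => (hw j).mono ?_) ?_
      · rw [uIcc_of_le hs]; exact Icc_subset_Ici_self
      · rw [uIcc_of_le hs]; exact hW s
    exact tendsto_nhds_unique (hZ s hs) (by simpa only [← h1] using (hZ 0 le_rfl).add h2)
  -- Freezing `W` at negative times gives a continuous function on the line, so the two-sided
  -- theorem also yields the one-sided derivative at `0`.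
  have hc : Continuous fun τ => W (max τ 0) := by
    rw [← continuousOn_univ]
    exact hWc.comp (by fun_prop) fun τ _ => mem_Ici.2 (le_max_right τ 0)
  have h3 := ((hc.integral_hasStrictDerivAt 0 t).hasDerivAt.const_add (Z 0)).hasDerivWithinAt
    (s := Ici 0)
  have h4 : ∀ s, 0 ≤ s → ∫ τ in (0 : ℝ)..s, W τ = ∫ τ in (0 : ℝ)..s, W (max τ 0) := fun s hs =>
    intervalIntegral.integral_congr fun τ hτ => by
      rw [uIcc_of_le hs] at hτ
      simp only [max_eq_left hτ.1]
  rw [max_eq_left ht] at h3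
  exact h3.congr (fun s hs => by rw [hint s hs, h4 s hs]) (by rw [hint t ht, h4 t ht])

/-! ### The energy estimate -/

section Energy

variable {H : Type*} [NormedAddCommGroup H] [InnerProductSpace ℝ H]

/-- By symmetry of `L` the two terms with `L` cancel in the derivative of the energy, and the
damping term has the good sign. What remains is bounded by the energy and `F²`, so neither `‖L‖` nor
the size of `a` enters the constant. -/
theorem energy_le_of_hasDerivWithinAt {M L : H →L[ℝ] H} (hM : ∀ x, ‖M x‖ ≤ ‖x‖)
    (hL : ∀ x y, inner ℝ (L x) y = inner ℝ x (L y)) {q : ℝ} (hq : 0 ≤ q) {a : ℝ → ℝ}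
    {x y f : ℝ → H} {T F : ℝ}
    (ha : ∀ t ∈ Icc 0 T, 0 ≤ a t) (hf : ∀ t ∈ Icc 0 T, ‖f t‖ ≤ F)
    (hx : ∀ t ∈ Icc 0 T, HasDerivWithinAt x (L (y t)) (Ici 0) t)
    (hy : ∀ t ∈ Icc 0 T,
      HasDerivWithinAt y (-(q • L (x t)) + q • M (x t) - a t • y t + f t) (Ici 0) t) :
    ∀ t ∈ Icc 0 T, q * ‖x t‖ ^ 2 + ‖y t‖ ^ 2 ≤
      (q * ‖x 0‖ ^ 2 + ‖y 0‖ ^ 2 + F ^ 2) * Real.exp ((q + 1) * t) := by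
  let E' : ℝ → ℝ := fun t => q * (2 * inner ℝ (x t) (L (y t))) +
    2 * inner ℝ (y t) (-(q • L (x t)) + q • M (x t) - a t • y t + f t)
  have hE : ∀ t ∈ Icc 0 T,
      HasDerivWithinAt (fun t => q * ‖x t‖ ^ 2 + ‖y t‖ ^ 2) (E' t) (Ici 0) t := fun t ht =>
    ((hx t ht).norm_sq.const_mul q).add (hy t ht).norm_sq
  have hb : ∀ t ∈ Icc 0 T, E' t ≤ (q + 1) * (q * ‖x t‖ ^ 2 + ‖y t‖ ^ 2) + F ^ 2 := by
    intro t ht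
    have h1 : inner ℝ (y t) (L (x t)) = inner ℝ (x t) (L (y t)) := by
      rw [← hL, real_inner_comm]
    have h2 : inner ℝ (y t) (M (x t)) ≤ ‖y t‖ * ‖x t‖ :=
      (real_inner_le_norm _ _).trans (mul_le_mul_of_nonneg_left (hM _) (norm_nonneg _))
    have h3 : inner ℝ (y t) (f t) ≤ ‖y t‖ * F :=
      (real_inner_le_norm _ _).trans (mul_le_mul_of_nonneg_left (hf t ht) (norm_nonneg _))
    have h4 : 0 ≤ a t * ‖y t‖ ^ 2 := mul_nonneg (ha t ht) (sq_nonneg _)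
    have h5 : q * (2 * inner ℝ (y t) (M (x t))) ≤ q * (‖y t‖ ^ 2 + ‖x t‖ ^ 2) :=
      mul_le_mul_of_nonneg_left (by nlinarith [sq_nonneg (‖y t‖ - ‖x t‖)]) hq
    have h6 : 0 ≤ q * q * ‖x t‖ ^ 2 := by positivity
    simp only [E', inner_add_right, inner_sub_right, inner_neg_right, inner_smul_right,
      real_inner_self_eq_norm_sq, h1]
    nlinarith [sq_nonneg (‖y t‖ - F)]
  intro t ht
  have hF : 0 ≤ F ^ 2 := sq_nonneg F
  have hg := le_gronwallBound_of_liminf_deriv_right_le (a := 0) (b := T) (ε := F ^ 2) (K := q + 1)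
    (fun s hs => (hE s hs).continuousWithinAt.mono Icc_subset_Ici_self)
    (fun s hs r hr => ((hE s (Ico_subset_Icc_self hs)).mono
      (Ici_subset_Ici.2 hs.1)).liminf_right_slope_le hr) le_rfl
    (fun s hs => hb s (Ico_subset_Icc_self hs)) t ht
  refine hg.trans ?_
  rw [sub_zero, gronwallBound_of_K_ne_0 (by positivity)]
  have h1 : 1 ≤ Real.exp ((q + 1) * t) := Real.one_le_exp (mul_nonneg (by linarith) ht.1)
  -- Since `q + 1 ≥ 1`, the inhomogeneous part of the Gronwall bound is absorbed into the initial
  -- energy.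
  have h2 : F ^ 2 / (q + 1) ≤ F ^ 2 := div_le_self hF (by linarith)
  have h3 : F ^ 2 / (q + 1) * (Real.exp ((q + 1) * t) - 1) ≤ F ^ 2 * Real.exp ((q + 1) * t) :=
    mul_le_mul h2 (by linarith) (by linarith) hF
  rw [add_mul]
  linarith

end Energy

/-! ### The abstract wave equation -/

theorem uniformCauchySeqOn_of_energy {H : Type*} [NormedAddCommGroup H]
    {q : ℝ} {x : ℕ → ℝ → H} {X₀ Y₀ : ℕ → H}
    (hX : CauchySeq X₀) (hY : CauchySeq Y₀) {C : ℝ} {K : Set ℝ}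
    (h : ∀ i j, i ≤ j → ∀ t ∈ K,
      ‖x j t - x i t‖ ^ 2 ≤ (q * ‖X₀ j - X₀ i‖ ^ 2 + ‖Y₀ j - Y₀ i‖ ^ 2) * C) :
    UniformCauchySeqOn x Filter.atTop K := by
  have hlim : Filter.Tendsto (fun p : ℕ × ℕ =>
      (q * dist (X₀ p.1) (X₀ p.2) ^ 2 + dist (Y₀ p.1) (Y₀ p.2) ^ 2) * C) Filter.atTop (𝓝 0) := by
    have := (((cauchySeq_iff_tendsto_dist_atTop_0.1 hX).pow 2).const_mul q).add
      ((cauchySeq_iff_tendsto_dist_atTop_0.1 hY).pow 2)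
    simpa using this.mul_const C
  rw [Metric.uniformCauchySeqOn_iff]
  intro ε hε
  obtain ⟨N, hN⟩ := Filter.eventually_atTop.1 (hlim.eventually_lt_const (show 0 < ε ^ 2 by positivity))
  have main : ∀ i j, N.1 + N.2 ≤ i → i ≤ j → ∀ t ∈ K, dist (x j t) (x i t) < ε := by
    intro i j hi hij t ht
    have h1 := hN (j, i) ⟨by simp; omega, by simp; omega⟩
    have h2 := h i j hij t ht
    rw [dist_eq_norm]
    simp only [dist_eq_norm] at h1
    exact lt_of_pow_lt_pow_left₀ 2 hε.le (h2.trans_lt h1)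
  refine ⟨N.1 + N.2, fun m hm n hn t ht => ?_⟩
  rcases le_total m n with hmn | hmn
  · rw [dist_comm]; exact main m n hm hmn t ht
  · exact main n m hn hmn t ht

/-- Bounded symmetric operators `Λ j` that converge to the inverse of the contraction `M`. -/
structure CutoffInverse {H : Type*} [NormedAddCommGroup H] [InnerProductSpace ℝ H]
    (M : H →L[ℝ] H) where
  inv : ℕ → H →L[ℝ] H
  contraction : ∀ x, ‖M x‖ ≤ ‖x‖
  symm : ∀ j x y, inner ℝ (inv j x) y = inner ℝ x (inv j y)
  comm : ∀ j x, M (inv j x) = inv j (M x)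
  proj : ∀ i j, i ≤ j → ∀ x, inv j (M (inv i x)) = inv i x
  proj_norm_le : ∀ j x, ‖inv j (M x)‖ ≤ ‖x‖
  tendsto : ∀ x, Filter.Tendsto (fun j => inv j (M x)) Filter.atTop (𝓝 x)

namespace CutoffInverse

variable {H : Type*} [NormedAddCommGroup H] [InnerProductSpace ℝ H] {M : H →L[ℝ] H}

/-- Apply the bounded-operator estimate to the projections `inv j (M X)` and `inv j (M Y)`, for
which `inv j` plays the role of `M⁻¹`. The bound does not depend on `j`, and the projections tend to
the identity. -/
theorem energy_le (S : CutoffInverse M) {q : ℝ} (hq : 0 ≤ q) {a : ℝ → ℝ} {X Y f : ℝ → H} {T F : ℝ}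
    (ha : ∀ t ∈ Icc 0 T, 0 ≤ a t) (hf : ∀ t ∈ Icc 0 T, ‖f t‖ ≤ F)
    (hX : ∀ t ∈ Icc 0 T, HasDerivWithinAt (fun τ => M (X τ)) (Y t) (Ici 0) t)
    (hY : ∀ t ∈ Icc 0 T, HasDerivWithinAt (fun τ => M (Y τ))
      (-(q • (X t - M (M (X t)))) - a t • M (Y t) + M (f t)) (Ici 0) t) :
    ∀ t ∈ Icc 0 T, q * ‖X t‖ ^ 2 + ‖Y t‖ ^ 2 ≤
      (q * ‖X 0‖ ^ 2 + ‖Y 0‖ ^ 2 + F ^ 2) * Real.exp ((q + 1) * t) := by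
  intro t ht
  have key : ∀ j, q * ‖S.inv j (M (X t))‖ ^ 2 + ‖S.inv j (M (Y t))‖ ^ 2 ≤
      (q * ‖S.inv j (M (X 0))‖ ^ 2 + ‖S.inv j (M (Y 0))‖ ^ 2 + F ^ 2) *
        Real.exp ((q + 1) * t) := fun j => by
    refine energy_le_of_hasDerivWithinAt (M := M) (L := S.inv j) (a := a)
      (x := fun t => S.inv j (M (X t))) (y := fun t => S.inv j (M (Y t)))
      (f := fun t => S.inv j (M (f t))) S.contraction (S.symm j) hq ha
      (fun t ht => (S.proj_norm_le j _).trans (hf t ht)) (fun t ht => ?_) (fun t ht => ?_) t ht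
    · have h := (S.inv j).hasFDerivAt.comp_hasDerivWithinAt t (hX t ht)
      rw [← S.comm, S.proj j j le_rfl]
      exact h
    · have h := (S.inv j).hasFDerivAt.comp_hasDerivWithinAt t (hY t ht)
      refine h.congr_deriv ?_
      have h1 : S.inv j (M (M (X t))) = M (S.inv j (M (X t))) := (S.comm j _).symm
      have h2 : S.inv j (S.inv j (M (X t))) = S.inv j (X t) := by
        rw [← S.comm, S.proj j j le_rfl]
      simp only [map_add, map_sub, map_neg, map_smul, smul_sub, h1, h2]
      abel
  have hl := fun x => (S.tendsto x).norm.pow 2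
  exact le_of_tendsto_of_tendsto' (((hl (X t)).const_mul q).add (hl (Y t)))
    (((((hl (X 0)).const_mul q).add (hl (Y 0))).add_const (F ^ 2)).mul_const _) key

/-- The truncated system is linear with bounded coefficients on `H × H`. Its solution with the full
data is projected afterwards; the projection `inv j ∘ M` commutes with all operators involved, so
the result solves the same system and remains in the range of the projection. -/
theorem exists_hasDerivAt_cutoff [CompleteSpace H] (S : CutoffInverse M) (q : ℝ) {a : ℝ → ℝ}
    (ha : Continuous a) (X₀ Y₀ : H) (j : ℕ) :
    ∃ x y : ℝ → H, x 0 = S.inv j (M X₀) ∧ y 0 = S.inv j (M Y₀) ∧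
      (∀ t, S.inv j (M (x t)) = x t) ∧ (∀ t, S.inv j (M (y t)) = y t) ∧
      (∀ t, HasDerivAt x (S.inv j (y t)) t) ∧
      ∀ t, HasDerivAt y (-(q • S.inv j (x t)) + q • M (x t) - a t • y t) t := by
  let A₀ : H × H →L[ℝ] H × H := ((S.inv j).comp (.snd ℝ H H)).prod
    ((-(q • S.inv j) + q • M).comp (.fst ℝ H H))
  let A₁ : H × H →L[ℝ] H × H := (ContinuousLinearMap.inr ℝ H H).comp (.snd ℝ H H)
  obtain ⟨z, hz0, hz⟩ := exists_hasDerivAt_clm_apply (A := fun t => A₀ - a t • A₁)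
    (by fun_prop) (X₀, Y₀)
  have h1 : ∀ t, HasDerivAt (fun τ => (z τ).1) (S.inv j (z t).2) t := fun t => by
    have h := (ContinuousLinearMap.fst ℝ H H).hasFDerivAt.comp_hasDerivAt t (hz t)
    refine h.congr_deriv ?_
    simp [A₀, A₁]
  have h2 : ∀ t, HasDerivAt (fun τ => (z τ).2)
      (-(q • S.inv j (z t).1) + q • M (z t).1 - a t • (z t).2) t := fun t => by
    have h := (ContinuousLinearMap.snd ℝ H H).hasFDerivAt.comp_hasDerivAt t (hz t)
    refine h.congr_deriv ?_
    simp [A₀, A₁]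
  have hP : ∀ x, S.inv j (M (S.inv j (M x))) = S.inv j (M x) := fun x => S.proj j j le_rfl _
  refine ⟨fun t => S.inv j (M (z t).1), fun t => S.inv j (M (z t).2), by simp [hz0], by simp [hz0],
    fun t => hP _, fun t => hP _, fun t => ?_, fun t => ?_⟩
  · have h := ((S.inv j).comp M).hasFDerivAt.comp_hasDerivAt t (h1 t)
    refine h.congr_deriv ?_
    simp only [ContinuousLinearMap.comp_apply, S.comm]
  · have h := ((S.inv j).comp M).hasFDerivAt.comp_hasDerivAt t (h2 t)
    refine h.congr_deriv ?_
    simp only [ContinuousLinearMap.comp_apply, map_add, map_sub, map_neg, map_smul, S.comm]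

/-- The Cauchy problem for `X'' + q (1 - M²) X + a X' = 0`, where `M X` and `M Y` are
differentiable with `Y = (M X)'`. -/
theorem exists_solution [CompleteSpace H] (S : CutoffInverse M) {q : ℝ} (hq : 1 ≤ q) {a : ℝ → ℝ}
    (ha : ContinuousOn a (Ici 0)) (ha0 : ∀ t, 0 ≤ t → 0 ≤ a t) (X₀ Y₀ : H) :
    ∃ X Y : ℝ → H, ContinuousOn X (Ici 0) ∧ ContinuousOn Y (Ici 0) ∧ X 0 = X₀ ∧ Y 0 = Y₀ ∧
      (∀ t, 0 ≤ t → HasDerivWithinAt (fun τ => M (X τ)) (Y t) (Ici 0) t) ∧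
      ∀ t, 0 ≤ t → HasDerivWithinAt (fun τ => M (Y τ))
        (-(q • (X t - M (M (X t)))) - a t • M (Y t)) (Ici 0) t := by
  have hq0 : 0 ≤ q := by linarith
  have hac : Continuous fun t => a (max t 0) := by
    rw [← continuousOn_univ]
    exact ha.comp (by fun_prop) fun τ _ => mem_Ici.2 (le_max_right τ 0)
  choose x y hx0 hy0 hPx hPy hx hy using S.exists_hasDerivAt_cutoff q hac X₀ Y₀
  -- On the range of the `i`-th projection the later cutoff inverses agree with the `i`-th one.
  -- Hence for `i ≤ j` the solution at level `i` also solves the system of level `j`, and the energy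
  -- estimate applies to the difference.
  have hinv : ∀ i j, i ≤ j → ∀ z : H, S.inv i (M z) = z → S.inv j z = S.inv i z := by
    intro i j hij z hz
    rw [← hz, ← S.comm, S.proj i j hij, S.proj i i le_rfl]
  have hen : ∀ (T : ℝ) i j, i ≤ j → ∀ t ∈ Icc 0 T,
      q * ‖x j t - x i t‖ ^ 2 + ‖y j t - y i t‖ ^ 2 ≤
      (q * ‖S.inv j (M X₀) - S.inv i (M X₀)‖ ^ 2 + ‖S.inv j (M Y₀) - S.inv i (M Y₀)‖ ^ 2) *
        Real.exp ((q + 1) * T) := by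
    intro T i j hij t ht
    have h := energy_le_of_hasDerivWithinAt (M := M) (L := S.inv j) (T := T) (F := 0)
      (a := fun t => a (max t 0)) (x := fun t => x j t - x i t) (y := fun t => y j t - y i t)
      (f := fun _ => 0) S.contraction (S.symm j) hq0 (fun t _ => ha0 _ (le_max_right _ _))
      (by simp) (fun t _ => ?_) (fun t _ => ?_) t ht
    · rw [hx0, hy0, hx0, hy0] at h
      refine h.trans ?_
      rw [zero_pow two_ne_zero, add_zero]
      have h1 : Real.exp ((q + 1) * t) ≤ Real.exp ((q + 1) * T) :=
        Real.exp_le_exp.2 (mul_le_mul_of_nonneg_left ht.2 (by linarith))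
      exact mul_le_mul_of_nonneg_left h1 (by positivity)
    · rw [map_sub, hinv i j hij _ (hPy i t)]
      exact ((hx j t).sub (hx i t)).hasDerivWithinAt
    · refine ((hy j t).sub (hy i t)).hasDerivWithinAt.congr_deriv ?_
      rw [map_sub, map_sub, hinv i j hij _ (hPx i t)]
      simp only [smul_sub]
      abel
  have hcX := (S.tendsto X₀).cauchySeq
  have hcY := (S.tendsto Y₀).cauchySeq
  have hux : ∀ T : ℝ, UniformCauchySeqOn x Filter.atTop (Icc 0 T) := fun T =>
    uniformCauchySeqOn_of_energy (C := Real.exp ((q + 1) * T)) hcX hcY fun i j hij t ht => by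
      refine le_trans ?_ (hen T i j hij t ht)
      nlinarith [sq_nonneg ‖y j t - y i t‖, sq_nonneg ‖x j t - x i t‖]
  have huy : ∀ T : ℝ, UniformCauchySeqOn y Filter.atTop (Icc 0 T) := fun T =>
    uniformCauchySeqOn_of_energy (C := Real.exp ((q + 1) * T)) hcX hcY fun i j hij t ht => by
      refine le_trans ?_ (hen T i j hij t ht)
      nlinarith [sq_nonneg ‖y j t - y i t‖, sq_nonneg ‖x j t - x i t‖]
  have hlim : ∀ z : ℕ → ℝ → H, (∀ T : ℝ, UniformCauchySeqOn z Filter.atTop (Icc 0 T)) →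
      ∀ t, ∃ l, 0 ≤ t → Filter.Tendsto (fun j => z j t) Filter.atTop (𝓝 l) := by
    intro z hz t
    by_cases ht : 0 ≤ t
    · obtain ⟨l, hl⟩ := cauchySeq_tendsto_of_complete ((hz t).cauchySeq ⟨ht, le_rfl⟩)
      exact ⟨l, fun _ => hl⟩
    · exact ⟨0, fun h => absurd h ht⟩
  choose X hX using hlim x hux
  choose Y hY using hlim y huy
  have hUX : ∀ T, TendstoUniformlyOn x X Filter.atTop (Icc 0 T) := fun T =>
    (hux T).tendstoUniformlyOn_of_tendsto fun t ht => hX t ht.1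
  have hUY : ∀ T, TendstoUniformlyOn y Y Filter.atTop (Icc 0 T) := fun T =>
    (huy T).tendstoUniformlyOn_of_tendsto fun t ht => hY t ht.1
  have hxc : ∀ j, Continuous (x j) := fun j =>
    continuous_iff_continuousAt.2 fun t => (hx j t).continuousAt
  have hyc : ∀ j, Continuous (y j) := fun j =>
    continuous_iff_continuousAt.2 fun t => (hy j t).continuousAt
  have hcont : ∀ (z : ℕ → ℝ → H) (Z : ℝ → H), (∀ j, Continuous (z j)) →
      (∀ T : ℝ, TendstoUniformlyOn z Z Filter.atTop (Icc 0 T)) → ContinuousOn Z (Ici 0) := by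
    intro z Z hz hZ s hs
    have h := (hZ (s + 1)).continuousOn (Filter.Frequently.of_forall fun j => (hz j).continuousOn)
    refine (h s ⟨hs, by linarith⟩).mono_of_mem_nhdsWithin ?_
    rw [← Ici_inter_Iic]
    exact inter_mem_nhdsWithin _ (Iic_mem_nhds (by linarith))
  have hXc := hcont x X hxc hUX
  have hYc := hcont y Y hyc hUY
  refine ⟨X, Y, hXc, hYc, ?_, ?_, ?_, ?_⟩
  · exact tendsto_nhds_unique (by simpa only [hx0] using hX 0 le_rfl) (S.tendsto X₀)
  · exact tendsto_nhds_unique (by simpa only [hy0] using hY 0 le_rfl) (S.tendsto Y₀)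
  · intro t ht
    refine hasDerivWithinAt_Ici_of_tendstoUniformlyOn (z := fun j τ => M (x j τ)) (w := y)
      (fun j t _ => ?_) (fun j => (hyc j).continuousOn)
      (fun t ht => (M.continuous.tendsto _).comp (hX t ht)) hUY ht
    -- Applying `M` undoes `inv j` on the range of the projection, so the derivative of `M (x j)` is
    -- `y j`, which converges uniformly on `[0, T]`.
    have h := M.hasFDerivAt.comp_hasDerivAt t (hx j t)
    rw [S.comm, hPy] at h
    exact h.hasDerivWithinAt
  · intro t ht
    refine hasDerivWithinAt_Ici_of_tendstoUniformlyOn (z := fun j τ => M (y j τ))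
      (w := fun j t => -(q • (x j t - M (M (x j t)))) - a (max t 0) • M (y j t))
      (W := fun t => -(q • (X t - M (M (X t)))) - a t • M (Y t))
      (fun j t _ => ?_) (fun j => ?_)
      (fun t ht => (M.continuous.tendsto _).comp (hY t ht)) ?_ ht
    · have h := M.hasFDerivAt.comp_hasDerivAt t (hy j t)
      refine (h.congr_deriv ?_).hasDerivWithinAt
      simp only [map_add, map_sub, map_neg, map_smul, S.comm, hPx, smul_sub]
      abel
    · exact (((((hxc j).sub (M.continuous.comp (M.continuous.comp (hxc j)))).const_smul q).neg).sub
        (hac.smul (M.continuous.comp (hyc j)))).continuousOn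
    · intro T
      obtain ⟨A, hA⟩ := (isCompact_Icc (a := 0) (b := T)).exists_bound_of_continuousOn
        hac.continuousOn
      -- The right-hand side changes by at most `2 * q + |A|` times the larger error of `x j` and `y
      -- j`, as `M` is a contraction; the extra `1` makes the final inequality strict.
      have hpos : 0 < 2 * q + |A| + 1 := by positivity
      rw [Metric.tendstoUniformlyOn_iff]
      intro ε hε
      have hδ : 0 < ε / (2 * q + |A| + 1) := by positivity
      filter_upwards [Metric.tendstoUniformlyOn_iff.1 (hUX T) _ hδ,
        Metric.tendstoUniformlyOn_iff.1 (hUY T) _ hδ] with j h1 h2 t ht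
      have h1 := (h1 t ht).le
      have h2 := (h2 t ht).le
      have hAt := hA t ht
      rw [max_eq_left ht.1] at hAt ⊢
      rw [dist_eq_norm] at h1 h2 ⊢
      have e : -(q • (X t - M (M (X t)))) - a t • M (Y t) -
          (-(q • (x j t - M (M (x j t)))) - a t • M (y j t)) =
          -(q • (X t - x j t)) + q • M (M (X t - x j t)) - a t • M (Y t - y j t) := by
        simp only [map_sub, smul_sub]
        abel
      rw [e]
      have n1 : ‖-(q • (X t - x j t))‖ = q * ‖X t - x j t‖ := by
        rw [norm_neg, norm_smul, Real.norm_of_nonneg hq0]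
      have n2 : ‖q • M (M (X t - x j t))‖ ≤ q * ‖X t - x j t‖ := by
        rw [norm_smul, Real.norm_of_nonneg hq0]
        exact mul_le_mul_of_nonneg_left ((S.contraction _).trans (S.contraction _)) hq0
      have n3 : ‖a t • M (Y t - y j t)‖ ≤ |A| * ‖Y t - y j t‖ := by
        rw [norm_smul]
        exact mul_le_mul (hAt.trans (le_abs_self A)) (S.contraction _) (norm_nonneg _)
          (abs_nonneg _)
      have n4 := norm_sub_le (-(q • (X t - x j t)) + q • M (M (X t - x j t)))
        (a t • M (Y t - y j t))
      have n5 := norm_add_le (-(q • (X t - x j t))) (q • M (M (X t - x j t)))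
      have m1 := mul_le_mul_of_nonneg_left h1 hq0
      have m2 := mul_le_mul_of_nonneg_left h2 (abs_nonneg A)
      have m3 : (2 * q + |A| + 1) * (ε / (2 * q + |A| + 1)) = ε := by field_simp
      linarith

end CutoffInverse

/-! ### Curves in a scale of spaces

The scale is described by a bounded operator `M` on one space: `M ^ k` stands for the inclusion
into the `k`-th space below. -/

theorem iteratedDerivWithin_clm_apply {E F : Type*} [NormedAddCommGroup E] [NormedSpace ℝ E]
    [NormedAddCommGroup F] [NormedSpace ℝ F] (L : E →L[ℝ] F) {f : ℝ → E} {k : ℕ}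
    (hf : ContDiffOn ℝ k f (Ici 0)) {t : ℝ} (ht : 0 ≤ t) :
    iteratedDerivWithin k (fun τ => L (f τ)) (Ici 0) t =
      L (iteratedDerivWithin k f (Ici 0) t) := by
  have h := L.iteratedFDerivWithin_comp_left (hf t ht) (uniqueDiffOn_Ici (0 : ℝ)) ht (i := k) le_rfl
  simp only [iteratedDerivWithin]
  exact congrArg (fun m => m fun _ => 1) h

theorem contDiffOn_iteratedDerivWithin {E : Type*} [NormedAddCommGroup E] [NormedSpace ℝ E]
    {s : Set ℝ} (hs : UniqueDiffOn ℝ s) {f : ℝ → E} {i j : ℕ}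
    (hf : ContDiffOn ℝ (j + i : ℕ) f s) : ContDiffOn ℝ j (iteratedDerivWithin i f s) s := by
  induction i generalizing f with
  | zero => simpa using hf
  | succ i ih =>
    rw [iteratedDerivWithin_succ']
    exact ih (hf.derivWithin hs (by norm_cast))

theorem iteratedDerivWithin_iteratedDerivWithin {E : Type*} [NormedAddCommGroup E]
    [NormedSpace ℝ E] {s : Set ℝ} (f : ℝ → E) (i j : ℕ) :
    iteratedDerivWithin j (iteratedDerivWithin i f s) s = iteratedDerivWithin (i + j) f s := by
  induction i generalizing f with
  | zero => simp
  | succ i ih => rw [iteratedDerivWithin_succ', ih, add_right_comm, iteratedDerivWithin_succ']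

section Scale

variable {H : Type*} [NormedAddCommGroup H] [NormedSpace ℝ H] (M : H →L[ℝ] H)

/-- `M ^ k X` is of class `C^k` on `[0, ∞)` for all `k`. -/
def IsScaleSmooth (X : ℝ → H) : Prop :=
  ∀ k : ℕ, ContDiffOn ℝ k (fun t => (M ^ k) (X t)) (Ici 0)

/-- The `k`-th derivative of `M ^ k X`. -/
def scaleDeriv (k : ℕ) (X : ℝ → H) : ℝ → H :=
  iteratedDerivWithin k (fun t => (M ^ k) (X t)) (Ici 0)

variable {M} {X : ℝ → H}

@[simp] theorem scaleDeriv_zero : scaleDeriv M 0 X = X := by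
  funext t
  simp [scaleDeriv]

/-- Bounded operators commute with differentiation. This allows `M` to be used as a currency: one
power has to be spent for each time derivative. -/
theorem pow_scaleDeriv (hX : IsScaleSmooth M X) (m i : ℕ) {t : ℝ} (ht : 0 ≤ t) :
    (M ^ m) (scaleDeriv M i X t) =
      iteratedDerivWithin i (fun τ => (M ^ (m + i)) (X τ)) (Ici 0) t := by
  simp only [pow_add, mul_apply_eq_comp]
  exact (iteratedDerivWithin_clm_apply (M ^ m) (hX i) ht).symm

theorem contDiffOn_pow_scaleDeriv (hX : IsScaleSmooth M X) {j m : ℕ} (hjm : j ≤ m) (i : ℕ) :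
    ContDiffOn ℝ j (fun τ => (M ^ m) (scaleDeriv M i X τ)) (Ici 0) := by
  refine (contDiffOn_iteratedDerivWithin (uniqueDiffOn_Ici 0) ?_).congr
    fun t ht => pow_scaleDeriv hX m i ht
  exact (hX (m + i)).of_le (by exact_mod_cast Nat.add_le_add_right hjm i)

/-- Each of the `j` derivatives uses up one of the `m` available powers of `M`; the surplus stays
outside. -/
theorem iteratedDerivWithin_pow_scaleDeriv (hX : IsScaleSmooth M X) {j m : ℕ} (hjm : j ≤ m) (i : ℕ)
    {t : ℝ} (ht : 0 ≤ t) :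
    iteratedDerivWithin j (fun τ => (M ^ m) (scaleDeriv M i X τ)) (Ici 0) t =
      (M ^ (m - j)) (scaleDeriv M (i + j) X t) := by
  rw [iteratedDerivWithin_congr (s := Ici 0) (fun τ hτ => pow_scaleDeriv hX m i hτ) (mem_Ici.2 ht),
    iteratedDerivWithin_iteratedDerivWithin, pow_scaleDeriv hX _ _ ht,
    show m - j + (i + j) = m + i by omega]

theorem hasDerivWithinAt_scaleDeriv (hX : IsScaleSmooth M X) (k : ℕ) {t : ℝ} (ht : 0 ≤ t) :
    HasDerivWithinAt (fun τ => M (scaleDeriv M k X τ)) (scaleDeriv M (k + 1) X t) (Ici 0) t := by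
  have h1 := contDiffOn_pow_scaleDeriv hX (j := 1) (m := 1) le_rfl k
  have h2 := iteratedDerivWithin_pow_scaleDeriv hX (j := 1) (m := 1) le_rfl k ht
  simp only [pow_one, iteratedDerivWithin_one, Nat.sub_self, pow_zero,
    one_apply_eq_self] at h1 h2
  rw [← h2]
  exact ((h1.differentiableOn (by norm_num)) t ht).hasDerivWithinAt

theorem IsScaleSmooth.sub {Y : ℝ → H} (hX : IsScaleSmooth M X) (hY : IsScaleSmooth M Y) :
    IsScaleSmooth M (X - Y) := fun k => by
  simp only [Pi.sub_apply, map_sub]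
  exact (hX k).sub (hY k)

theorem scaleDeriv_sub {Y : ℝ → H} (hX : IsScaleSmooth M X) (hY : IsScaleSmooth M Y) (k : ℕ)
    {t : ℝ} (ht : 0 ≤ t) :
    scaleDeriv M k (X - Y) t = scaleDeriv M k X t - scaleDeriv M k Y t := by
  simp only [scaleDeriv, Pi.sub_apply, map_sub]
  exact iteratedDerivWithin_sub (mem_Ici.2 ht) (uniqueDiffOn_Ici 0) (hX k t ht) (hY k t ht)

/-! ### The wave operator and its time derivatives -/

variable (M)

/-- `X'' + q (1 - M²) X`, differentiated `j` times. -/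
def waveMain (q : ℝ) (j : ℕ) (X : ℝ → H) (t : ℝ) : H :=
  scaleDeriv M (2 + j) X t + q • (scaleDeriv M j X t - M (M (scaleDeriv M j X t)))

/-- The Leibniz expansion of the `k`-th derivative of `β (X'' + q (1 - M²) X) + β' X'`. -/
def waveSum (q : ℝ) (k : ℕ) (β β' : ℝ → ℝ) (X : ℝ → H) (t : ℝ) : H :=
  ∑ l ∈ Finset.range (k + 1), k.choose l •
    (iteratedDerivWithin l β (Ici 0) t • (M ^ l) (waveMain M q (k - l) X t) +
      iteratedDerivWithin l β' (Ici 0) t • (M ^ l) (M (scaleDeriv M (1 + (k - l)) X t)))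

variable {M}

theorem contDiffOn_pow_waveMain (hX : IsScaleSmooth M X) (q : ℝ) {j m : ℕ} (hjm : j ≤ m) :
    ContDiffOn ℝ j (fun τ => (M ^ m) (waveMain M q 0 X τ)) (Ici 0) := by
  have h1 := contDiffOn_pow_scaleDeriv hX hjm 2
  have h2 := contDiffOn_pow_scaleDeriv hX hjm 0
  have h3 := contDiffOn_pow_scaleDeriv hX (show j ≤ m + 1 + 1 by omega) 0
  simp only [pow_succ, mul_apply_eq_comp] at h3
  simp only [waveMain, map_add, map_smul, map_sub]
  exact h1.add ((h2.sub h3).const_smul q)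

theorem iteratedDerivWithin_pow_waveMain (hX : IsScaleSmooth M X) (q : ℝ) {j m : ℕ} (hjm : j ≤ m)
    {t : ℝ} (ht : 0 ≤ t) :
    iteratedDerivWithin j (fun τ => (M ^ m) (waveMain M q 0 X τ)) (Ici 0) t =
      (M ^ (m - j)) (waveMain M q j X t) := by
  have hu := uniqueDiffOn_Ici (0 : ℝ)
  have ht' : t ∈ Ici 0 := ht
  have h1 := contDiffOn_pow_scaleDeriv hX hjm 2
  have h2 := contDiffOn_pow_scaleDeriv hX hjm 0
  have h3 := contDiffOn_pow_scaleDeriv hX (show j ≤ m + 1 + 1 by omega) 0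
  have e1 := iteratedDerivWithin_pow_scaleDeriv hX hjm 2 ht
  have e2 := iteratedDerivWithin_pow_scaleDeriv hX hjm 0 ht
  have e3 := iteratedDerivWithin_pow_scaleDeriv hX (show j ≤ m + 1 + 1 by omega) 0 ht
  rw [show m + 1 + 1 - j = m - j + 1 + 1 by omega] at e3
  simp only [pow_succ, mul_apply_eq_comp] at h3 e3
  rw [zero_add] at e2 e3
  simp only [waveMain, map_add, map_smul, map_sub, add_zero]
  have e4 := (iteratedDerivWithin_sub ht' hu (h2 t ht) (h3 t ht)).trans (congrArg₂ _ e2 e3)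
  rw [iteratedDerivWithin_fun_add ht' hu (h1 t ht) (((h2.sub h3).const_smul q) t ht),
    iteratedDerivWithin_fun_const_smul ht' hu q ((h2.sub h3) t ht), e1, ← e4]
  rfl

theorem waveSum_eq_zero {q : ℝ} {β β' : ℝ → ℝ} (hβ : ContDiffOn ℝ ∞ β (Ici 0))
    (hβ' : ContDiffOn ℝ ∞ β' (Ici 0)) (hX : IsScaleSmooth M X)
    (h : ∀ t, 0 ≤ t → β t • waveMain M q 0 X t + β' t • M (scaleDeriv M 1 X t) = 0) (k : ℕ)
    {t : ℝ} (ht : 0 ≤ t) : waveSum M q k β β' X t = 0 := by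
  have hu := uniqueDiffOn_Ici (0 : ℝ)
  have ht' : t ∈ Ici 0 := ht
  have hβk : ContDiffOn ℝ k β (Ici 0) := hβ.of_le (by exact_mod_cast le_top)
  have hβk' : ContDiffOn ℝ k β' (Ici 0) := hβ'.of_le (by exact_mod_cast le_top)
  have h1 := contDiffOn_pow_waveMain hX q (le_refl k)
  have h2 := contDiffOn_pow_scaleDeriv hX (show k ≤ k + 1 by omega) 1
  -- The equation has to be multiplied by `M ^ k` before it can be differentiated `k` times.
  have e0 : EqOn (fun τ => (0 : H)) (β • (fun τ => (M ^ k) (waveMain M q 0 X τ)) +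
      β' • (fun τ => (M ^ (k + 1)) (scaleDeriv M 1 X τ))) (Ici 0) := fun τ hτ => by
    have h3 := congrArg (M ^ k) (h τ hτ)
    simp only [map_add, map_smul, map_zero] at h3
    simp only [Pi.add_apply, Pi.smul_apply', pow_succ, mul_apply_eq_comp]
    exact h3.symm
  have e := iteratedDerivWithin_congr (n := k) e0 ht'
  rw [iteratedDerivWithin_const, ite_self, iteratedDerivWithin_add ht' hu
    ((hβk.smul h1) t ht) ((hβk'.smul h2) t ht), iteratedDerivWithin_smul ht' hu (hβk t ht) (h1 t ht),
    iteratedDerivWithin_smul ht' hu (hβk' t ht) (h2 t ht), ← Finset.sum_add_distrib] at e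
  rw [e, waveSum]
  refine Finset.sum_congr rfl fun l hl => ?_
  have hl' : l ≤ k := by simpa [Nat.lt_succ_iff] using hl
  rw [iteratedDerivWithin_pow_waveMain hX q (Nat.sub_le k l) ht,
    iteratedDerivWithin_pow_scaleDeriv hX (show k - l ≤ k + 1 by omega) 1 ht,
    show k - (k - l) = l by omega, show k + 1 - (k - l) = l + 1 by omega, smul_add, pow_succ,
    mul_apply_eq_comp]

/-- If `U` solves the equation with `β, β'` and `V` the one with `γ, γ'`, the first two terms on the
right vanish. The error left for `U - V` has only differences of coefficients in it. -/
theorem waveSum_sub {q : ℝ} {β β' γ γ' : ℝ → ℝ} (hβ : ContDiffOn ℝ ∞ β (Ici 0))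
    (hβ' : ContDiffOn ℝ ∞ β' (Ici 0)) (hγ : ContDiffOn ℝ ∞ γ (Ici 0))
    (hγ' : ContDiffOn ℝ ∞ γ' (Ici 0)) {U V : ℝ → H} (hU : IsScaleSmooth M U)
    (hV : IsScaleSmooth M V) (k : ℕ) {t : ℝ} (ht : 0 ≤ t) :
    waveSum M q k β β' (U - V) t =
      waveSum M q k β β' U t - waveSum M q k γ γ' V t + waveSum M q k (γ - β) (γ' - β') V t := by
  have hu := uniqueDiffOn_Ici (0 : ℝ)
  have ht' : t ∈ Ici 0 := ht
  have hc : ∀ {f : ℝ → ℝ} (l : ℕ), ContDiffOn ℝ ∞ f (Ici 0) → ContDiffWithinAt ℝ l f (Ici 0) t :=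
    fun l h => (h.of_le (by exact_mod_cast le_top)) t ht
  simp only [waveSum, waveMain, scaleDeriv_sub hU hV _ ht]
  rw [← Finset.sum_sub_distrib, ← Finset.sum_add_distrib]
  refine Finset.sum_congr rfl fun l _ => ?_
  rw [iteratedDerivWithin_sub ht' hu (hc l hγ) (hc l hβ),
    iteratedDerivWithin_sub ht' hu (hc l hγ') (hc l hβ')]
  simp only [map_sub, map_add, map_smul, sub_smul, smul_sub, smul_add]
  abel

end Scale

/-! ### Growth of nets -/

/-- `‖g ε t‖ = O(ε ^ m)` uniformly for `t ∈ K` and `ε ∈ (0, 1]`. -/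
def NetBound {E : Type*} [NormedAddCommGroup E] (K : Set ℝ) (m : ℤ) (g : Eps → ℝ → E) : Prop :=
  ∃ c : ℝ, ∀ ε : Eps, ∀ t ∈ K, ‖g ε t‖ ≤ c * (ε : ℝ) ^ m

namespace NetBound

variable {E F : Type*} [NormedAddCommGroup E] [NormedAddCommGroup F] {K : Set ℝ} {m m' : ℤ}
  {g h : Eps → ℝ → E}

theorem of_norm_le {g : Eps → ℝ → E} {h : Eps → ℝ → F} (hh : NetBound K m h) (C : ℝ)
    (hC : 0 ≤ C) (hg : ∀ ε, ∀ t ∈ K, ‖g ε t‖ ≤ C * ‖h ε t‖) : NetBound K m g := by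
  obtain ⟨c, hc⟩ := hh
  refine ⟨C * c, fun ε t ht => (hg ε t ht).trans ?_⟩
  rw [mul_assoc]
  exact mul_le_mul_of_nonneg_left (hc ε t ht) hC

theorem congr (hh : NetBound K m h) (hg : ∀ ε, ∀ t ∈ K, g ε t = h ε t) : NetBound K m g :=
  hh.of_norm_le 1 zero_le_one fun ε t ht => by rw [one_mul, hg ε t ht]

theorem mono (h : NetBound K m' g) (hm : m ≤ m') : NetBound K m g := by
  obtain ⟨c, hc⟩ := h
  refine ⟨|c|, fun ε t ht => (hc ε t ht).trans ?_⟩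
  have h1 : (ε : ℝ) ^ m' ≤ (ε : ℝ) ^ m := zpow_le_zpow_right_of_le_one₀ ε.pos ε.le_one hm
  exact mul_le_mul (le_abs_self c) h1 (zpow_nonneg ε.pos.le _) (abs_nonneg c)

theorem add (hg : NetBound K m g) (hh : NetBound K m h) :
    NetBound K m (fun ε t => g ε t + h ε t) := by
  obtain ⟨c, hc⟩ := hg
  obtain ⟨d, hd⟩ := hh
  refine ⟨c + d, fun ε t ht => (norm_add_le _ _).trans ?_⟩
  rw [add_mul]
  exact add_le_add (hc ε t ht) (hd ε t ht)

theorem sub (hg : NetBound K m g) (hh : NetBound K m h) :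
    NetBound K m (fun ε t => g ε t - h ε t) := by
  simp only [sub_eq_add_neg]
  exact hg.add (hh.of_norm_le 1 zero_le_one fun ε t _ => by rw [norm_neg, one_mul])

theorem zero : NetBound K m (fun _ _ => (0 : E)) := ⟨0, fun ε t _ => by simp⟩

theorem sum {ι : Type*} {s : Finset ι} {g : ι → Eps → ℝ → E} (hg : ∀ i ∈ s, NetBound K m (g i)) :
    NetBound K m (fun ε t => ∑ i ∈ s, g i ε t) := by
  classical
  induction s using Finset.induction_on with
  | empty => simpa using zero
  | insert i s hi ih =>
    simp only [Finset.sum_insert hi]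
    exact (hg i (by simp)).add (ih fun j hj => hg j (by simp [hj]))

theorem smul [NormedSpace ℝ E] {f : Eps → ℝ → ℝ} (hf : NetBound K m f) (hg : NetBound K m' g) :
    NetBound K (m + m') (fun ε t => f ε t • g ε t) := by
  obtain ⟨c, hc⟩ := hf
  obtain ⟨d, hd⟩ := hg
  refine ⟨c * d, fun ε t ht => ?_⟩
  rw [norm_smul, zpow_add₀ ε.pos.ne', mul_mul_mul_comm]
  exact mul_le_mul (hc ε t ht) (hd ε t ht) (norm_nonneg _) ((norm_nonneg _).trans (hc ε t ht))

theorem clm [NormedSpace ℝ E] [NormedSpace ℝ F] (L : E →L[ℝ] F) (hg : NetBound K m g) :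
    NetBound K m (fun ε t => L (g ε t)) :=
  hg.of_norm_le ‖L‖ (norm_nonneg L) fun ε t _ => L.le_opNorm (g ε t)

theorem const_smul [NormedSpace ℝ E] (r : ℝ) (hg : NetBound K m g) :
    NetBound K m (fun ε t => r • g ε t) :=
  hg.of_norm_le ‖r‖ (norm_nonneg r) fun ε t _ => (norm_smul r (g ε t)).le

/-- An estimate of a moderate net has to be checked for small `ε` only. -/
theorem of_small (hg : NetBound K m g) (p : ℤ) {ε₀ : ℝ} (hε₀ : 0 < ε₀) {c : ℝ}
    (h : ∀ ε : Eps, (ε : ℝ) ≤ ε₀ → ∀ t ∈ K, ‖g ε t‖ ≤ c * (ε : ℝ) ^ p) : NetBound K p g := by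
  obtain ⟨d, hd⟩ := hg
  -- Away from `ε = 0` all powers of `ε` are comparable, by compactness of `[ε₀, 1]`.
  obtain ⟨A, hA⟩ : ∃ A : ℝ, ∀ x ∈ Icc ε₀ 1, ‖x ^ m * (x ^ p)⁻¹‖ ≤ A :=
    isCompact_Icc.exists_bound_of_continuousOn fun x hx => by
      have hx0 : x ≠ 0 := (hε₀.trans_le hx.1).ne'
      exact ((continuousAt_zpow₀ x m (Or.inl hx0)).mul
        ((continuousAt_zpow₀ x p (Or.inl hx0)).inv₀ (zpow_ne_zero _ hx0))).continuousWithinAt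
  refine ⟨|c| + |d| * |A|, fun ε t ht => ?_⟩
  have hp : 0 < (ε : ℝ) ^ p := zpow_pos ε.pos p
  have hm : 0 < (ε : ℝ) ^ m := zpow_pos ε.pos m
  have hdA : 0 ≤ |d| * |A| := by positivity
  rcases le_total (ε : ℝ) ε₀ with hε | hε
  · refine (h ε hε t ht).trans (mul_le_mul_of_nonneg_right ?_ hp.le)
    linarith [le_abs_self c]
  · have h1 := hA ε ⟨hε, ε.le_one⟩
    rw [norm_mul, norm_inv, Real.norm_of_nonneg hm.le, Real.norm_of_nonneg hp.le,
      ← div_eq_mul_inv, div_le_iff₀ hp] at h1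
    calc ‖g ε t‖ ≤ d * (ε : ℝ) ^ m := hd ε t ht
      _ ≤ |d| * (|A| * (ε : ℝ) ^ p) := by
        refine mul_le_mul (le_abs_self d) (h1.trans ?_) hm.le (abs_nonneg d)
        exact mul_le_mul_of_nonneg_right (le_abs_self A) hp.le
      _ ≤ (|c| + |d| * |A|) * (ε : ℝ) ^ p := by nlinarith [abs_nonneg c]

/-- Division by a net that is bounded below for small `ε`. -/
theorem of_smul [NormedSpace ℝ E] {f : Eps → ℝ → ℝ} {p : ℤ} (hg : NetBound K m g)
    (h : NetBound K p (fun ε t => f ε t • g ε t)) {ε₀ r : ℝ} (hε₀ : 0 < ε₀) (hr : 0 < r)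
    (hf : ∀ ε : Eps, (ε : ℝ) ≤ ε₀ → ∀ t ∈ K, r ≤ f ε t) : NetBound K p g := by
  obtain ⟨c, hc⟩ := h
  refine hg.of_small p hε₀ (c := c / r) fun ε hε t ht => ?_
  have h1 := hc ε t ht
  have h2 := hf ε hε t ht
  rw [norm_smul, Real.norm_of_nonneg (hr.le.trans h2)] at h1
  rw [div_mul_eq_mul_div, le_div_iff₀ hr]
  nlinarith [norm_nonneg (g ε t)]

end NetBound

theorem NetBound.smul_of_forall {E : Type*} [NormedAddCommGroup E] [NormedSpace ℝ E] {K : Set ℝ}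
    {N : ℤ} {f : Eps → ℝ → ℝ} {g : Eps → ℝ → E} (hf : NetBound K N f)
    (hg : ∀ p : ℤ, NetBound K p g) (p : ℤ) : NetBound K p (fun ε t => f ε t • g ε t) := by
  simpa using hf.smul (hg (p - N))

theorem NetBound.smul_of_forall_left {E : Type*} [NormedAddCommGroup E] [NormedSpace ℝ E]
    {K : Set ℝ} {N : ℤ} {f : Eps → ℝ → ℝ} {g : Eps → ℝ → E} (hf : ∀ p : ℤ, NetBound K p f)
    (hg : NetBound K N g) (p : ℤ) : NetBound K p (fun ε t => f ε t • g ε t) := by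
  simpa using (hf (p - N)).smul hg

/-! ### Nets of solutions of the wave equation -/

section Nets

variable {H : Type*} [NormedAddCommGroup H] [NormedSpace ℝ H] {M : H →L[ℝ] H} {K : Set ℝ}
  {m : ℤ} {q : ℝ} {β β' : Eps → ℝ → ℝ} {X : Eps → ℝ → H} {k : ℕ}

/-- The operators `M ^ l` do not depend on `ε`, so only products of one coefficient derivative and
one derivative of `X` matter. -/
theorem netBound_waveSum
    (hA : ∀ l ≤ k, NetBound K m (fun ε t =>
      iteratedDerivWithin l (β ε) (Ici 0) t • scaleDeriv M (2 + (k - l)) (X ε) t))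
    (hB : ∀ l ≤ k, NetBound K m (fun ε t =>
      iteratedDerivWithin l (β ε) (Ici 0) t • scaleDeriv M (k - l) (X ε) t))
    (hC : ∀ l ≤ k, NetBound K m (fun ε t =>
      iteratedDerivWithin l (β' ε) (Ici 0) t • scaleDeriv M (1 + (k - l)) (X ε) t)) :
    NetBound K m (fun ε t => waveSum M q k (β ε) (β' ε) (X ε) t) := by
  unfold waveSum
  refine NetBound.sum fun l hl => ?_
  have hl' : l ≤ k := by simpa [Nat.lt_succ_iff] using hl
  have h1 := ((hA l hl').add (((hB l hl').sub (((hB l hl').clm M).clm M)).const_smul q)).clm (M ^ l)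
  have h2 := ((hC l hl').clm M).clm (M ^ l)
  refine ((h1.add h2).const_smul (k.choose l : ℝ)).congr fun ε t _ => ?_
  simp only [waveMain, map_add, map_smul, map_sub, smul_add, smul_sub,
    smul_comm q (iteratedDerivWithin l (β ε) (Ici 0) t), Nat.cast_smul_eq_nsmul]

/-- The wave equation expresses the highest derivative by lower ones. -/
theorem netBound_smul_scaleDeriv
    (hR : NetBound K m (fun ε t => waveSum M q k (β ε) (β' ε) (X ε) t))
    (hA : ∀ l ≤ k, 0 < l → NetBound K m (fun ε t =>
      iteratedDerivWithin l (β ε) (Ici 0) t • scaleDeriv M (2 + (k - l)) (X ε) t))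
    (hB : ∀ l ≤ k, NetBound K m (fun ε t =>
      iteratedDerivWithin l (β ε) (Ici 0) t • scaleDeriv M (k - l) (X ε) t))
    (hC : ∀ l ≤ k, NetBound K m (fun ε t =>
      iteratedDerivWithin l (β' ε) (Ici 0) t • scaleDeriv M (1 + (k - l)) (X ε) t)) :
    NetBound K m (fun ε t => β ε t • scaleDeriv M (2 + k) (X ε) t) := by
  have hsum : NetBound K m (fun ε t => ∑ l ∈ Finset.range k, k.choose (l + 1) •
      (iteratedDerivWithin (l + 1) (β ε) (Ici 0) t • (M ^ (l + 1))
          (waveMain M q (k - (l + 1)) (X ε) t) +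
        iteratedDerivWithin (l + 1) (β' ε) (Ici 0) t •
          (M ^ (l + 1)) (M (scaleDeriv M (1 + (k - (l + 1))) (X ε) t)))) := by
    refine NetBound.sum fun l hl => ?_
    have hl' : l + 1 ≤ k := by simpa using hl
    have h1 := ((hA _ hl' l.succ_pos).add
      (((hB _ hl').sub (((hB _ hl').clm M).clm M)).const_smul q)).clm (M ^ (l + 1))
    have h2 := ((hC _ hl').clm M).clm (M ^ (l + 1))
    refine ((h1.add h2).const_smul (k.choose (l + 1) : ℝ)).congr fun ε t _ => ?_
    simp only [waveMain, map_add, map_smul, map_sub, smul_add, smul_sub,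
      smul_comm q (iteratedDerivWithin (l + 1) (β ε) (Ici 0) t), Nat.cast_smul_eq_nsmul]
  have hB0 := hB 0 (Nat.zero_le k)
  have hC0 := hC 0 (Nat.zero_le k)
  -- The highest derivative occurs only in the term `l = 0` of the Leibniz sum, and there without
  -- any power of `M`; everything else is moved to the other side.
  refine (((hR.sub hsum).sub (hC0.clm M)).sub
    ((hB0.sub ((hB0.clm M).clm M)).const_smul q)).congr fun ε t _ => ?_
  rw [waveSum, Finset.sum_range_succ']
  simp only [waveMain, iteratedDerivWithin_zero, Nat.choose_zero_right, one_smul, pow_zero,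
    one_apply_eq_self, Nat.sub_zero, map_smul, smul_add, smul_sub, smul_comm q (β ε t)]
  abel

/-- Exact powers of `ε` for the time derivatives of solutions. -/
theorem netBound_scaleDeriv_of_solution {r : ℝ} (hr : 0 < r)
    (hβ : ∀ ε, ∀ t ∈ K, r ≤ β ε t)
    (hβl : ∀ l : ℕ, NetBound K (-l) (fun ε t => iteratedDerivWithin l (β ε) (Ici 0) t))
    (hβl' : ∀ l : ℕ, NetBound K (-1 - l) (fun ε t => iteratedDerivWithin l (β' ε) (Ici 0) t))
    (h : ∀ k ε, ∀ t ∈ K, waveSum M q k (β ε) (β' ε) (X ε) t = 0)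
    (h0 : NetBound K 0 (fun ε t => scaleDeriv M 0 (X ε) t))
    (h1 : NetBound K (-1) (fun ε t => scaleDeriv M 1 (X ε) t)) (k : ℕ) :
    NetBound K (-k) (fun ε t => scaleDeriv M k (X ε) t) := by
  induction k using Nat.strong_induction_on with
  | _ k ih =>
    rcases k with _ | _ | k
    · simpa using h0
    · simpa using h1
    · have hI : ∀ j ≤ k + 1, NetBound K (-j) (fun ε t => scaleDeriv M j (X ε) t) :=
        fun j hj => ih j (by omega)
      -- The exponents balance: `-l - (2 + k - l)` and `-1 - l - (1 + k - l)` both equal `-(k + 2)`,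
      -- and the zeroth order term is better by two powers.
      have key : NetBound K (-(k + 2 : ℕ)) (fun ε t => β ε t • scaleDeriv M (2 + k) (X ε) t) := by
        refine netBound_smul_scaleDeriv (q := q) (β' := β')
          (NetBound.zero.congr fun ε t ht => h k ε t ht) (fun l hl hl0 => ?_) (fun l hl => ?_)
          (fun l hl => ?_)
        · exact ((hβl l).smul (hI (2 + (k - l)) (by omega))).mono (by omega)
        · exact ((hβl l).smul (hI (k - l) (by omega))).mono (by omega)
        · exact ((hβl' l).smul (hI (1 + (k - l)) (by omega))).mono (by omega)
      rw [add_comm 2 k] at key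
      obtain ⟨c, hc⟩ := key
      refine ⟨c / r, fun ε t ht => ?_⟩
      have e1 := hc ε t ht
      have e2 := hβ ε t ht
      rw [norm_smul, Real.norm_of_nonneg (hr.le.trans e2)] at e1
      rw [div_mul_eq_mul_div, le_div_iff₀ hr]
      nlinarith [norm_nonneg (scaleDeriv M (k + 1 + 1) (X ε) t)]

end Nets

/-! ### Time regularity of solutions -/

section Regularity

variable {H : Type*} [NormedAddCommGroup H] [NormedSpace ℝ H] {M : H →L[ℝ] H}

theorem contDiffOn_succ_of_hasDerivWithinAt {f g : ℝ → H} {k : ℕ}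
    (hf : ∀ t, 0 ≤ t → HasDerivWithinAt f (g t) (Ici 0) t) (hg : ContDiffOn ℝ k g (Ici 0)) :
    ContDiffOn ℝ (k + 1 : ℕ) f (Ici 0) := by
  rw [Nat.cast_add, Nat.cast_one, contDiffOn_succ_iff_derivWithin (uniqueDiffOn_Ici 0)]
  refine ⟨fun t ht => (hf t ht).differentiableWithinAt, fun h => ?_, hg.congr fun t ht =>
    (hf t ht).derivWithin (uniqueDiffOn_Ici 0 t ht)⟩
  exact absurd h (by simp)

variable {q : ℝ} {a : ℝ → ℝ} {X Y : ℝ → H}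

/-- Bootstrap on the first-order system: the derivatives of `M ^ (k + 1) X` and `M ^ (k + 1) Y` are
`M ^ k` applied to expressions in `X` and `Y` that are already of class `C^k`. -/
theorem contDiffOn_pow_of_wave (ha : ContDiffOn ℝ ∞ a (Ici 0)) (hXc : ContinuousOn X (Ici 0))
    (hYc : ContinuousOn Y (Ici 0))
    (hX : ∀ t, 0 ≤ t → HasDerivWithinAt (fun τ => M (X τ)) (Y t) (Ici 0) t)
    (hY : ∀ t, 0 ≤ t → HasDerivWithinAt (fun τ => M (Y τ))
      (-(q • (X t - M (M (X t)))) - a t • M (Y t)) (Ici 0) t) (k : ℕ) :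
    ContDiffOn ℝ k (fun t => (M ^ k) (X t)) (Ici 0) ∧
      ContDiffOn ℝ k (fun t => (M ^ k) (Y t)) (Ici 0) := by
  induction k with
  | zero => simpa using ⟨hXc, hYc⟩
  | succ k ih =>
    obtain ⟨h1, h2⟩ := ih
    have hak : ContDiffOn ℝ k a (Ici 0) := ha.of_le (by exact_mod_cast le_top)
    have hc : ∀ {Z : ℝ → H}, ContDiffOn ℝ k (fun t => (M ^ k) (Z t)) (Ici 0) →
        ContDiffOn ℝ k (fun t => (M ^ k) (M (Z t))) (Ici 0) := fun h => by
      have := M.contDiff.comp_contDiffOn h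
      refine this.congr fun t _ => ?_
      rw [← mul_apply_eq_comp, ← pow_succ, pow_succ', mul_apply_eq_comp]
      rfl
    constructor
    · refine contDiffOn_succ_of_hasDerivWithinAt (g := fun t => (M ^ k) (Y t)) (fun t ht => ?_) h2
      have := (M ^ k).hasFDerivAt.comp_hasDerivWithinAt t (hX t ht)
      simpa only [pow_succ, mul_apply_eq_comp, Function.comp_def] using this
    · refine contDiffOn_succ_of_hasDerivWithinAt
        (g := fun t => (M ^ k) (-(q • (X t - M (M (X t)))) - a t • M (Y t))) (fun t ht => ?_) ?_
      · have := (M ^ k).hasFDerivAt.comp_hasDerivWithinAt t (hY t ht)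
        simpa only [pow_succ, mul_apply_eq_comp, Function.comp_def] using this
      · simp only [map_sub, map_neg, map_smul]
        exact (((h1.sub (hc (hc h1))).const_smul q).neg).sub (hak.smul (hc h2))

theorem isScaleSmooth_of_wave (ha : ContDiffOn ℝ ∞ a (Ici 0)) (hXc : ContinuousOn X (Ici 0))
    (hYc : ContinuousOn Y (Ici 0))
    (hX : ∀ t, 0 ≤ t → HasDerivWithinAt (fun τ => M (X τ)) (Y t) (Ici 0) t)
    (hY : ∀ t, 0 ≤ t → HasDerivWithinAt (fun τ => M (Y τ))
      (-(q • (X t - M (M (X t)))) - a t • M (Y t)) (Ici 0) t) :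
    IsScaleSmooth M X ∧ (∀ t, 0 ≤ t → scaleDeriv M 1 X t = Y t) ∧
      ∀ t, 0 ≤ t → waveMain M q 0 X t + a t • M (scaleDeriv M 1 X t) = 0 := by
  have hs : IsScaleSmooth M X := fun k => (contDiffOn_pow_of_wave ha hXc hYc hX hY k).1
  have h1 : ∀ t, 0 ≤ t → scaleDeriv M 1 X t = Y t := fun t ht => by
    have e := hasDerivWithinAt_scaleDeriv hs 0 ht
    rw [scaleDeriv_zero] at e
    exact (uniqueDiffOn_Ici 0 t ht).eq_deriv _ e (hX t ht)
  refine ⟨hs, h1, fun t ht => ?_⟩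
  have e := (hasDerivWithinAt_scaleDeriv hs 1 ht).congr (f₁ := fun τ => M (Y τ))
    (fun τ hτ => by rw [h1 τ hτ]) (by rw [h1 t ht])
  have e2 := (uniqueDiffOn_Ici 0 t ht).eq_deriv _ e (hY t ht)
  rw [waveMain, scaleDeriv_zero, h1 t ht, e2]
  abel

end Regularity

/-! ### Existence and comparison of nets of solutions -/

section Cauchy

variable {H : Type*} [NormedAddCommGroup H] [InnerProductSpace ℝ H] {M : H →L[ℝ] H}
  {q : ℝ}

/-- Solutions of the regularised problems, with exact powers of `ε` for their derivatives. -/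
theorem CutoffInverse.exists_net_solution [CompleteSpace H] (S : CutoffInverse M) (hq : 1 ≤ q)
    {β β' : Eps → ℝ → ℝ} (hβ : ∀ ε, ContDiffOn ℝ ∞ (β ε) (Ici 0))
    (hβ' : ∀ ε, ContDiffOn ℝ ∞ (β' ε) (Ici 0)) {r : ℝ} (hr : 0 < r)
    (hβr : ∀ ε t, 0 ≤ t → r ≤ β ε t) (hβ0 : ∀ ε t, 0 ≤ t → 0 ≤ β' ε t)
    (hβl : ∀ T (l : ℕ), NetBound (Icc 0 T) (-l) fun ε t => iteratedDerivWithin l (β ε) (Ici 0) t)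
    (hβl' : ∀ T (l : ℕ),
      NetBound (Icc 0 T) (-1 - l) fun ε t => iteratedDerivWithin l (β' ε) (Ici 0) t) (X₀ Y₀ : H) :
    ∃ X : Eps → ℝ → H, (∀ ε, IsScaleSmooth M (X ε)) ∧
      (∀ ε t, 0 ≤ t → waveMain M q 0 (X ε) t + (β' ε t / β ε t) • M (scaleDeriv M 1 (X ε) t) = 0) ∧
      (∀ ε, X ε 0 = X₀) ∧ (∀ ε, scaleDeriv M 1 (X ε) 0 = Y₀) ∧
      ∀ T (k : ℕ), NetBound (Icc 0 T) (-k) fun ε t => scaleDeriv M k (X ε) t := by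
  have hne : ∀ ε t, 0 ≤ t → β ε t ≠ 0 := fun ε t ht => (hr.trans_le (hβr ε t ht)).ne'
  have ha : ∀ ε, ContDiffOn ℝ ∞ (fun t => β' ε t / β ε t) (Ici 0) := fun ε =>
    (hβ' ε).div (hβ ε) fun t ht => hne ε t ht
  have ha0 : ∀ ε t, 0 ≤ t → 0 ≤ β' ε t / β ε t := fun ε t ht =>
    div_nonneg (hβ0 ε t ht) (hr.le.trans (hβr ε t ht))
  choose X Y hXc hYc hX0 hY0 hX hY using fun ε =>
    S.exists_solution hq (ha ε).continuousOn (ha0 ε) X₀ Y₀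
  have hreg := fun ε => isScaleSmooth_of_wave (ha ε) (hXc ε) (hYc ε) (hX ε) (hY ε)
  refine ⟨X, fun ε => (hreg ε).1, fun ε => (hreg ε).2.2, hX0, fun ε => ?_, fun T k => ?_⟩
  · rw [(hreg ε).2.1 0 le_rfl, hY0]
  -- This bound does not depend on `ε`, because the coefficient enters the energy estimate only
  -- through its sign.
  have hen : ∀ ε, ∀ t ∈ Icc 0 T, q * ‖X ε t‖ ^ 2 + ‖Y ε t‖ ^ 2 ≤
      (q * ‖X₀‖ ^ 2 + ‖Y₀‖ ^ 2) * Real.exp ((q + 1) * T) := fun ε t ht => by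
    have h := S.energy_le (q := q) (a := fun t => β' ε t / β ε t) (f := fun _ => 0) (F := 0)
      (X := X ε) (Y := Y ε) (T := T)
      (by linarith) (fun t ht => ha0 ε t ht.1) (by simp) (fun t ht => hX ε t ht.1)
      (fun t ht => by simpa using hY ε t ht.1) t ht
    rw [hX0, hY0, zero_pow two_ne_zero, add_zero] at h
    refine h.trans (mul_le_mul_of_nonneg_left ?_ (by positivity))
    exact Real.exp_le_exp.2 (mul_le_mul_of_nonneg_left ht.2 (by linarith))
  set C := (q * ‖X₀‖ ^ 2 + ‖Y₀‖ ^ 2) * Real.exp ((q + 1) * T) with hC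
  refine netBound_scaleDeriv_of_solution (q := q) hr (fun ε t ht => hβr ε t ht.1) (hβl T) (hβl' T)
    (fun k ε t ht => waveSum_eq_zero (hβ ε) (hβ' ε) (hreg ε).1 (fun t ht => ?_) k ht.1) ?_ ?_ k
  -- Multiplication by `β` removes the quotient, so that only derivatives of `β` and `β'` have to be
  -- estimated.
  · have h := congrArg (fun z => β ε t • z) ((hreg ε).2.2 t ht)
    simp only [smul_add, smul_smul, smul_zero, mul_div_cancel₀ _ (hne ε t ht)] at h
    exact h
  · refine ⟨√C, fun ε t ht => ?_⟩
    simp only [scaleDeriv_zero, zpow_zero, mul_one]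
    refine Real.le_sqrt_of_sq_le (le_trans ?_ (hen ε t ht))
    nlinarith [sq_nonneg ‖X ε t‖, sq_nonneg ‖Y ε t‖]
  · refine NetBound.mono (m' := 0) ⟨√C, fun ε t ht => ?_⟩ (by norm_num)
    simp only [(hreg ε).2.1 t ht.1, zpow_zero, mul_one]
    refine Real.le_sqrt_of_sq_le (le_trans ?_ (hen ε t ht))
    nlinarith [sq_nonneg ‖X ε t‖, sq_nonneg ‖Y ε t‖]

variable {β β' γ γ' : Eps → ℝ → ℝ} {U V : Eps → ℝ → H} {T ε₀ r : ℝ}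

/-- The energy estimate for the difference of two nets of solutions. -/
theorem CutoffInverse.netBound_sub_of_energy (S : CutoffInverse M) (hq : 1 ≤ q)
    (hU : ∀ ε, IsScaleSmooth M (U ε)) (hV : ∀ ε, IsScaleSmooth M (V ε)) {N : ℤ}
    (hβN : NetBound (Icc 0 T) N β) (hβN' : NetBound (Icc 0 T) N β')
    (hVN : NetBound (Icc 0 T) N fun ε t => scaleDeriv M 1 (V ε) t)
    (hd : ∀ p, NetBound (Icc 0 T) p (γ - β)) (hd' : ∀ p, NetBound (Icc 0 T) p (γ' - β'))
    (hr : 0 < r) (hβr : ∀ ε : Eps, (ε : ℝ) ≤ ε₀ → ∀ t ∈ Icc 0 T, r ≤ β ε t)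
    (hγr : ∀ ε : Eps, (ε : ℝ) ≤ ε₀ → ∀ t ∈ Icc 0 T, r ≤ γ ε t)
    (hβ0 : ∀ ε : Eps, (ε : ℝ) ≤ ε₀ → ∀ t ∈ Icc 0 T, 0 ≤ β' ε t)
    (hsU : ∀ ε t, 0 ≤ t → waveMain M q 0 (U ε) t + (β' ε t / β ε t) • M (scaleDeriv M 1 (U ε) t) = 0)
    (hsV : ∀ ε t, 0 ≤ t → waveMain M q 0 (V ε) t + (γ' ε t / γ ε t) • M (scaleDeriv M 1 (V ε) t) = 0)
    (h0 : ∀ ε, U ε 0 = V ε 0) (h1 : ∀ ε, scaleDeriv M 1 (U ε) 0 = scaleDeriv M 1 (V ε) 0)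
    (p : ℤ) : ∃ c : ℝ, ∀ ε : Eps, (ε : ℝ) ≤ ε₀ → ∀ t ∈ Icc 0 T,
      ‖(U ε - V ε) t‖ ≤ c * (ε : ℝ) ^ p ∧ ‖scaleDeriv M 1 (U ε - V ε) t‖ ≤ c * (ε : ℝ) ^ p := by
  -- Up to sign this is the numerator of `(γ' / γ - β' / β) V'`: writing `β' γ - β γ'` through the
  -- differences `γ - β` and `γ' - β'` shows that it is negligible.
  have hg : NetBound (Icc 0 T) p fun ε t =>
      (β' ε t • (γ - β) ε t - β ε t • (γ' - β') ε t) • scaleDeriv M 1 (V ε) t :=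
    NetBound.smul_of_forall_left (f := fun ε t => β' ε t • (γ - β) ε t - β ε t • (γ' - β') ε t)
      (fun p => (hβN'.smul_of_forall hd p).sub (hβN.smul_of_forall hd' p)) hVN p
  obtain ⟨c, hc⟩ := hg
  have hcE : 1 ≤ Real.exp ((q + 1) * |T|) := Real.one_le_exp (by positivity)
  -- The factor `r ^ 2` bounds the denominator `β γ` from below. The absolute value of `T` makes the
  -- exponential at least `1` for every real `T`.
  refine ⟨|c| / r ^ 2 * Real.exp ((q + 1) * |T|), fun ε hε => ?_⟩
  set F := |c| / r ^ 2 * (ε : ℝ) ^ p with hF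
  have hF0 : 0 ≤ F := by have := zpow_pos ε.pos p; positivity
  let f : ℝ → H := fun t => (γ' ε t / γ ε t - β' ε t / β ε t) • scaleDeriv M 1 (V ε) t
  have hf : ∀ t ∈ Icc 0 T, ‖f t‖ ≤ F := fun t ht => by
    have hb := hβr ε hε t ht
    have hγ := hγr ε hε t ht
    have hb0 : 0 < β ε t := hr.trans_le hb
    have hγ0 : 0 < γ ε t := hr.trans_le hγ
    have e : f t = (-(β ε t * γ ε t)⁻¹) •
        ((β' ε t • (γ - β) ε t - β ε t • (γ' - β') ε t) • scaleDeriv M 1 (V ε) t) := by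
      simp only [f]
      rw [smul_smul]
      congr 1
      simp only [Pi.sub_apply, smul_eq_mul]
      field_simp
      ring
    have h2 : r ^ 2 ≤ β ε t * γ ε t := by nlinarith
    have h3 : (β ε t * γ ε t)⁻¹ ≤ (r ^ 2)⁻¹ := inv_anti₀ (by positivity) h2
    rw [e, norm_smul, norm_neg, norm_inv, Real.norm_of_nonneg (by positivity : 0 ≤ β ε t * γ ε t), hF]
    have h4 : ‖(β' ε t • (γ - β) ε t - β ε t • (γ' - β') ε t) • scaleDeriv M 1 (V ε) t‖ ≤
        |c| * (ε : ℝ) ^ p := (hc ε t ht).trans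
      (mul_le_mul_of_nonneg_right (le_abs_self c) (zpow_pos ε.pos p).le)
    calc _ ≤ (r ^ 2)⁻¹ * (|c| * (ε : ℝ) ^ p) := mul_le_mul h3 h4 (norm_nonneg _) (by positivity)
      _ = _ := by ring
  have hW := (hU ε).sub (hV ε)
  have hen := S.energy_le (q := q) (a := fun t => β' ε t / β ε t) (f := f) (F := F)
    (X := U ε - V ε) (Y := scaleDeriv M 1 (U ε - V ε)) (T := T) (by linarith)
    (fun t ht => div_nonneg (hβ0 ε hε t ht) (hr.le.trans (hβr ε hε t ht))) hf
    (fun t ht => by simpa using hasDerivWithinAt_scaleDeriv hW 0 ht.1)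
    (fun t ht => by
      refine (hasDerivWithinAt_scaleDeriv hW 1 ht.1).congr_deriv ?_
      have e1 := hsU ε t ht.1
      have e2 := hsV ε t ht.1
      rw [waveMain, scaleDeriv_zero, add_assoc, add_eq_zero_iff_eq_neg] at e1 e2
      rw [scaleDeriv_sub (hU ε) (hV ε) _ ht.1, scaleDeriv_sub (hU ε) (hV ε) _ ht.1]
      change scaleDeriv M (2 + 0) (U ε) t - scaleDeriv M (2 + 0) (V ε) t = _
      rw [e1, e2]
      simp only [f, Pi.sub_apply, map_sub, map_smul, smul_sub, sub_smul]
      abel)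
  intro t ht
  have h2 := hen t ht
  have e0 : ‖(U ε - V ε) 0‖ = 0 := by rw [Pi.sub_apply, h0, sub_self, norm_zero]
  have e1 : ‖scaleDeriv M 1 (U ε - V ε) 0‖ = 0 := by
    rw [scaleDeriv_sub (hU ε) (hV ε) _ le_rfl, h1, sub_self, norm_zero]
  rw [e0, e1, zero_pow two_ne_zero, mul_zero, add_zero, zero_add] at h2
  have h3 : Real.exp ((q + 1) * t) ≤ Real.exp ((q + 1) * |T|) := Real.exp_le_exp.2
    (mul_le_mul_of_nonneg_left (ht.2.trans (le_abs_self T)) (by linarith))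
  -- The exponential is at least `1`, so it may be replaced by its square; then the square root of
  -- the energy bound is again linear in `F`.
  have h4 : F ^ 2 * Real.exp ((q + 1) * t) ≤ (F * Real.exp ((q + 1) * |T|)) ^ 2 := by
    rw [mul_pow F]
    exact mul_le_mul_of_nonneg_left (h3.trans (le_self_pow₀ hcE two_ne_zero)) (sq_nonneg F)
  have h5 : |c| / r ^ 2 * Real.exp ((q + 1) * |T|) * (ε : ℝ) ^ p =
      F * Real.exp ((q + 1) * |T|) := by rw [hF]; ring
  rw [h5]
  have hFE : 0 ≤ F * Real.exp ((q + 1) * |T|) := by positivity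
  constructor
  · refine (sq_le_sq₀ (norm_nonneg _) hFE).1 ?_
    nlinarith [sq_nonneg ‖(U ε - V ε) t‖, sq_nonneg ‖scaleDeriv M 1 (U ε - V ε) t‖]
  · refine (sq_le_sq₀ (norm_nonneg _) hFE).1 ?_
    nlinarith [sq_nonneg ‖(U ε - V ε) t‖, sq_nonneg ‖scaleDeriv M 1 (U ε - V ε) t‖]

/-- Two nets of solutions whose coefficients differ by negligible nets differ by a negligible
net. -/
theorem CutoffInverse.netBound_sub (S : CutoffInverse M) (hq : 1 ≤ q)
    (hU : ∀ ε, IsScaleSmooth M (U ε)) (hV : ∀ ε, IsScaleSmooth M (V ε))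
    (hUm : ∀ k, ∃ N : ℤ, NetBound (Icc 0 T) N fun ε t => scaleDeriv M k (U ε) t)
    (hVm : ∀ k, ∃ N : ℤ, NetBound (Icc 0 T) N fun ε t => scaleDeriv M k (V ε) t)
    (hβ : ∀ ε, ContDiffOn ℝ ∞ (β ε) (Ici 0)) (hβ' : ∀ ε, ContDiffOn ℝ ∞ (β' ε) (Ici 0))
    (hγ : ∀ ε, ContDiffOn ℝ ∞ (γ ε) (Ici 0)) (hγ' : ∀ ε, ContDiffOn ℝ ∞ (γ' ε) (Ici 0))
    (hβm : ∀ l, ∃ N : ℤ, NetBound (Icc 0 T) N fun ε t => iteratedDerivWithin l (β ε) (Ici 0) t)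
    (hβm' : ∀ l, ∃ N : ℤ, NetBound (Icc 0 T) N fun ε t => iteratedDerivWithin l (β' ε) (Ici 0) t)
    (hd : ∀ l p, NetBound (Icc 0 T) p fun ε t => iteratedDerivWithin l (γ ε - β ε) (Ici 0) t)
    (hd' : ∀ l p, NetBound (Icc 0 T) p fun ε t => iteratedDerivWithin l (γ' ε - β' ε) (Ici 0) t)
    (hε₀ : 0 < ε₀) (hr : 0 < r) (hβr : ∀ ε : Eps, (ε : ℝ) ≤ ε₀ → ∀ t ∈ Icc 0 T, r ≤ β ε t)
    (hγr : ∀ ε : Eps, (ε : ℝ) ≤ ε₀ → ∀ t ∈ Icc 0 T, r ≤ γ ε t)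
    (hβ0 : ∀ ε : Eps, (ε : ℝ) ≤ ε₀ → ∀ t ∈ Icc 0 T, 0 ≤ β' ε t)
    (hβne : ∀ ε t, 0 ≤ t → β ε t ≠ 0) (hγne : ∀ ε t, 0 ≤ t → γ ε t ≠ 0)
    (hsU : ∀ ε t, 0 ≤ t → waveMain M q 0 (U ε) t + (β' ε t / β ε t) • M (scaleDeriv M 1 (U ε) t) = 0)
    (hsV : ∀ ε t, 0 ≤ t → waveMain M q 0 (V ε) t + (γ' ε t / γ ε t) • M (scaleDeriv M 1 (V ε) t) = 0)
    (h0 : ∀ ε, U ε 0 = V ε 0) (h1 : ∀ ε, scaleDeriv M 1 (U ε) 0 = scaleDeriv M 1 (V ε) 0)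
    (k : ℕ) (p : ℤ) : NetBound (Icc 0 T) p fun ε t => scaleDeriv M k (U ε - V ε) t := by
  -- Moderateness of the difference serves for those `ε` that are not small, where the lower bounds
  -- on the coefficients may fail.
  have hWm : ∀ k, ∃ N : ℤ, NetBound (Icc 0 T) N fun ε t => scaleDeriv M k (U ε - V ε) t := by
    intro k
    obtain ⟨N, hN⟩ := hUm k
    obtain ⟨N', hN'⟩ := hVm k
    refine ⟨min N N', ((hN.mono (min_le_left _ _)).sub (hN'.mono (min_le_right _ _))).congr
      fun ε t ht => scaleDeriv_sub (hU ε) (hV ε) k ht.1⟩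
  have hen : ∀ p : ℤ, ∃ c : ℝ, ∀ ε : Eps, (ε : ℝ) ≤ ε₀ → ∀ t ∈ Icc 0 T,
      ‖(U ε - V ε) t‖ ≤ c * (ε : ℝ) ^ p ∧ ‖scaleDeriv M 1 (U ε - V ε) t‖ ≤ c * (ε : ℝ) ^ p := by
    obtain ⟨N₁, hN₁⟩ := hβm 0
    obtain ⟨N₂, hN₂⟩ := hβm' 0
    obtain ⟨N₃, hN₃⟩ := hVm 1
    have hd0 := hd 0
    have hd0' := hd' 0
    simp only [iteratedDerivWithin_zero] at hN₁ hN₂ hd0 hd0'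
    exact S.netBound_sub_of_energy hq hU hV (N := min N₁ (min N₂ N₃)) (hN₁.mono (by omega))
      (hN₂.mono (by omega)) (hN₃.mono (by omega)) hd0 hd0' hr hβr hγr hβ0 hsU hsV h0 h1
  have hz : ∀ (a b : ℝ) (x y : H), b ≠ 0 → x + (a / b) • y = 0 → b • x + a • y = 0 := by
    intro a b x y hb h
    have h' := congrArg (fun z => b • z) h
    simpa only [smul_add, smul_smul, smul_zero, mul_div_cancel₀ _ hb] using h'
  induction k using Nat.strong_induction_on generalizing p with
  | _ k ih =>
    obtain ⟨N, hN⟩ := hWm k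
    rcases k with _ | _ | k
    · obtain ⟨c, hc⟩ := hen p
      exact hN.of_small p hε₀ fun ε hε t ht => by
        rw [scaleDeriv_zero]; exact (hc ε hε t ht).1
    · obtain ⟨c, hc⟩ := hen p
      exact hN.of_small p hε₀ fun ε hε t ht => (hc ε hε t ht).2
    · have hI : ∀ j ≤ k + 1, ∀ p, NetBound (Icc 0 T) p fun ε t => scaleDeriv M j (U ε - V ε) t :=
        fun j hj p => ih j (by omega) p
      have hR : NetBound (Icc 0 T) p fun ε t =>
          waveSum M q k ((γ - β) ε) ((γ' - β') ε) (V ε) t := by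
        refine netBound_waveSum (fun l _ => ?_) (fun l _ => ?_) (fun l _ => ?_)
        · obtain ⟨N', hN'⟩ := hVm (2 + (k - l))
          exact NetBound.smul_of_forall_left (hd l) hN' p
        · obtain ⟨N', hN'⟩ := hVm (k - l)
          exact NetBound.smul_of_forall_left (hd l) hN' p
        · obtain ⟨N', hN'⟩ := hVm (1 + (k - l))
          exact NetBound.smul_of_forall_left (hd' l) hN' p
      have key : NetBound (Icc 0 T) p fun ε t => β ε t • scaleDeriv M (2 + k) (U ε - V ε) t := by
        refine netBound_smul_scaleDeriv (q := q) (β' := β') (X := fun ε => U ε - V ε)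
          (hR.congr fun ε t ht => ?_) (fun l hl hl0 => ?_) (fun l hl => ?_) (fun l hl => ?_)
        -- Both equations hold exactly, so the wave sum of `U - V` equals that of `V` with the
        -- negligible coefficients `γ - β` and `γ' - β'`.
        · rw [waveSum_sub (hβ ε) (hβ' ε) (hγ ε) (hγ' ε) (hU ε) (hV ε) k ht.1,
            waveSum_eq_zero (hβ ε) (hβ' ε) (hU ε)
              (fun t ht => hz _ _ _ _ (hβne ε t ht) (hsU ε t ht)) k ht.1,
            waveSum_eq_zero (hγ ε) (hγ' ε) (hV ε)
              (fun t ht => hz _ _ _ _ (hγne ε t ht) (hsV ε t ht)) k ht.1]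
          simp
        · obtain ⟨N', hN'⟩ := hβm l
          exact hN'.smul_of_forall (hI _ (by omega)) p
        · obtain ⟨N', hN'⟩ := hβm l
          exact hN'.smul_of_forall (hI _ (by omega)) p
        · obtain ⟨N', hN'⟩ := hβm' l
          exact hN'.smul_of_forall (hI _ (by omega)) p
      rw [add_comm 2 k] at key
      exact hN.of_smul key hε₀ hr hβr

end Cauchy

/-! ### Multiplication operators on the frequency side -/

/-- Square integrable functions of the frequency. -/
abbrev FreqSpace (n : ℕ) : Type := Lp ℂ 2 (volume : Measure (EuclideanSpace ℝ (Fin n)))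

namespace FreqSpace

variable {n : ℕ}

/-- Multiplication by a bounded function. -/
def mul (g : EuclideanSpace ℝ (Fin n) → ℝ) (hg : MemLp (fun ξ => (g ξ : ℂ)) ⊤ volume) :
    FreqSpace n →L[ℝ] FreqSpace n :=
  LinearMap.mkContinuous
    { toFun := fun f => hg.toLp _ • f
      map_add' := fun _ _ => Lp.add_smul _ _ _
      map_smul' := fun c _ => (Lp.smul_comm c _ _).symm }
    ‖hg.toLp _‖ fun _ => Lp.norm_smul_le _ _

theorem mul_apply (g : EuclideanSpace ℝ (Fin n) → ℝ) (hg : MemLp (fun ξ => (g ξ : ℂ)) ⊤ volume)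
    (f : FreqSpace n) : mul g hg f = hg.toLp _ • f := rfl

variable {g h : EuclideanSpace ℝ (Fin n) → ℝ} {hg : MemLp (fun ξ => (g ξ : ℂ)) ⊤ volume}
  {hh : MemLp (fun ξ => (h ξ : ℂ)) ⊤ volume}

theorem fn_mul (f : FreqSpace n) : (mul g hg f) =ᵐ[volume] fun ξ => (g ξ : ℂ) * f ξ := by
  filter_upwards [Lp.coeFn_lpSMul (r := 2) (hg.toLp _) f, hg.coeFn_toLp] with ξ h1 h2
  rw [mul_apply, h1, Pi.smul_apply', h2, smul_eq_mul]

theorem norm_mul_le {C : ℝ} (hC : ∀ ξ, |g ξ| ≤ C) (f : FreqSpace n) : ‖mul g hg f‖ ≤ C * ‖f‖ := by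
  refine Lp.norm_le_mul_norm_of_ae_le_mul (E := ℂ) (F := ℂ) (p := 2) ?_
  filter_upwards [fn_mul (hg := hg) f] with ξ h1
  refine (congrArg norm h1).le.trans ?_
  rw [norm_mul, Complex.norm_real]
  exact mul_le_mul_of_nonneg_right (hC ξ) (norm_nonneg _)

theorem mul_mul_eq {k : EuclideanSpace ℝ (Fin n) → ℝ} {hk : MemLp (fun ξ => (k ξ : ℂ)) ⊤ volume}
    (h' : ∀ ξ, g ξ * h ξ = k ξ) (f : FreqSpace n) : mul g hg (mul h hh f) = mul k hk f := by
  refine Lp.ext ?_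
  filter_upwards [fn_mul (hg := hg) (mul h hh f), fn_mul (hg := hh) f, fn_mul (hg := hk) f]
    with ξ h1 h2 h3
  rw [h1, h2, h3, ← h' ξ]
  push_cast
  ring

theorem inner_mul_left (f f' : FreqSpace n) :
    inner ℝ (mul g hg f) f' = inner ℝ f (mul g hg f') := by
  rw [L2.inner_def, L2.inner_def]
  refine integral_congr_ae ?_
  filter_upwards [fn_mul (hg := hg) f, fn_mul (hg := hg) f'] with ξ h1 h2
  rw [h1, h2]
  simp only [Complex.inner, map_mul, Complex.conj_ofReal]
  ring_nf

/-- Dominated convergence for `|F j - f|²`, with `|f|²` as the dominating function. -/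
theorem tendsto_of_ae {f : FreqSpace n} {F : ℕ → FreqSpace n}
    (hF : ∀ j, ∀ᵐ ξ, ‖F j ξ - f ξ‖ ≤ ‖f ξ‖)
    (hlim : ∀ᵐ ξ, Filter.Tendsto (fun j => F j ξ) Filter.atTop (𝓝 (f ξ))) :
    Filter.Tendsto F Filter.atTop (𝓝 f) := by
  have hfn : ∀ᵐ ξ, ∀ j, (F j - f : FreqSpace n) ξ = F j ξ - f ξ :=
    ae_all_iff.2 fun j => Lp.coeFn_sub (F j) f
  have hint : Filter.Tendsto (fun j => ∫ ξ, inner ℝ ((F j - f : FreqSpace n) ξ) ((F j - f : FreqSpace n) ξ))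
      Filter.atTop (𝓝 (∫ _ : EuclideanSpace ℝ (Fin n), (0 : ℝ))) := by
    refine tendsto_integral_of_dominated_convergence
      (fun ξ => ‖(inner ℝ (f ξ) (f ξ) : ℝ)‖)
      (fun j => (L2.integrable_inner (𝕜 := ℝ) (F j - f) (F j - f)).aestronglyMeasurable)
      (L2.integrable_inner (𝕜 := ℝ) f f).norm (fun j => ?_) ?_
    · filter_upwards [hF j, hfn] with ξ h1 h2
      rw [h2 j]
      rw [real_inner_self_eq_norm_sq, real_inner_self_eq_norm_sq, norm_pow, norm_pow, norm_norm,
        norm_norm]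
      exact pow_le_pow_left₀ (norm_nonneg _) h1 2
    · filter_upwards [hlim, hfn] with ξ h1 h2
      simp only [h2]
      have h3 : Filter.Tendsto (fun j => F j ξ - f ξ) Filter.atTop (𝓝 0) := by
        simpa using h1.sub_const (f ξ)
      simpa using h3.inner (𝕜 := ℝ) h3
  have hre : Filter.Tendsto (fun j => ‖F j - f‖ ^ 2) Filter.atTop (𝓝 0) := by
    rw [integral_zero] at hint
    refine hint.congr fun j => ?_
    rw [← real_inner_self_eq_norm_sq, L2.inner_def]
  rw [tendsto_iff_norm_sub_tendsto_zero]
  simpa using hre.sqrt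

/-- The function `(1 + |ξ|²) ^ (a / 2)`. -/
def japanese (n : ℕ) (a : ℝ) (ξ : EuclideanSpace ℝ (Fin n)) : ℝ := (1 + ‖ξ‖ ^ 2) ^ (a / 2)

theorem hasTemperateGrowth_japanese (a : ℝ) :
    (fun ξ => (japanese n a ξ : ℂ)).HasTemperateGrowth := by
  unfold japanese
  fun_prop

theorem japanese_pos (a : ℝ) (ξ : EuclideanSpace ℝ (Fin n)) : 0 < japanese n a ξ := by
  unfold japanese; positivity

theorem japanese_zero (ξ : EuclideanSpace ℝ (Fin n)) : japanese n 0 ξ = 1 := by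
  simp [japanese]

theorem japanese_mul (a b : ℝ) (ξ : EuclideanSpace ℝ (Fin n)) :
    japanese n a ξ * japanese n b ξ = japanese n (a + b) ξ := by
  rw [japanese, japanese, japanese, ← Real.rpow_add (by positivity), add_div]

theorem japanese_le_one {a : ℝ} (ha : a ≤ 0) (ξ : EuclideanSpace ℝ (Fin n)) :
    japanese n a ξ ≤ 1 :=
  Real.rpow_le_one_of_one_le_of_nonpos (by nlinarith [sq_nonneg ‖ξ‖]) (by linarith)

theorem continuous_japanese (a : ℝ) : Continuous (japanese n a) := by
  unfold japanese
  exact Continuous.rpow_const (by fun_prop) fun ξ => Or.inl (by positivity)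

theorem memLp_japanese {a : ℝ} (ha : a ≤ 0) :
    MemLp (fun ξ => (japanese n a ξ : ℂ)) ⊤ volume := by
  refine memLp_top_of_bound (Complex.continuous_ofReal.comp
    (continuous_japanese a)).aestronglyMeasurable 1 (Filter.Eventually.of_forall fun ξ => ?_)
  rw [Complex.norm_real, Real.norm_of_nonneg (japanese_pos a ξ).le]
  exact japanese_le_one ha ξ

/-- The inclusion `H^s ⊆ H^{s-1}` on the frequency side. -/
def incl (n : ℕ) : FreqSpace n →L[ℝ] FreqSpace n :=
  mul (japanese n (-1)) (memLp_japanese (by norm_num))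

theorem incl_pow_apply (k : ℕ) (f : FreqSpace n) :
    (incl n ^ k) f = mul (japanese n (-k)) (memLp_japanese (by simp)) f := by
  induction k with
  | zero =>
    refine Lp.ext ?_
    filter_upwards [fn_mul (hg := memLp_japanese (n := n) (a := -((0 : ℕ) : ℝ)) (by simp)) f]
      with ξ h1
    rw [h1]
    simp [japanese_zero]
  | succ k ih =>
    rw [pow_succ', mul_apply_eq_comp, ih]
    refine mul_mul_eq (fun ξ => ?_) f
    rw [japanese_mul]
    congr 1
    push_cast
    ring

/-- The weight `(1 + |ξ|²) ^ (1 / 2)`, cut off outside of the ball of radius `j`. -/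
def cutoffWeight (n j : ℕ) (ξ : EuclideanSpace ℝ (Fin n)) : ℝ :=
  (Metric.closedBall 0 (j : ℝ)).indicator (japanese n 1) ξ

theorem memLp_cutoffWeight (j : ℕ) : MemLp (fun ξ => (cutoffWeight n j ξ : ℂ)) ⊤ volume := by
  obtain ⟨C, hC⟩ := (isCompact_closedBall (0 : EuclideanSpace ℝ (Fin n)) j).exists_bound_of_continuousOn
    (continuous_japanese 1).continuousOn
  refine memLp_top_of_bound (Complex.measurable_ofReal.comp ((continuous_japanese 1).measurable.indicator
    measurableSet_closedBall)).aestronglyMeasurable |C| (Filter.Eventually.of_forall fun ξ => ?_)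
  rw [Complex.norm_real, cutoffWeight]
  by_cases h : ξ ∈ Metric.closedBall (0 : EuclideanSpace ℝ (Fin n)) j
  · rw [indicator_of_mem h]; exact (hC ξ h).trans (le_abs_self C)
  · rw [indicator_of_notMem h, norm_zero]; exact abs_nonneg C

theorem cutoffWeight_mul (j : ℕ) (ξ : EuclideanSpace ℝ (Fin n)) :
    cutoffWeight n j ξ * japanese n (-1) ξ = (Metric.closedBall 0 (j : ℝ)).indicator 1 ξ := by
  rw [cutoffWeight]
  by_cases h : ξ ∈ Metric.closedBall (0 : EuclideanSpace ℝ (Fin n)) j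
  · rw [indicator_of_mem h, indicator_of_mem h, japanese_mul, add_neg_cancel, japanese_zero]; rfl
  · rw [indicator_of_notMem h, indicator_of_notMem h, zero_mul]

theorem memLp_indicator (j : ℕ) : MemLp (fun ξ : EuclideanSpace ℝ (Fin n) =>
    (((Metric.closedBall 0 (j : ℝ)).indicator 1 ξ : ℝ) : ℂ)) ⊤ volume := by
  refine memLp_top_of_bound (Complex.measurable_ofReal.comp (measurable_one.indicator
    measurableSet_closedBall)).aestronglyMeasurable 1 (Filter.Eventually.of_forall fun ξ => ?_)
  rw [Complex.norm_real]
  exact (norm_indicator_le_norm_self _ _).trans (by simp)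

/-- Frequency cutoffs as approximate inverses of the inclusion. -/
def cutoffInverse (n : ℕ) : CutoffInverse (incl n) where
  inv j := mul (cutoffWeight n j) (memLp_cutoffWeight j)
  contraction f := by
    refine (norm_mul_le (C := 1) (fun ξ => ?_) f).trans_eq (one_mul _)
    rw [abs_of_pos (japanese_pos _ _)]
    exact japanese_le_one (by norm_num) ξ
  symm j f f' := inner_mul_left f f'
  comm j f := (mul_mul_eq (hk := memLp_indicator j) (fun ξ => by
      rw [mul_comm, cutoffWeight_mul]) f).trans
    (mul_mul_eq (hk := memLp_indicator j) (fun ξ => cutoffWeight_mul j ξ) f).symm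
  proj i j hij f := (mul_mul_eq (hk := memLp_indicator j) (fun ξ => cutoffWeight_mul j ξ) _).trans
    (mul_mul_eq (hk := memLp_cutoffWeight i) (fun ξ => by
      by_cases h : ξ ∈ Metric.closedBall (0 : EuclideanSpace ℝ (Fin n)) i
      · have h' : ξ ∈ Metric.closedBall (0 : EuclideanSpace ℝ (Fin n)) j :=
          Metric.closedBall_subset_closedBall (by exact_mod_cast hij) h
        rw [indicator_of_mem h', Pi.one_apply, one_mul]
      · rw [cutoffWeight, indicator_of_notMem h, mul_zero]) f)
  proj_norm_le j f := by
    rw [show mul (cutoffWeight n j) (memLp_cutoffWeight j) (incl n f) = _ from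
      mul_mul_eq (hk := memLp_indicator j) (fun ξ => cutoffWeight_mul j ξ) f]
    refine (norm_mul_le (C := 1) (fun ξ => ?_) f).trans_eq (one_mul _)
    rw [← Real.norm_eq_abs]
    exact (norm_indicator_le_norm_self _ _).trans (by simp)
  tendsto f := by
    have e : ∀ j, mul (cutoffWeight n j) (memLp_cutoffWeight j) (incl n f) =
        mul _ (memLp_indicator j) f := fun j =>
      mul_mul_eq (hk := memLp_indicator j) (fun ξ => cutoffWeight_mul j ξ) f
    simp only [e]
    have hae := ae_all_iff.2 fun j : ℕ => fn_mul (hg := memLp_indicator j) f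
    refine tendsto_of_ae (fun j => ?_) ?_
    · filter_upwards [hae] with ξ h1
      rw [h1 j]
      by_cases h : ξ ∈ Metric.closedBall (0 : EuclideanSpace ℝ (Fin n)) j
      · simp [indicator_of_mem h]
      · simp [indicator_of_notMem h]
    · filter_upwards [hae] with ξ h1
      obtain ⟨N, hN⟩ := exists_nat_ge ‖ξ‖
      -- At a fixed frequency the sequence is constant as soon as the ball contains `ξ`.
      refine tendsto_const_nhds.congr' ?_
      filter_upwards [Filter.eventually_ge_atTop N] with j hj
      have h : ξ ∈ Metric.closedBall (0 : EuclideanSpace ℝ (Fin n)) j := by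
        rw [mem_closedBall_zero_iff]
        exact hN.trans (by exact_mod_cast hj)
      rw [h1 j, indicator_of_mem h]
      simp

end FreqSpace

/-! ### Sobolev spaces on the frequency side -/

namespace Sobolev

open FourierTransform FreqSpace

variable {n : ℕ} {s : ℝ}

theorem fourier_besselPotential_toDist (u : Sobolev n s) :
    𝓕 (besselPotential _ ℂ s (toDist u)) =
      ((𝓕 (besselMap u) : FreqSpace n) : 𝓢'(EuclideanSpace ℝ (Fin n), ℂ)) := by
  rw [besselFun_spec, Lp.fourier_toTemperedDistribution_eq]
  rfl

theorem besselMap_surjective :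
    Function.Surjective (besselMap : Sobolev n s →ₗ[ℂ] FreqSpace n) := by
  intro f
  have h : besselPotential _ ℂ s (besselPotential _ ℂ (-s)
      (f : 𝓢'(EuclideanSpace ℝ (Fin n), ℂ))) = (f : 𝓢'(EuclideanSpace ℝ (Fin n), ℂ)) := by
    simp
  refine ⟨⟨besselPotential _ ℂ (-s) (f : 𝓢'(EuclideanSpace ℝ (Fin n), ℂ)), f, h⟩, ?_⟩
  exact lp_eq_of_dist_eq ((besselFun_spec _).symm.trans h)

/-- The map `u ↦ (1 + |ξ|²) ^ (s / 2) 𝓕 u`, as a linear isometry. -/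
def toFreqLI (n : ℕ) (s : ℝ) : Sobolev n s →ₗᵢ[ℝ] FreqSpace n where
  toFun u := Lp.fourierTransformₗᵢ (EuclideanSpace ℝ (Fin n)) ℂ (besselMap u)
  map_add' u v := by simp
  map_smul' c u := by
    rw [← algebraMap_smul ℂ c u, map_smul, map_smul, RingHom.id_apply, algebraMap_smul]
  norm_map' u := (LinearIsometryEquiv.norm_map _ _).trans (norm_def u).symm

/-- The unitary map `u ↦ (1 + |ξ|²) ^ (s / 2) 𝓕 u` from `H^s` to `L²`. -/
def toFreq (n : ℕ) (s : ℝ) : Sobolev n s ≃ₗᵢ[ℝ] FreqSpace n :=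
  LinearIsometryEquiv.ofSurjective (toFreqLI n s)
    ((Lp.fourierTransformₗᵢ (EuclideanSpace ℝ (Fin n)) ℂ).surjective.comp besselMap_surjective)

theorem toFreq_dist (u : Sobolev n s) :
    (toFreq n s u : 𝓢'(EuclideanSpace ℝ (Fin n), ℂ)) = 𝓕 (besselPotential _ ℂ s (toDist u)) :=
  (fourier_besselPotential_toDist u).symm

theorem mul_dist {g : EuclideanSpace ℝ (Fin n) → ℝ} {hg : MemLp (fun ξ => (g ξ : ℂ)) ⊤ volume}
    (hg' : (fun ξ => (g ξ : ℂ)).HasTemperateGrowth) (f : FreqSpace n) :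
    (mul g hg f : 𝓢'(EuclideanSpace ℝ (Fin n), ℂ)) =
      smulLeftCLM ℂ (fun ξ => (g ξ : ℂ)) (f : 𝓢'(EuclideanSpace ℝ (Fin n), ℂ)) :=
  MeasureTheory.Lp.toTemperedDistribution_smul_eq hg' hg f

theorem fourier_besselPotential (a : ℝ) (T : 𝓢'(EuclideanSpace ℝ (Fin n), ℂ)) :
    𝓕 (besselPotential _ ℂ a T) = smulLeftCLM ℂ (fun ξ => (japanese n a ξ : ℂ)) (𝓕 T) :=
  fourier_besselPotential_eq_smulLeftCLM_fourier_apply a T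

theorem fourier_besselPotential_sub {k : ℝ} (hk : -k ≤ 0) (u : Sobolev n s) :
    𝓕 (besselPotential _ ℂ (s - k) (toDist u)) =
      (mul (japanese n (-k)) (memLp_japanese hk) (toFreq n s u) :
        𝓢'(EuclideanSpace ℝ (Fin n), ℂ)) := by
  rw [mul_dist (hasTemperateGrowth_japanese _), toFreq_dist, sub_eq_add_neg,
    ← besselPotential_besselPotential_apply, fourier_besselPotential]

/-- Changing the order from `s` to `s - k` changes the weight by `⟨ξ⟩^{-k}`; this identifies the
Sobolev scale with the powers of one operator. -/
theorem toFreq_lower (k : ℕ) (u : Sobolev n s) :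
    toFreq n (s - k) (lower k u) = (incl n ^ k) (toFreq n s u) := by
  apply lp_eq_of_dist_eq
  rw [toFreq_dist, toDist_lower, incl_pow_apply, fourier_besselPotential_sub (by simp)]

theorem fourier_fourierMultiplierCLM (g : EuclideanSpace ℝ (Fin n) → ℂ)
    (T : 𝓢'(EuclideanSpace ℝ (Fin n), ℂ)) :
    𝓕 (fourierMultiplierCLM ℂ g T) = smulLeftCLM ℂ g (𝓕 T) := by
  rw [fourierMultiplierCLM_apply, fourier_fourierInv_eq]

theorem dist_smul (c : ℝ) (f : FreqSpace n) :
    ((c • f : FreqSpace n) : 𝓢'(EuclideanSpace ℝ (Fin n), ℂ)) =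
      (c : ℂ) • (f : 𝓢'(EuclideanSpace ℝ (Fin n), ℂ)) := by
  rw [← algebraMap_smul ℂ c f, ← Lp.toTemperedDistributionCLM_apply, map_smul,
    Lp.toTemperedDistributionCLM_apply]
  rfl

theorem dist_add (f g : FreqSpace n) :
    ((f + g : FreqSpace n) : 𝓢'(EuclideanSpace ℝ (Fin n), ℂ)) =
      (f : 𝓢'(EuclideanSpace ℝ (Fin n), ℂ)) + (g : 𝓢'(EuclideanSpace ℝ (Fin n), ℂ)) :=
  map_add (Lp.toTemperedDistributionCLM ℂ volume 2) f g

theorem dist_zero :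
    ((0 : FreqSpace n) : 𝓢'(EuclideanSpace ℝ (Fin n), ℂ)) = 0 :=
  map_zero (Lp.toTemperedDistributionCLM ℂ volume 2)

theorem memLp_one_sub : MemLp (fun ξ : EuclideanSpace ℝ (Fin n) =>
    ((1 - japanese n (-2) ξ : ℝ) : ℂ)) ⊤ volume := by
  refine memLp_top_of_bound (Complex.continuous_ofReal.comp
    (continuous_const.sub (continuous_japanese _))).aestronglyMeasurable 1
    (Filter.Eventually.of_forall fun ξ => ?_)
  rw [Complex.norm_real, Real.norm_eq_abs, abs_le]
  have h1 := japanese_pos (-2) ξ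
  have h2 := japanese_le_one (a := -2) (by norm_num) ξ
  constructor <;> linarith

theorem mul_one_sub (f : FreqSpace n) :
    mul (fun ξ => 1 - japanese n (-2) ξ) memLp_one_sub f = f - incl n (incl n f) := by
  have e : incl n (incl n f) = mul (japanese n (-2)) (memLp_japanese (by norm_num)) f :=
    mul_mul_eq (fun ξ => by rw [japanese_mul]; norm_num) f
  rw [e]
  refine Lp.ext ?_
  filter_upwards [fn_mul (hg := memLp_one_sub) f, Lp.coeFn_sub f
    (mul (japanese n (-2)) (memLp_japanese (by norm_num)) f),
    fn_mul (hg := memLp_japanese (n := n) (a := -2) (by norm_num)) f] with ξ h1 h2 h3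
  rw [h1, h2, Pi.sub_apply, h3]
  push_cast
  ring

/-- The symbol is `-(2π)² |ξ|² ⟨ξ⟩⁻² = -(2π)² (1 - ⟨ξ⟩⁻²)`. The Fourier transform puts `2π` into the
exponent while the weight is `1 + |ξ|²`, hence the factor `(2π)²`. -/
theorem fourier_besselPotential_laplacian (u : Sobolev n s) :
    𝓕 (besselPotential _ ℂ (s - 2) (Δ (toDist u))) =
      (-((2 * Real.pi) ^ 2 : ℝ) : ℂ) • (((toFreq n s u - incl n (incl n (toFreq n s u)) :
        FreqSpace n)) : 𝓢'(EuclideanSpace ℝ (Fin n), ℂ)) := by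
  have hg : (fun ξ : EuclideanSpace ℝ (Fin n) =>
      ((1 - japanese n (-2) ξ : ℝ) : ℂ)).HasTemperateGrowth := by
    unfold japanese
    fun_prop
  have e : (fun x : EuclideanSpace ℝ (Fin n) =>
      Complex.ofReal (‖x‖ ^ 2 * (1 + ‖x‖ ^ 2) ^ (-1 : ℝ))) =
      fun ξ => ((1 - japanese n (-2) ξ : ℝ) : ℂ) := by
    ext x
    have h : (1 + ‖x‖ ^ 2) ≠ 0 := by positivity
    rw [japanese, show (-2 / 2 : ℝ) = -1 by norm_num, Real.rpow_neg_one]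
    congr 1
    field_simp
    ring
  rw [sub_eq_neg_add, ← besselPotential_besselPotential_apply, besselPotential_neg_two_laplacian_eq,
    e, fourier_besselPotential, ← mul_one_sub, mul_dist hg, toFreq_dist, fourier_besselPotential]
  rw [← algebraMap_smul ℂ (-(2 * Real.pi) ^ 2 : ℝ), FourierTransform.fourier_smul, map_smul,
    fourier_fourierMultiplierCLM,
    smulLeftCLM_smulLeftCLM_apply hg (hasTemperateGrowth_japanese s),
    smulLeftCLM_smulLeftCLM_apply (hasTemperateGrowth_japanese s) hg,
    mul_comm fun ξ : EuclideanSpace ℝ (Fin n) => (japanese n s ξ : ℂ),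
    Complex.coe_algebraMap, Complex.ofReal_neg]

/-- All three terms are of order `s - 2`. Applying the injective map `𝓕 ⟨D⟩^{s-2}` turns the
identity of distributions into one in `L²`. -/
theorem wave_equation_iff (c : ℝ) (u₀ : Sobolev n s) (u₁ : Sobolev n (s - (1 : ℕ)))
    (u₂ : Sobolev n (s - (2 : ℕ))) :
    toDist u₂ - Δ (toDist u₀) + (c : ℂ) • toDist u₁ = 0 ↔
      toFreq n _ u₂ + (2 * Real.pi) ^ 2 • (toFreq n s u₀ - incl n (incl n (toFreq n s u₀))) +
        c • incl n (toFreq n _ u₁) = 0 := by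
  let F : 𝓢'(EuclideanSpace ℝ (Fin n), ℂ) →L[ℂ] 𝓢'(EuclideanSpace ℝ (Fin n), ℂ) :=
    (fourierCLM ℂ 𝓢'(EuclideanSpace ℝ (Fin n), ℂ)).comp (besselPotential _ ℂ (s - 2))
  have hF : ∀ T, F T = 0 ↔ T = 0 := by
    refine fun T => ⟨fun h => ?_, fun h => by rw [h, map_zero]⟩
    have h1 : besselPotential _ ℂ (s - 2) T = 0 :=
      (fourierEquiv ℂ 𝓢'(EuclideanSpace ℝ (Fin n), ℂ)).map_eq_zero_iff.1 h
    have h2 := congrArg (besselPotential _ ℂ (-(s - 2))) h1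
    rwa [besselPotential_besselPotential_apply, map_zero, add_neg_cancel, besselPotential_zero]
      at h2
  have h2 : F (toDist u₂) =
      (toFreq n _ u₂ : 𝓢'(EuclideanSpace ℝ (Fin n), ℂ)) := by
    rw [toFreq_dist]
    simp only [Nat.cast_ofNat]
    rfl
  have h1 : F (toDist u₁) =
      (incl n (toFreq n _ u₁) : 𝓢'(EuclideanSpace ℝ (Fin n), ℂ)) := by
    rw [incl, ← fourier_besselPotential_sub (k := 1) (by norm_num)]
    have e : s - (1 : ℕ) - 1 = s - 2 := by push_cast; ring
    rw [e]
    rfl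
  have h0 : F (Δ (toDist u₀)) = _ := fourier_besselPotential_laplacian u₀
  rw [← hF, map_add, map_sub, map_smul, h0, h1, h2, neg_smul, sub_neg_eq_add, ← dist_smul,
    ← dist_smul, ← dist_add, ← dist_add]
  exact ⟨fun h => lp_eq_of_dist_eq (h.trans dist_zero.symm), fun h => by rw [h, dist_zero]⟩

theorem isScaleSmooth_toFreq {u : ℝ → Sobolev n s} (hu : IsSmoothCurve u) :
    IsScaleSmooth (incl n) fun t => toFreq n s (u t) := fun k => by
  refine ((toFreq n (s - k)).contDiff.comp_contDiffOn (hu k)).congr fun t _ => ?_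
  exact (toFreq_lower k (u t)).symm

theorem isSmoothCurve_toFreq_symm {X : ℝ → FreqSpace n} (hX : IsScaleSmooth (incl n) X) :
    IsSmoothCurve fun t => (toFreq n s).symm (X t) := fun k => by
  refine ((toFreq n (s - k)).symm.contDiff.comp_contDiffOn (hX k)).congr fun t _ => ?_
  rw [Function.comp_apply, LinearIsometryEquiv.eq_symm_apply, toFreq_lower,
    LinearIsometryEquiv.apply_symm_apply]

theorem toFreq_timeDeriv {u : ℝ → Sobolev n s} (hu : IsSmoothCurve u) (k : ℕ) {t : ℝ}
    (ht : 0 ≤ t) :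
    toFreq n (s - k) (timeDeriv k u t) = scaleDeriv (incl n) k (fun t => toFreq n s (u t)) t := by
  rw [scaleDeriv]
  simp only [← toFreq_lower]
  exact (iteratedDerivWithin_clm_apply
    (toFreq n (s - k)).toContinuousLinearEquiv.toContinuousLinearMap (hu k) ht).symm

theorem norm_timeDeriv {u : ℝ → Sobolev n s} (hu : IsSmoothCurve u) (k : ℕ) {t : ℝ}
    (ht : 0 ≤ t) :
    ‖timeDeriv k u t‖ = ‖scaleDeriv (incl n) k (fun t => toFreq n s (u t)) t‖ := by
  rw [← toFreq_timeDeriv hu k ht, LinearIsometryEquiv.norm_map]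

end Sobolev

/-! ### Regularisation of locally integrable functions -/

/-- The convolution of two functions on the line. -/
def convol (h g : ℝ → ℝ) (t : ℝ) : ℝ := ∫ τ, h τ * g (t - τ)

theorem hasDerivAt_convol {h g : ℝ → ℝ} (hh : LocallyIntegrable h) (hg : HasCompactSupport g)
    (hg' : ContDiff ℝ 1 g) (t : ℝ) : HasDerivAt (convol h g) (convol h (deriv g) t) t :=
  hg.hasDerivAt_convolution_right (ContinuousLinearMap.mul ℝ ℝ) hh hg' t

theorem contDiff_convol {h g : ℝ → ℝ} (hh : LocallyIntegrable h) (hg : HasCompactSupport g)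
    (hg' : ContDiff ℝ ∞ g) : ContDiff ℝ ∞ (convol h g) :=
  hg.contDiff_convolution_right (ContinuousLinearMap.mul ℝ ℝ) hh hg'

theorem HasCompactSupport.iteratedDeriv_real {g : ℝ → ℝ} (hg : HasCompactSupport g) (k : ℕ) :
    HasCompactSupport (iteratedDeriv k g) := by
  induction k with
  | zero => simpa using hg
  | succ k ih => rw [iteratedDeriv_succ]; exact ih.deriv

theorem contDiff_iteratedDeriv {g : ℝ → ℝ} (hg : ContDiff ℝ ∞ g) (k : ℕ) :
    ContDiff ℝ ∞ (iteratedDeriv k g) := by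
  induction k with
  | zero => simpa using hg
  | succ k ih => rw [iteratedDeriv_succ]; exact (contDiff_infty_iff_deriv.1 ih).2

theorem iteratedDeriv_convol {h g : ℝ → ℝ} (hh : LocallyIntegrable h) (hg : HasCompactSupport g)
    (hg' : ContDiff ℝ ∞ g) (k : ℕ) :
    iteratedDeriv k (convol h g) = convol h (iteratedDeriv k g) := by
  induction k with
  | zero => simp
  | succ k ih =>
    ext t
    rw [iteratedDeriv_succ, ih, iteratedDeriv_succ]
    exact (hasDerivAt_convol hh (hg.iteratedDeriv_real k)
      ((contDiff_iteratedDeriv hg' k).of_le (by norm_num)) t).deriv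

theorem iteratedDerivWithin_convol {h g : ℝ → ℝ} (hh : LocallyIntegrable h)
    (hg : HasCompactSupport g) (hg' : ContDiff ℝ ∞ g) (k : ℕ) {t : ℝ} (ht : 0 ≤ t) :
    iteratedDerivWithin k (convol h g) (Ici 0) t = convol h (iteratedDeriv k g) t := by
  rw [← iteratedDeriv_convol hh hg hg']
  exact iteratedDerivWithin_eq_iteratedDeriv (uniqueDiffOn_Ici 0)
    ((contDiff_convol hh hg hg').of_le (by exact_mod_cast le_top)).contDiffAt ht

theorem locallyIntegrable_indicator {f : ℝ → ℝ} (hf : LocallyIntegrableOn f (Ici 0)) :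
    LocallyIntegrable ((Ici 0).indicator f) := by
  rw [locallyIntegrable_iff]
  intro K hK
  rw [integrableOn_indicator_iff measurableSet_Ici]
  exact hf.integrableOn_compact_subset inter_subset_left (hK.inter_left isClosed_Ici)

namespace Mollifier

variable (ψ : Mollifier)

/-- The rescaled mollifier. -/
def scale (ε : ℝ) (x : ℝ) : ℝ := ε⁻¹ * ψ.toFun (ε⁻¹ * x)

theorem contDiff_scale (ε : ℝ) : ContDiff ℝ ∞ (ψ.scale ε) :=
  contDiff_const.mul (ψ.smooth.comp (contDiff_const.mul contDiff_id))

theorem iteratedDeriv_scale (ε : ℝ) (k : ℕ) (x : ℝ) :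
    iteratedDeriv k (ψ.scale ε) x = ε⁻¹ ^ (k + 1) * iteratedDeriv k ψ.toFun (ε⁻¹ * x) := by
  have h : ContDiff ℝ k ψ.toFun := ψ.smooth.of_le (by exact_mod_cast le_top)
  unfold scale
  rw [iteratedDeriv_const_mul_field, iteratedDeriv_comp_const_mul h]
  ring

theorem exists_radius : ∃ R : ℝ, 0 < R ∧ ∀ k x, iteratedDeriv k ψ.toFun x ≠ 0 →
    x ∈ Icc (-R) 0 := by
  obtain ⟨R, hR⟩ := ψ.compactSupport.isCompact.isBounded.subset_closedBall 0
  refine ⟨max R 1, by positivity, fun k x hx => ?_⟩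
  have h1 : x ∈ tsupport ψ.toFun := by
    refine support_iteratedFDeriv_subset (𝕜 := ℝ) k (?_ : iteratedFDeriv ℝ k ψ.toFun x ≠ 0)
    intro h
    exact hx (by rw [iteratedDeriv_eq_iteratedFDeriv, h]; rfl)
  have h2 : x < 0 := ψ.tsupport_subset h1
  have h3 := hR h1
  rw [mem_closedBall_zero_iff, Real.norm_eq_abs, abs_le] at h3
  exact ⟨by have := le_max_left R 1; linarith [h3.1], h2.le⟩

theorem hasCompactSupport_scale {ε : ℝ} (hε : ε ≠ 0) : HasCompactSupport (ψ.scale ε) :=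
  (ψ.compactSupport.comp_homeomorph (Homeomorph.mulLeft₀ ε⁻¹ (inv_ne_zero hε))).mul_left

theorem integral_scale {ε : ℝ} (hε : 0 < ε) : ∫ x, ψ.scale ε x = 1 := by
  unfold scale
  rw [integral_const_mul, Measure.integral_comp_mul_left, ψ.integral_eq_one, inv_inv,
    abs_of_pos hε, smul_eq_mul, mul_one, inv_mul_cancel₀ hε.ne']

theorem scale_nonneg {ε : ℝ} (hε : 0 < ε) (x : ℝ) : 0 ≤ ψ.scale ε x :=
  mul_nonneg (inv_nonneg.2 hε.le) (ψ.nonneg _)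

theorem exists_radius_scale : ∃ R : ℝ, 0 < R ∧ ∀ (ε : ℝ), 0 < ε → ∀ k x,
    iteratedDeriv k (ψ.scale ε) x ≠ 0 → x ∈ Icc (-(R * ε)) 0 := by
  obtain ⟨R, hR, h⟩ := ψ.exists_radius
  refine ⟨R, hR, fun ε hε k x hx => ?_⟩
  rw [iteratedDeriv_scale] at hx
  have h1 := h k _ (right_ne_zero_of_mul hx)
  rw [inv_mul_eq_div, mem_Icc, le_div_iff₀ hε, div_le_iff₀ hε, zero_mul] at h1
  exact ⟨by linarith [h1.1], h1.2⟩

/-- As the mollifier lives on the negative axis, the convolution at `t` sees only the window `[t, t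
+ R ε]`, and each derivative of the kernel costs a factor `ε⁻¹`. -/
theorem exists_abs_convol_le : ∃ R : ℝ, 0 < R ∧ ∀ k : ℕ, ∃ S : ℝ, 0 ≤ S ∧
    ∀ h : ℝ → ℝ, LocallyIntegrable h → ∀ (ε t : ℝ), 0 < ε →
      |convol h (iteratedDeriv k (ψ.scale ε)) t| ≤
        S * ε⁻¹ ^ (k + 1) * ∫ τ in Icc t (t + R * ε), |h τ| := by
  obtain ⟨R, hR, hR'⟩ := ψ.exists_radius_scale
  refine ⟨R, hR, fun k => ?_⟩
  obtain ⟨S, hS⟩ := (ψ.compactSupport.iteratedDeriv_real k).exists_bound_of_continuous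
    (contDiff_iteratedDeriv ψ.smooth k).continuous
  have hS0 : 0 ≤ S := (norm_nonneg _).trans (hS 0)
  refine ⟨S, hS0, fun h hh ε t hε => ?_⟩
  have e : convol h (iteratedDeriv k (ψ.scale ε)) t =
      ∫ τ in Icc t (t + R * ε), h τ * iteratedDeriv k (ψ.scale ε) (t - τ) := by
    rw [convol, setIntegral_eq_integral_of_forall_compl_eq_zero]
    intro τ hτ
    by_contra hne
    have h1 := hR' ε hε k _ (right_ne_zero_of_mul hne)
    exact hτ ⟨by linarith [h1.2], by linarith [h1.1]⟩
  rw [e, ← integral_const_mul, ← Real.norm_eq_abs]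
  refine norm_integral_le_of_norm_le ?_ (Filter.Eventually.of_forall fun τ => ?_)
  · exact ((hh.integrableOn_isCompact isCompact_Icc).abs).const_mul _
  · rw [norm_mul, Real.norm_eq_abs, iteratedDeriv_scale, norm_mul, norm_pow, norm_inv,
      Real.norm_of_nonneg hε.le, mul_comm, mul_comm S]
    gcongr
    exact hS _

end Mollifier

/-! ### Regularisation of distributions -/

theorem exists_subset_Icc {K : Set ℝ} (hK : IsCompact K) (hK0 : K ⊆ Ici 0) :
    ∃ T, K ⊆ Icc 0 T := by
  obtain ⟨T, hT⟩ := hK.bddAbove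
  exact ⟨T, fun t ht => ⟨hK0 ht, hT ht⟩⟩

theorem IsModerate.of_netBound {f : Eps → ℝ → ℝ} (N : ℕ)
    (hf : ∀ ε, ContDiffOn ℝ ∞ (f ε) (Ici 0))
    (h : ∀ (T : ℝ) (k : ℕ), NetBound (Icc 0 T) (-N - k) fun ε t =>
      iteratedDerivWithin k (f ε) (Ici 0) t) : IsModerate f := by
  refine ⟨hf, fun K hK hK0 k => ?_⟩
  obtain ⟨T, hT⟩ := exists_subset_Icc hK hK0
  obtain ⟨c, hc⟩ := h T k
  refine ⟨N, c, fun ε t ht => (hc ε t (hT ht)).trans_eq ?_⟩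
  rw [show (-N - k : ℤ) = -((N + k : ℕ) : ℤ) by push_cast; ring, zpow_neg, zpow_natCast,
    div_eq_mul_inv]

namespace Mollifier

variable (ψ : Mollifier)

/-- The regularisation of a distribution on the half line by convolution. -/
def net (T : 𝓓'(halfLine, ℝ)) (ε : Eps) (t : ℝ) : ℝ :=
  T (ψ.kernel ε (max t 0) (le_max_right t 0))

theorem net_of_nonneg (T : 𝓓'(halfLine, ℝ)) (ε : Eps) {t : ℝ} (ht : 0 ≤ t) :
    ψ.net T ε t = T (ψ.kernel ε t ht) := by
  unfold net
  congr 2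
  exact max_eq_left ht

theorem kernel_apply (ε : Eps) {t : ℝ} (ht : 0 ≤ t) (τ : ℝ) :
    ψ.kernel ε t ht τ = ψ.scale ε (t - τ) := by
  show (ε : ℝ)⁻¹ * ψ.toFun ((t - τ) / ε) = _
  rw [scale, div_eq_inv_mul]

theorem lineDeriv_apply (φ : 𝓓(halfLine, ℝ)) (x : ℝ) :
    (∂_{(1 : ℝ)} φ : 𝓓(halfLine, ℝ)) x = deriv φ x := by
  have h : DifferentiableAt ℝ φ x := (φ.contDiff.differentiable (by simp)).differentiableAt
  refine (TestFunction.lineDerivCLM_apply_of_le (𝕜 := ℝ) (by simp)).trans ?_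
  rw [h.lineDeriv_eq_fderiv, fderiv_apply_one_eq_deriv]

theorem lineDeriv_kernel_apply (ε : Eps) {t : ℝ} (ht : 0 ≤ t) (τ : ℝ) :
    (∂_{(1 : ℝ)} (ψ.kernel ε t ht) : 𝓓(halfLine, ℝ)) τ = -deriv (ψ.scale ε) (t - τ) := by
  rw [lineDeriv_apply, ← deriv_comp_const_sub]
  congr 1
  ext τ
  exact ψ.kernel_apply ε ht τ

theorem distDeriv_apply (T : 𝓓'(halfLine, ℝ)) (φ : 𝓓(halfLine, ℝ)) :
    distDeriv T φ = -T (∂_{(1 : ℝ)} φ) := by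
  rw [distDeriv, Distribution.lineDerivOp_apply_apply, map_neg]

variable {f g : ℝ → ℝ}

theorem distOf_apply_indicator (hf : LocallyIntegrableOn f (Ici 0)) (φ : 𝓓(halfLine, ℝ)) :
    distOf f φ = ∫ x, (Ici 0).indicator f x * φ x := by
  rw [distOf_apply hf]
  congr 1
  ext x
  by_cases hx : x ∈ Ici (0 : ℝ)
  · rw [indicator_of_mem hx, mul_comm]
  · have : φ x = 0 := by
      by_contra h
      exact hx (Ioi_subset_Ici_self (φ.tsupport_subset (subset_tsupport _ h)))
    rw [this, zero_mul, mul_zero]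

theorem net_distOf (hf : LocallyIntegrableOn f (Ici 0)) (ε : Eps) {t : ℝ} (ht : 0 ≤ t) :
    ψ.net (distOf f) ε t = convol ((Ici 0).indicator f) (ψ.scale ε) t := by
  rw [net_of_nonneg _ _ _ ht, distOf_apply_indicator hf]
  simp only [kernel_apply]
  rfl

theorem net_distDeriv (hf : LocallyIntegrableOn f (Ici 0)) (ε : Eps) {t : ℝ} (ht : 0 ≤ t) :
    ψ.net (distDeriv (distOf f)) ε t =
      convol ((Ici 0).indicator f) (iteratedDeriv 1 (ψ.scale ε)) t := by
  rw [net_of_nonneg _ _ _ ht, distDeriv_apply, distOf_apply_indicator hf]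
  simp only [lineDeriv_kernel_apply, iteratedDeriv_one, convol, mul_neg, integral_neg, neg_neg]

theorem net_add (T S : 𝓓'(halfLine, ℝ)) : ψ.net (T + S) = ψ.net T + ψ.net S := rfl

theorem contDiffOn_net_distOf (hf : LocallyIntegrableOn f (Ici 0)) (ε : Eps) :
    ContDiffOn ℝ ∞ (ψ.net (distOf f) ε) (Ici 0) :=
  (contDiff_convol (locallyIntegrable_indicator hf) (ψ.hasCompactSupport_scale ε.pos.ne')
    (ψ.contDiff_scale ε)).contDiffOn.congr fun _ ht => ψ.net_distOf hf ε ht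

theorem contDiffOn_net_distDeriv (hf : LocallyIntegrableOn f (Ici 0)) (ε : Eps) :
    ContDiffOn ℝ ∞ (ψ.net (distDeriv (distOf f)) ε) (Ici 0) :=
  (contDiff_convol (locallyIntegrable_indicator hf)
    ((ψ.hasCompactSupport_scale ε.pos.ne').iteratedDeriv_real 1)
    (contDiff_iteratedDeriv (ψ.contDiff_scale ε) 1)).contDiffOn.congr
      fun _ ht => ψ.net_distDeriv hf ε ht

theorem iteratedDerivWithin_net_distOf (hf : LocallyIntegrableOn f (Ici 0)) (ε : Eps) (k : ℕ)
    {t : ℝ} (ht : 0 ≤ t) :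
    iteratedDerivWithin k (ψ.net (distOf f) ε) (Ici 0) t =
      convol ((Ici 0).indicator f) (iteratedDeriv k (ψ.scale ε)) t := by
  rw [← iteratedDerivWithin_convol (locallyIntegrable_indicator hf)
    (ψ.hasCompactSupport_scale ε.pos.ne') (ψ.contDiff_scale ε) k ht]
  exact iteratedDerivWithin_congr (fun τ hτ => ψ.net_distOf hf ε hτ) ht

theorem iteratedDerivWithin_net_distDeriv (hf : LocallyIntegrableOn f (Ici 0)) (ε : Eps) (k : ℕ)
    {t : ℝ} (ht : 0 ≤ t) :
    iteratedDerivWithin k (ψ.net (distDeriv (distOf f)) ε) (Ici 0) t =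
      convol ((Ici 0).indicator f) (iteratedDeriv (k + 1) (ψ.scale ε)) t := by
  have e : iteratedDeriv (k + 1) (ψ.scale ε) = iteratedDeriv k (iteratedDeriv 1 (ψ.scale ε)) := by
    rw [iteratedDeriv_succ', iteratedDeriv_one]
  rw [e, ← iteratedDerivWithin_convol (locallyIntegrable_indicator hf)
    ((ψ.hasCompactSupport_scale ε.pos.ne').iteratedDeriv_real 1)
    (contDiff_iteratedDeriv (ψ.contDiff_scale ε) 1) k ht]
  exact iteratedDerivWithin_congr (fun τ hτ => ψ.net_distDeriv hf ε hτ) ht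

/-- For `t ≤ T` and `ε ≤ 1` all windows lie in `[0, T + R]`, so local integrability suffices. -/
theorem netBound_convol {h : ℝ → ℝ} (hh : LocallyIntegrable h) (T : ℝ) (k : ℕ) :
    NetBound (Icc 0 T) (-1 - k) fun ε t => convol h (iteratedDeriv k (ψ.scale ε)) t := by
  obtain ⟨R, hR, hb⟩ := ψ.exists_abs_convol_le
  obtain ⟨S, hS, hb⟩ := hb k
  refine ⟨S * ∫ τ in Icc 0 (T + R), |h τ|, fun ε t ht => ?_⟩
  rw [Real.norm_eq_abs]
  refine (hb h hh ε t ε.pos).trans ?_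
  have e : (ε : ℝ) ^ (-1 - k : ℤ) = (ε : ℝ)⁻¹ ^ (k + 1) := by
    rw [show (-1 - k : ℤ) = -((k + 1 : ℕ) : ℤ) by push_cast; ring, zpow_neg, zpow_natCast, inv_pow]
  rw [e, mul_right_comm]
  have hε := ε.pos
  gcongr
  · exact Filter.Eventually.of_forall fun τ => abs_nonneg _
  · exact (hh.integrableOn_isCompact isCompact_Icc).abs
  · exact ht.1
  · exact ht.2
  · exact mul_le_of_le_one_right hR.le ε.le_one

/-- The window has length `R ε`, so local boundedness gains one power of `ε` over mere
integrability. This yields the exact powers needed for the coefficient. -/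
theorem netBound_convol_of_bounded {h : ℝ → ℝ} (hh : LocallyIntegrable h)
    (hbd : ∀ T, ∃ B, ∀ t ∈ Icc 0 T, |h t| ≤ B) (T : ℝ) (k : ℕ) :
    NetBound (Icc 0 T) (-k) fun ε t => convol h (iteratedDeriv k (ψ.scale ε)) t := by
  obtain ⟨R, hR, hb⟩ := ψ.exists_abs_convol_le
  obtain ⟨S, hS, hb⟩ := hb k
  obtain ⟨B, hB⟩ := hbd (T + R)
  refine ⟨S * (B * R), fun ε t ht => ?_⟩
  rw [Real.norm_eq_abs]
  have hε := ε.pos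
  refine (hb h hh ε t ε.pos).trans ?_
  have h1 : ∫ τ in Icc t (t + R * ε), |h τ| ≤ B * (R * ε) := by
    have h2 := norm_setIntegral_le_of_norm_le_const (μ := volume) (f := fun τ => |h τ|)
      (s := Icc t (t + R * (ε : ℝ))) (C := B) (by simp) fun τ hτ => by
        rw [Real.norm_eq_abs, abs_abs]
        exact hB τ ⟨ht.1.trans hτ.1, by nlinarith [hτ.2, ht.2, ε.le_one]⟩
    rw [Real.volume_real_Icc_of_le (by nlinarith), add_sub_cancel_left] at h2
    exact (le_abs_self _).trans h2
  refine (mul_le_mul_of_nonneg_left h1 (by positivity)).trans_eq ?_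
  rw [zpow_neg, zpow_natCast, ← inv_pow, pow_succ]
  field_simp

theorem isModerate_net {T : 𝓓'(halfLine, ℝ)} (hT : T ∈ firstOrderDist) :
    IsModerate (ψ.net T) := by
  obtain ⟨f, g, hf, hg, rfl⟩ := hT
  rw [net_add]
  -- The derivative in `g'` falls on the kernel and costs one further power of `ε`: hence the orders
  -- `1` and `2`.
  refine IsModerate.add ?_ ?_
  · refine .of_netBound 1 (ψ.contDiffOn_net_distOf hf) fun T k => ?_
    refine (ψ.netBound_convol (locallyIntegrable_indicator hf) T k).congr fun ε t ht => ?_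
    exact ψ.iteratedDerivWithin_net_distOf hf ε k ht.1
  · refine .of_netBound 2 (ψ.contDiffOn_net_distDeriv hg) fun T k => ?_
    refine ((ψ.netBound_convol (locallyIntegrable_indicator hg) T (k + 1)).congr fun ε t ht =>
      ψ.iteratedDerivWithin_net_distDeriv hg ε k ht.1).mono ?_
    push_cast
    omega

/-- The embedding of distributions on the half line into the Colombeau algebra. -/
def embedding : firstOrderDist →ₗ[ℝ] ColombeauAlgebra where
  toFun T := Ideal.Quotient.mk negligibleNets ⟨ψ.net T, ψ.isModerate_net T.2⟩
  map_add' _ _ := rfl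
  map_smul' _ _ := rfl

theorem isRegularisation_embedding : IsRegularisation ψ ψ.embedding :=
  fun T => ⟨⟨ψ.net T, ψ.isModerate_net T.2⟩, rfl, fun ε _ ht => ψ.net_of_nonneg T ε ht⟩

end Mollifier

/-! ### Injectivity of the embedding -/

/-- By Fubini the averaging is moved from `h` to `χ`. Averaging a function with Lipschitz constant
`L` against a probability density supported in `[-δ, δ]` changes it by at most `L δ`. -/
theorem abs_integral_mul_convol_sub_le {h χ ρ : ℝ → ℝ} {L δ : ℝ} (hh : Integrable h)
    (hχ : Continuous χ) (hχc : HasCompactSupport χ) (hL : ∀ x y, |χ x - χ y| ≤ L * |x - y|)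
    (hL0 : 0 ≤ L) (hρ : Continuous ρ) (hρc : HasCompactSupport ρ) (hρ0 : ∀ x, 0 ≤ ρ x)
    (hρ1 : ∫ x, ρ x = 1) (hρδ : ∀ x, ρ x ≠ 0 → |x| ≤ δ) :
    |(∫ t, χ t * convol h ρ t) - ∫ t, χ t * h t| ≤ L * δ * ∫ t, |h t| := by
  have hρi : Integrable ρ := hρ.integrable_of_hasCompactSupport hρc
  obtain ⟨B, hB⟩ := hχc.exists_bound_of_continuous hχ
  have hF : Integrable (Function.uncurry fun t τ => χ t * (h τ * ρ (t - τ)))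
      (volume.prod volume) :=
    (hh.convolution_integrand (ContinuousLinearMap.mul ℝ ℝ) hρi).bdd_mul (c := B)
      (f := fun p : ℝ × ℝ => χ p.1) (hχ.comp continuous_fst).aestronglyMeasurable
      (Filter.Eventually.of_forall fun p => hB p.1)
  have hsh : ∀ τ, ∫ t, ρ (t - τ) = 1 := fun τ => by rw [integral_sub_right_eq_self, hρ1]
  have hA : ∀ τ, |(∫ t, χ t * ρ (t - τ)) - χ τ| ≤ L * δ := by
    intro τ
    have hi : Integrable fun t => ρ (t - τ) := hρi.comp_sub_right τ
    have hi' : Integrable fun t => χ t * ρ (t - τ) :=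
      hi.bdd_mul hχ.aestronglyMeasurable (Filter.Eventually.of_forall hB)
    have e : (∫ t, χ t * ρ (t - τ)) - χ τ = ∫ t, (χ t - χ τ) * ρ (t - τ) := by
      simp only [sub_mul]
      rw [integral_sub hi' (hi.const_mul _), integral_const_mul, hsh, mul_one]
    rw [e, ← Real.norm_eq_abs, ← mul_one (L * δ), ← hsh τ, ← integral_const_mul]
    refine norm_integral_le_of_norm_le (hi.const_mul _) (Filter.Eventually.of_forall fun t => ?_)
    rw [norm_mul, Real.norm_of_nonneg (hρ0 _)]
    by_cases h0 : ρ (t - τ) = 0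
    · rw [h0, mul_zero, mul_zero]
    · exact mul_le_mul_of_nonneg_right ((hL t τ).trans
        (mul_le_mul_of_nonneg_left (hρδ _ h0) hL0)) (hρ0 _)
  have e : (∫ t, χ t * convol h ρ t) = ∫ τ, h τ * ∫ t, χ t * ρ (t - τ) := by
    simp only [convol, ← integral_const_mul]
    rw [integral_integral_swap hF]
    congr 1
    ext τ
    congr 1
    ext t
    ring
  have hi1 : Integrable fun τ => h τ * ∫ t, χ t * ρ (t - τ) := by
    refine hF.integral_prod_right.congr (Filter.Eventually.of_forall fun τ => ?_)
    simp only [Function.uncurry, ← integral_const_mul]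
    congr 1
    ext t
    ring
  have hi2 : Integrable fun t => χ t * h t :=
    hh.bdd_mul hχ.aestronglyMeasurable (Filter.Eventually.of_forall hB)
  rw [e, ← integral_sub hi1 hi2, ← Real.norm_eq_abs, ← integral_const_mul]
  refine norm_integral_le_of_norm_le (hh.abs.const_mul _) (Filter.Eventually.of_forall fun τ => ?_)
  rw [mul_comm (χ τ), ← mul_sub, norm_mul, mul_comm]
  exact mul_le_mul_of_nonneg_right (hA τ) (norm_nonneg _)

theorem Mollifier.exists_abs_integral_mul_convol_sub_le (ψ : Mollifier) {h χ : ℝ → ℝ}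
    (hh : LocallyIntegrable h) (hχ : ContDiff ℝ ∞ χ) (hχc : HasCompactSupport χ) :
    ∃ C : ℝ, ∀ ε : Eps,
      |(∫ t, χ t * convol h (ψ.scale ε) t) - ∫ t, χ t * h t| ≤ C * ε := by
  obtain ⟨R, hR, hR'⟩ := ψ.exists_radius_scale
  obtain ⟨L, hL⟩ := hχ.lipschitzWith_of_hasCompactSupport hχc (by simp)
  obtain ⟨A, hA⟩ := hχc.isCompact.isBounded.subset_closedBall 0
  -- For `ε ≤ 1` and `t` in the support of `χ`, the convolution uses `h` only within distance `R` of
  -- `t`; cutting `h` off outside `K` therefore changes nothing and makes it integrable.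
  set K : Set ℝ := Metric.closedBall 0 (A + R) with hK
  have hKm : MeasurableSet K := measurableSet_closedBall
  have h1i : Integrable (K.indicator h) :=
    (integrable_indicator_iff hKm).2 (hh.integrableOn_isCompact (isCompact_closedBall 0 _))
  refine ⟨L * R * ∫ t, |K.indicator h t|, fun ε => ?_⟩
  have hsupp : ∀ x, ψ.scale ε x ≠ 0 → |x| ≤ R * ε := fun x hx => by
    have h2 := hR' ε ε.pos 0 x (by simpa using hx)
    rw [abs_le]
    exact ⟨h2.1, h2.2.trans (mul_pos hR ε.pos).le⟩
  have hχ0 : ∀ t, χ t ≠ 0 → |t| ≤ A := fun t ht => by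
    simpa using hA (subset_tsupport _ ht)
  have e1 : ∀ t, χ t * convol h (ψ.scale ε) t = χ t * convol (K.indicator h) (ψ.scale ε) t := by
    intro t
    by_cases h0 : χ t = 0
    · rw [h0, zero_mul, zero_mul]
    congr 1
    refine integral_congr_ae (Filter.Eventually.of_forall fun τ => ?_)
    by_cases h1 : ψ.scale ε (t - τ) = 0
    · simp only [h1, mul_zero]
    · have h2 := hsupp _ h1
      have h3 := hχ0 t h0
      have h4 : τ ∈ K := by
        rw [hK, mem_closedBall_zero_iff, Real.norm_eq_abs]
        have h5 : |τ| ≤ |t| + |t - τ| := by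
          calc |τ| = |t - (t - τ)| := by ring_nf
            _ ≤ _ := abs_sub _ _
        nlinarith [ε.le_one]
      simp only [indicator_of_mem h4]
  have e2 : ∀ t, χ t * h t = χ t * K.indicator h t := by
    intro t
    by_cases h0 : χ t = 0
    · rw [h0, zero_mul, zero_mul]
    · have h4 : t ∈ K := by
        rw [hK, mem_closedBall_zero_iff, Real.norm_eq_abs]
        linarith [hχ0 t h0]
      rw [indicator_of_mem h4]
  simp only [e1, e2]
  refine (abs_integral_mul_convol_sub_le h1i hχ.continuous hχc (L := L) (δ := R * ε)
    (fun x y => by simpa [Real.dist_eq] using hL.dist_le_mul x y) L.2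
    (ψ.contDiff_scale ε).continuous (ψ.hasCompactSupport_scale ε.pos.ne')
    (ψ.scale_nonneg ε.pos) (ψ.integral_scale ε.pos) hsupp).trans_eq ?_
  ring

theorem integral_mul_convol_deriv {h g χ : ℝ → ℝ} (hh : LocallyIntegrable h)
    (hg : HasCompactSupport g) (hg' : ContDiff ℝ ∞ g) (hχ : ContDiff ℝ ∞ χ)
    (hχc : HasCompactSupport χ) :
    ∫ t, χ t * convol h (deriv g) t = -∫ t, deriv χ t * convol h g t := by
  have hc : Continuous (convol h g) := (contDiff_convol hh hg hg').continuous
  have hg1 : ContDiff ℝ ∞ (deriv g) := (contDiff_infty_iff_deriv.1 hg').2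
  have hc' : Continuous (convol h (deriv g)) := (contDiff_convol hh hg.deriv hg1).continuous
  refine integral_mul_deriv_eq_deriv_mul_of_integrable
    (fun x _ => (hχ.differentiable (by simp) x).hasDerivAt)
    (fun x _ => hasDerivAt_convol hh hg (hg'.of_le (by norm_num)) x) ?_ ?_ ?_
  · exact (hχ.continuous.mul hc').integrable_of_hasCompactSupport hχc.mul_right
  · exact ((hχ.continuous_deriv (by norm_num)).mul hc).integrable_of_hasCompactSupport
      hχc.deriv.mul_right
  · exact (hχ.continuous.mul hc).integrable_of_hasCompactSupport hχc.mul_right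

namespace Mollifier

/-- The pairing of `φ` with the net is `O(ε)` by negligibility and differs from `T φ` by `O(ε)`, so
`T φ = 0`. The part `g'` is treated by moving the derivative onto `φ`. -/
theorem apply_eq_zero_of_isNegligible (ψ : Mollifier) {T : 𝓓'(halfLine, ℝ)}
    (hT : T ∈ firstOrderDist) (hn : IsNegligible (ψ.net T)) (φ : 𝓓(halfLine, ℝ)) : T φ = 0 := by
  obtain ⟨f, g, hf, hg, rfl⟩ := hT
  have hφ : ContDiff ℝ ∞ φ := φ.contDiff
  have hφc : HasCompactSupport φ := φ.hasCompactSupport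
  have hφs : tsupport φ ⊆ Ici 0 := φ.tsupport_subset.trans Ioi_subset_Ici_self
  have hf' := locallyIntegrable_indicator hf
  have hg' := locallyIntegrable_indicator hg
  obtain ⟨C₁, h1⟩ := ψ.exists_abs_integral_mul_convol_sub_le hf' hφ hφc
  obtain ⟨C₂, h2⟩ := ψ.exists_abs_integral_mul_convol_sub_le hg'
    (contDiff_infty_iff_deriv.1 hφ).2 hφc.deriv
  -- Negligibility is needed only to first order in `ε`, without derivatives, and on the support of
  -- `φ`.
  obtain ⟨c, hc⟩ := hn _ hφc hφs 0 1
  have hval : (distOf f + distDeriv (distOf g)) φ =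
      (∫ t, φ t * (Ici 0).indicator f t) - ∫ t, deriv φ t * (Ici 0).indicator g t := by
    change distOf f φ + distDeriv (distOf g) φ = _
    rw [distDeriv_apply, distOf_apply_indicator hf, distOf_apply_indicator hg, sub_eq_add_neg]
    simp only [lineDeriv_apply, mul_comm]
  have hbound : ∀ ε : Eps, |(distOf f + distDeriv (distOf g)) φ| ≤
      (C₁ + C₂ + c * ∫ t, |φ t|) * ε := by
    intro ε
    have hs := ψ.hasCompactSupport_scale ε.pos.ne'
    have hd := ψ.contDiff_scale ε
    have i1 : Integrable fun t => φ t * convol ((Ici 0).indicator f) (ψ.scale ε) t :=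
      (hφ.continuous.mul (contDiff_convol hf' hs hd).continuous).integrable_of_hasCompactSupport
        hφc.mul_right
    have i2 : Integrable fun t => φ t * convol ((Ici 0).indicator g) (deriv (ψ.scale ε)) t :=
      (hφ.continuous.mul (contDiff_convol hg' hs.deriv
        (contDiff_infty_iff_deriv.1 hd).2).continuous).integrable_of_hasCompactSupport
        hφc.mul_right
    have h3 : |∫ t, φ t * (convol ((Ici 0).indicator f) (ψ.scale ε) t +
        convol ((Ici 0).indicator g) (deriv (ψ.scale ε)) t)| ≤ (c * ∫ t, |φ t|) * ε := by
      rw [mul_right_comm, ← integral_const_mul, ← Real.norm_eq_abs]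
      refine norm_integral_le_of_norm_le
        ((hφ.continuous.integrable_of_hasCompactSupport hφc).abs.const_mul _)
        (Filter.Eventually.of_forall fun t => ?_)
      by_cases h0 : φ t = 0
      · simp [h0]
      · have ht : t ∈ tsupport φ := subset_tsupport _ h0
        have h4 := hc ε t ht
        rw [iteratedDerivWithin_zero, net_add, pow_one] at h4
        have e1 := ψ.net_distOf hf ε (hφs ht)
        have e2 := ψ.net_distDeriv hg ε (hφs ht)
        rw [iteratedDeriv_one] at e2
        rw [norm_mul, ← e1, ← e2, mul_comm]
        exact mul_le_mul_of_nonneg_right h4 (norm_nonneg _)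
    simp only [mul_add] at h3
    rw [integral_add i1 i2, integral_mul_convol_deriv hg' hs hd hφ hφc] at h3
    rw [hval]
    have h1' := h1 ε
    have h2' := h2 ε
    rw [abs_le] at *
    constructor <;> linarith [h1'.1, h1'.2, h2'.1, h2'.2, h3.1, h3.2]
  by_contra hne
  have hpos : 0 < |(distOf f + distDeriv (distOf g)) φ| := abs_pos.2 hne
  set a := |(distOf f + distDeriv (distOf g)) φ|
  set C := C₁ + C₂ + c * ∫ t, |φ t|
  have hC : 0 < C := by
    have := hbound ⟨1, by norm_num, le_rfl⟩
    simp only [mul_one] at this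
    linarith
  -- At this `ε` the bound `a ≤ C ε` would give `a ≤ a / 2`.
  have hx : 0 < min 1 (a / (2 * C)) := lt_min one_pos (by positivity)
  have h5 := hbound ⟨min 1 (a / (2 * C)), hx, min_le_left _ _⟩
  have h6 : C * min 1 (a / (2 * C)) ≤ C * (a / (2 * C)) :=
    mul_le_mul_of_nonneg_left (min_le_right _ _) hC.le
  have h7 : C * (a / (2 * C)) = a / 2 := by field_simp
  simp only at h5
  linarith

theorem embedding_injective (ψ : Mollifier) : Function.Injective ψ.embedding := by
  rw [injective_iff_map_eq_zero]
  intro T hT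
  have hn : IsNegligible (ψ.net T) := Ideal.Quotient.eq_zero_iff_mem.1 hT
  refine Subtype.ext (DFunLike.ext _ _ fun φ => ?_)
  exact ψ.apply_eq_zero_of_isNegligible T.2 hn φ

/-- A mollifier exists. -/
theorem nonempty : Nonempty Mollifier := by
  -- The support is the interval `[-3, -1]`, away from `0`.
  let f : ContDiffBump (-2 : ℝ) := ⟨1 / 2, 1, by norm_num, by norm_num⟩
  refine ⟨⟨f.normed volume, f.contDiff_normed, f.hasCompactSupport_normed, f.nonneg_normed,
    f.integral_normed, ?_⟩⟩
  rw [f.tsupport_normed_eq]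
  intro x hx
  rw [Real.closedBall_eq_Icc] at hx
  show x < 0
  have := hx.2
  norm_num at this
  linarith

end Mollifier

/-! ### Regularisation of the coefficient -/

namespace Mollifier

variable (ψ : Mollifier) {b : ℝ → ℝ}

/-- At times `t ≥ 0` the regularisation averages values of `b` on `[0, ∞)` against a probability
density. -/
theorem le_net_distOf (hb : LocallyIntegrableOn b (Ici 0)) {r : ℝ} (hr : ∀ t, 0 ≤ t → r ≤ b t)
    (ε : Eps) {t : ℝ} (ht : 0 ≤ t) : r ≤ ψ.net (distOf b) ε t := by
  obtain ⟨R, hR, hR'⟩ := ψ.exists_radius_scale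
  have hs := ψ.hasCompactSupport_scale ε.pos.ne'
  have hi : Integrable (ψ.scale ε) :=
    (ψ.contDiff_scale ε).continuous.integrable_of_hasCompactSupport hs
  have h1 : r = ∫ τ, r * ψ.scale ε (t - τ) := by
    rw [integral_const_mul, integral_sub_left_eq_self, ψ.integral_scale ε.pos, mul_one]
  rw [ψ.net_distOf hb ε ht, h1]
  refine integral_mono ((hi.comp_sub_left t).const_mul r)
    (hs.convolutionExists_right (ContinuousLinearMap.mul ℝ ℝ) (locallyIntegrable_indicator hb)
      (ψ.contDiff_scale ε).continuous t) fun τ => ?_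
  by_cases h0 : ψ.scale ε (t - τ) = 0
  · simp only [h0, mul_zero, le_refl]
  · have h2 := (hR' ε ε.pos 0 _ (by simpa using h0)).2
    have h3 : τ ∈ Ici (0 : ℝ) := by simp only [mem_Ici]; linarith
    show r * ψ.scale ε (t - τ) ≤ (Ici 0).indicator b τ * ψ.scale ε (t - τ)
    rw [indicator_of_mem h3]
    exact mul_le_mul_of_nonneg_right (hr τ h3) (ψ.scale_nonneg ε.pos _)

/-- The kernel is itself an admissible nonnegative test function of integral one. -/
theorem le_net_of_distGE {T : 𝓓'(halfLine, ℝ)} {r : ℝ} (hT : DistGE T r) (ε : Eps) {t : ℝ}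
    (ht : 0 ≤ t) : r ≤ ψ.net T ε t := by
  have h := hT (ψ.kernel ε t ht) fun τ => by
    rw [kernel_apply]
    exact ψ.scale_nonneg ε.pos _
  simp only [kernel_apply] at h
  rwa [integral_sub_left_eq_self, ψ.integral_scale ε.pos, mul_one, ← net_of_nonneg] at h

theorem abs_indicator_le_of_monotoneOn (hb : MonotoneOn b (Ici 0)) (T : ℝ) :
    ∃ B, ∀ t ∈ Icc 0 T, |(Ici 0).indicator b t| ≤ B := by
  refine ⟨max |b 0| |b T|, fun t ht => ?_⟩
  rw [indicator_of_mem (show t ∈ Ici 0 from ht.1)]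
  exact abs_le_max_abs_abs (hb self_mem_Ici ht.1 ht.1) (hb ht.1 (ht.1.trans ht.2) ht.2)

end Mollifier

theorem IsModerate.exists_netBound {f : Eps → ℝ → ℝ} (hf : IsModerate f) (T : ℝ) (k : ℕ) :
    ∃ N : ℤ, NetBound (Icc 0 T) N fun ε t => iteratedDerivWithin k (f ε) (Ici 0) t := by
  obtain ⟨N, c, hc⟩ := hf.2 (Icc 0 T) isCompact_Icc Icc_subset_Ici_self k
  refine ⟨-((N + k : ℕ) : ℤ), c, fun ε t ht => (hc ε t ht).trans_eq ?_⟩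
  rw [zpow_neg, zpow_natCast, div_eq_mul_inv]

theorem NetBound.of_forall_nat {E : Type*} [NormedAddCommGroup E] {K : Set ℝ} {g : Eps → ℝ → E}
    (h : ∀ l : ℕ, ∃ c : ℝ, ∀ ε : Eps, ∀ t ∈ K, ‖g ε t‖ ≤ c * (ε : ℝ) ^ l) (p : ℤ) :
    NetBound K p g := by
  obtain ⟨c, hc⟩ := h p.toNat
  refine NetBound.mono ⟨c, fun ε t ht => ?_⟩ (Int.self_le_toNat p)
  rw [zpow_natCast]
  exact hc ε t ht

theorem IsNegligible.netBound {f : Eps → ℝ → ℝ} (hf : IsNegligible f) (T : ℝ) (k : ℕ) (p : ℤ) :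
    NetBound (Icc 0 T) p fun ε t => iteratedDerivWithin k (f ε) (Ici 0) t :=
  .of_forall_nat (hf (Icc 0 T) isCompact_Icc Icc_subset_Ici_self k) p

/-- A net that differs from a net bounded below by a negligible one is eventually bounded below. -/
theorem IsNegligible.exists_le {f g : Eps → ℝ → ℝ} (hfg : IsNegligible (f - g)) {r r' : ℝ}
    (hr : r' < r) (hg : ∀ ε t, 0 ≤ t → r ≤ g ε t) (T : ℝ) :
    ∃ ε₀ : ℝ, 0 < ε₀ ∧ ∀ ε : Eps, (ε : ℝ) ≤ ε₀ → ∀ t ∈ Icc 0 T, r' ≤ f ε t := by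
  obtain ⟨c, hc⟩ := hfg (Icc 0 T) isCompact_Icc Icc_subset_Ici_self 0 1
  have hr0 : 0 < r - r' := sub_pos.2 hr
  -- With this threshold the difference, at most `|c| ε` in size, does not exceed the gap `r - r'`.
  refine ⟨(r - r') / (|c| + 1), by positivity, fun ε hε t ht => ?_⟩
  have h1 := hc ε t ht
  rw [iteratedDerivWithin_zero, pow_one, Pi.sub_apply, Pi.sub_apply, abs_le] at h1
  rw [le_div_iff₀ (by positivity)] at hε
  have h2 : c * ε ≤ |c| * ε := mul_le_mul_of_nonneg_right (le_abs_self c) ε.pos.le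
  nlinarith [h1.1, hg ε t ht.1, ε.pos]

/-! ### The Cauchy problem on the frequency side -/

namespace Sobolev

open FreqSpace

variable {n : ℕ} {s : ℝ}

theorem solvesCauchyProblem_iff {b b' : ℝ → ℝ} {u : ℝ → Sobolev n s} (hu : IsSmoothCurve u)
    (v₀ : Sobolev n s) (v₁ : Sobolev n (s - (1 : ℕ))) :
    SolvesCauchyProblem b b' (toDist v₀) (toDist v₁) u ↔
      (∀ t, 0 ≤ t → b t ≠ 0) ∧
      (∀ t, 0 ≤ t → waveMain (incl n) ((2 * Real.pi) ^ 2) 0 (fun t => toFreq n s (u t)) t +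
        (b' t / b t) • incl n (scaleDeriv (incl n) 1 (fun t => toFreq n s (u t)) t) = 0) ∧
      toFreq n s (u 0) = toFreq n s v₀ ∧
      scaleDeriv (incl n) 1 (fun t => toFreq n s (u t)) 0 = toFreq n _ v₁ := by
  refine and_congr Iff.rfl (and_congr (forall₂_congr fun t ht => ?_) (and_congr ?_ ?_))
  · rw [wave_equation_iff, toFreq_timeDeriv hu 2 ht, toFreq_timeDeriv hu 1 ht, waveMain,
      scaleDeriv_zero]
  · rw [toDist_injective.eq_iff, (toFreq n s).injective.eq_iff]
  · rw [toDist_injective.eq_iff, ← toFreq_timeDeriv hu 1 le_rfl, (toFreq n _).injective.eq_iff]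

theorem exists_netBound_of_isModerateSobolev {u : Eps → ℝ → Sobolev n s}
    (hu : IsModerateSobolev u) (T : ℝ) (k : ℕ) :
    ∃ N : ℤ, NetBound (Icc 0 T) N fun ε t =>
      scaleDeriv (incl n) k (fun t => toFreq n s (u ε t)) t := by
  obtain ⟨N, h⟩ := hu.2 (Icc 0 T) isCompact_Icc Icc_subset_Ici_self
  obtain ⟨c, hc⟩ := h k
  refine ⟨-((N + k : ℕ) : ℤ), c, fun ε t ht => ?_⟩
  rw [← norm_timeDeriv (hu.1 ε) k ht.1, zpow_neg, zpow_natCast, ← div_eq_mul_inv]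
  exact hc ε t ht

theorem isModerateSobolev_of_netBound {X : Eps → ℝ → FreqSpace n}
    (hX : ∀ ε, IsScaleSmooth (incl n) (X ε))
    (hb : ∀ T (k : ℕ), NetBound (Icc 0 T) (-k) fun ε t => scaleDeriv (incl n) k (X ε) t) :
    IsModerateSobolev fun ε t => (toFreq n s).symm (X ε t) := by
  -- The bounds `O(ε^{-k})` make `N = 0` work for all `k` at once, as moderateness in this scale
  -- demands an `N` independent of `k`.
  refine ⟨fun ε => isSmoothCurve_toFreq_symm (hX ε), fun K hK hK0 => ⟨0, fun k => ?_⟩⟩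
  obtain ⟨T, hT⟩ := exists_subset_Icc hK hK0
  obtain ⟨c, hc⟩ := hb T k
  refine ⟨c, fun ε t ht => ?_⟩
  rw [norm_timeDeriv (isSmoothCurve_toFreq_symm (hX ε)) k (hK0 ht), zero_add, div_eq_mul_inv,
    ← zpow_natCast, ← zpow_neg]
  simpa using hc ε t (hT ht)

theorem one_le_two_pi_sq : 1 ≤ (2 * Real.pi) ^ 2 := by
  nlinarith [Real.pi_gt_three]

variable {b : ℝ → ℝ} {b₀ b₀' : ℝ}

/-- The regularisations themselves serve as representatives: they satisfy `b_ε ≥ b₀` and `b'_ε ≥ b₀'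
≥ 0` for every `ε`, and monotonicity provides the local bound behind the exact powers. -/
theorem exists_isColombeauSolution (ψ : Mollifier) (hb₀ : 0 < b₀) (hb₀' : 0 ≤ b₀')
    (hmono : MonotoneOn b (Ici 0)) (hlow : ∀ t, 0 ≤ t → b₀ ≤ b t)
    (hderiv : DistGE (distDeriv (distOf b)) b₀') (v₀ : Sobolev n s)
    (v₁ : Sobolev n (s - (1 : ℕ))) :
    ∃ U : ColombeauSobolev n s, IsColombeauSolution
      (ψ.embedding (coeffDist b (locallyIntegrableOn_of_monotoneOn hmono)))
      (ψ.embedding (coeffDerivDist b (locallyIntegrableOn_of_monotoneOn hmono)))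
      (toDist v₀) (toDist v₁) U := by
  have hb := locallyIntegrableOn_of_monotoneOn hmono
  have hbd := ψ.netBound_convol_of_bounded (locallyIntegrable_indicator hb)
    (Mollifier.abs_indicator_le_of_monotoneOn hmono)
  obtain ⟨X, hX, heq, h0, h1, hbX⟩ := (cutoffInverse n).exists_net_solution one_le_two_pi_sq
    (β := ψ.net (distOf b)) (β' := ψ.net (distDeriv (distOf b)))
    (ψ.contDiffOn_net_distOf hb) (ψ.contDiffOn_net_distDeriv hb) hb₀
    (fun ε t ht => ψ.le_net_distOf hb hlow ε ht)
    (fun ε t ht => hb₀'.trans (ψ.le_net_of_distGE hderiv ε ht))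
    (fun T l => (hbd T l).congr fun ε t ht => ψ.iteratedDerivWithin_net_distOf hb ε l ht.1)
    (fun T l => ((hbd T (l + 1)).congr fun ε t ht =>
      ψ.iteratedDerivWithin_net_distDeriv hb ε l ht.1).mono (by push_cast; omega))
    (toFreq n s v₀) (toFreq n _ v₁)
  refine ⟨QuotientAddGroup.mk ⟨_, isModerateSobolev_of_netBound hX hbX⟩, _, _, _, rfl, rfl, rfl,
    fun ε => ?_⟩
  refine (solvesCauchyProblem_iff (isSmoothCurve_toFreq_symm (hX ε)) v₀ v₁).2 ?_
  simp only [LinearIsometryEquiv.apply_symm_apply]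
  exact ⟨fun t ht => (hb₀.trans_le (ψ.le_net_distOf hb hlow ε ht)).ne', heq ε, h0 ε, h1 ε⟩

theorem isColombeauSolution_unique (ψ : Mollifier) (hb₀ : 0 < b₀) (hb₀' : 0 < b₀')
    (hmono : MonotoneOn b (Ici 0)) (hlow : ∀ t, 0 ≤ t → b₀ ≤ b t)
    (hderiv : DistGE (distDeriv (distOf b)) b₀') (v₀ : Sobolev n s)
    (v₁ : Sobolev n (s - (1 : ℕ))) {U V : ColombeauSobolev n s}
    (hU : IsColombeauSolution
      (ψ.embedding (coeffDist b (locallyIntegrableOn_of_monotoneOn hmono)))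
      (ψ.embedding (coeffDerivDist b (locallyIntegrableOn_of_monotoneOn hmono)))
      (toDist v₀) (toDist v₁) U)
    (hV : IsColombeauSolution
      (ψ.embedding (coeffDist b (locallyIntegrableOn_of_monotoneOn hmono)))
      (ψ.embedding (coeffDerivDist b (locallyIntegrableOn_of_monotoneOn hmono)))
      (toDist v₀) (toDist v₁) V) : U = V := by
  have hb := locallyIntegrableOn_of_monotoneOn hmono
  obtain ⟨u, β, β', rfl, hβ, hβ', hu⟩ := hU
  obtain ⟨v, γ, γ', rfl, hγ, hγ', hv⟩ := hV
  have hu0 : IsModerateSobolev (u : Eps → ℝ → Sobolev n s) := u.2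
  have hv0 : IsModerateSobolev (v : Eps → ℝ → Sobolev n s) := v.2
  have hβ0 : IsModerate (β : Eps → ℝ → ℝ) := β.2
  have hβ0' : IsModerate (β' : Eps → ℝ → ℝ) := β'.2
  have hγ0 : IsModerate (γ : Eps → ℝ → ℝ) := γ.2
  have hγ0' : IsModerate (γ' : Eps → ℝ → ℝ) := γ'.2
  have hβn : IsNegligible ((β : Eps → ℝ → ℝ) - ψ.net (distOf b)) := Ideal.Quotient.eq.1 hβ
  have hγn : IsNegligible ((γ : Eps → ℝ → ℝ) - ψ.net (distOf b)) := Ideal.Quotient.eq.1 hγ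
  have hβn' : IsNegligible ((β' : Eps → ℝ → ℝ) - ψ.net (distDeriv (distOf b))) :=
    Ideal.Quotient.eq.1 hβ'
  have hd : IsNegligible ((γ : Eps → ℝ → ℝ) - β) := Ideal.Quotient.eq.1 (hγ.trans hβ.symm)
  have hd' : IsNegligible ((γ' : Eps → ℝ → ℝ) - β') := Ideal.Quotient.eq.1 (hγ'.trans hβ'.symm)
  have hsu := fun ε => (solvesCauchyProblem_iff (hu0.1 ε) v₀ v₁).1 (hu ε)
  have hsv := fun ε => (solvesCauchyProblem_iff (hv0.1 ε) v₀ v₁).1 (hv ε)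
  have hsub : IsModerateSobolev
      ((u : Eps → ℝ → Sobolev n s) - (v : Eps → ℝ → Sobolev n s)) := (u - v).2
  refine QuotientAddGroup.eq_iff_sub_mem.2 fun K hK hK0 k p => ?_
  obtain ⟨T, hT⟩ := exists_subset_Icc hK hK0
  obtain ⟨ε₁, hε₁, h₁⟩ := hβn.exists_le (half_lt_self hb₀)
    (fun ε t ht => ψ.le_net_distOf hb hlow ε ht) T
  obtain ⟨ε₂, hε₂, h₂⟩ := hγn.exists_le (half_lt_self hb₀)
    (fun ε t ht => ψ.le_net_distOf hb hlow ε ht) T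
  -- A representative of `b'` may dip below the regularisation by a negligible amount; the strict
  -- inequality `b₀' > 0` keeps it nonnegative on `[0, T]` for small `ε`.
  obtain ⟨ε₃, hε₃, h₃⟩ := hβn'.exists_le hb₀' (fun ε t ht => ψ.le_net_of_distGE hderiv ε ht) T
  obtain ⟨c, hc⟩ := (cutoffInverse n).netBound_sub one_le_two_pi_sq
    (fun ε => isScaleSmooth_toFreq (hu0.1 ε)) (fun ε => isScaleSmooth_toFreq (hv0.1 ε))
    (exists_netBound_of_isModerateSobolev hu0 T) (exists_netBound_of_isModerateSobolev hv0 T)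
    hβ0.1 hβ0'.1 hγ0.1 hγ0'.1 (hβ0.exists_netBound T) (hβ0'.exists_netBound T)
    (hd.netBound T) (hd'.netBound T) (lt_min hε₁ (lt_min hε₂ hε₃)) (half_pos hb₀)
    (fun ε hε => h₁ ε (hε.trans (min_le_left _ _)))
    (fun ε hε => h₂ ε (hε.trans ((min_le_right _ _).trans (min_le_left _ _))))
    (fun ε hε => h₃ ε (hε.trans ((min_le_right _ _).trans (min_le_right _ _))))
    (fun ε => (hsu ε).1) (fun ε => (hsv ε).1) (fun ε => (hsu ε).2.1) (fun ε => (hsv ε).2.1)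
    (fun ε => (hsu ε).2.2.1.trans (hsv ε).2.2.1.symm)
    (fun ε => (hsu ε).2.2.2.trans (hsv ε).2.2.2.symm) k p
  refine ⟨c, fun ε t ht => ?_⟩
  refine (norm_timeDeriv (hsub.1 ε) k (hK0 ht)).le.trans ?_
  rw [← zpow_natCast]
  have e : (fun t => toFreq n s (((u : Eps → ℝ → Sobolev n s) - (v : Eps → ℝ → Sobolev n s)) ε t)) =
      (fun t => toFreq n s ((u : Eps → ℝ → Sobolev n s) ε t)) -
        fun t => toFreq n s ((v : Eps → ℝ → Sobolev n s) ε t) :=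
    funext fun τ => map_sub (toFreq n s) _ _
  rw [e]
  exact hc ε t (hT ht)

end Sobolev

/-! ### The theorem -/

open Sobolev

theorem mainTheorem2 (n : ℕ) (hn : 1 ≤ n) (b : ℝ → ℝ) (b₀ b₀' : ℝ)
    (hb₀ : 0 < b₀) (hb₀' : 0 < b₀')
    (hpc : IsPiecewiseContinuous b) (hmono : MonotoneOn b (Ici 0))
    (hlow : ∀ t, 0 ≤ t → b₀ ≤ b t)
    (hderiv : DistGE (distDeriv (distOf b)) b₀')
    (s : ℝ) (hs : 0 < s) (u₀ u₁ : 𝓢'(EuclideanSpace ℝ (Fin n), ℂ))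
    (hu₀ : MemSobolev s 2 u₀) (hu₁ : MemSobolev (s - 1) 2 u₁) :
    ∃ ι : firstOrderDist →ₗ[ℝ] ColombeauAlgebra,
      Function.Injective ι ∧ (∃ ψ : Mollifier, IsRegularisation ψ ι) ∧
      ∃! U : ColombeauSobolev n s, IsColombeauSolution
        (ι (coeffDist b (locallyIntegrableOn_of_monotoneOn hmono)))
        (ι (coeffDerivDist b (locallyIntegrableOn_of_monotoneOn hmono))) u₀ u₁ U := by
  obtain ⟨ψ⟩ := Mollifier.nonempty
  let v₀ : Sobolev n s := ⟨u₀, hu₀⟩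
  let v₁ : Sobolev n (s - (1 : ℕ)) := ⟨u₁, by rwa [Nat.cast_one]⟩
  obtain ⟨U, hU⟩ := exists_isColombeauSolution ψ hb₀ hb₀'.le hmono hlow hderiv v₀ v₁
  exact ⟨ψ.embedding, ψ.embedding_injective, ⟨ψ, ψ.isRegularisation_embedding⟩, U, hU,
    fun V hV => isColombeauSolution_unique ψ hb₀ hb₀' hmono hlow hderiv v₀ v₁ hV hU⟩

end
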